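/- **Setting.** Let $R$ be a $d\times d$ integer matrix all of whose eigenvalues have absolute value $>1$, $S=R^T$, and let $B,L\subset\mathbb Z^d$ be finite with $0\in B$ and $\#B=\#L=N$, such that $(R,B,L)$ is a Hadamard triple, i.e. the matrix $N^{-1/2}(e^{2\pi i R^{-1}b\cdot l})_{b\in B,l\in L}$ is unitary. Let $\mu_B$ be the invariant probability measure of the maps $x\mapsto R^{-1}(x+b)$, $b\in B$, with equal weights, $\hat\mu_B(x)=\int e^{2\pi i x\cdot y}\,d\mu_B(y)$, $W_B(x)=\bigl|\frac1N\sum_{b\in B}e^{2\pi i b\cdot x}\bigr|^2$ and $\tau_l(x)=S^{-1}(x+l)$ for $l\in L$. For $x\in\mathbb R^d$ let $P_x$ be the probability measure on $\Omega=L^{\mathbb N}$ with $P_x(\omega_1=l_1,\dots,\omega_n=l_n)=\prod_{k=1}^n W_B(\tau_{l_k}\cdots\tau_{l_1}x)$. A closed set $F\subset\mathbb R^d$ is invariant if it contains, for each $x\in F$, the closure of all the trajectories $\{\tau_{\omega_n}\cdots\tau_{\omega_1}x\mid n\ge1\}$, $\omega\in\Omega$, with $W_B(\tau_{\omega_n}\cdots\tau_{\omega_1}x)\ne0$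 for all $n\ge 1$; a nonempty invariant set is minimal if it contains no smaller nonempty invariant set. Put $N(F)=\{\omega\in\Omega\mid \lim_n d(\tau_{\omega_n}\cdots\tau_{\omega_1}x,F)=0\}$ (independent of $x$) and $h_F(x)=P_x(N(F))$. A Hadamard triple $(R',B',L')$ in $\mathbb Z^r\times\mathbb Z^t$ is reducible to $\mathbb R^r$ if: $(R')^T=\begin{pmatrix}S_1&C\\0&S_2\end{pmatrix}$; $B'=\{(r_i,\eta_{i,j})\}$ and $L'=\{(\gamma_{i,j},s_j)\}$, $1\le i\le N_1$, $1\le j\le N_2$; $(S_1^T,\{r_i\}_i,\{\gamma_{i,j}\}_i)$ is a Hadamard triple for each $j$ and $(S_2^T,\{\eta_{i,j}\}_j,\{s_j\}_j)$ is one for each $i$; and the invariant measure $\mu_1$ of the maps $\tau_{r_i}(x)=(S_1^T)^{-1}(x+r_i)$ on $\mathbb R^r$, with attractor $X_1$, is spectral (some family $\{e^{2\pi i\lambda\cdot x}\}_{\lambda\in\Lambda_1}$, $\Lambda_1\subset\mathbb R^r$, called a spectrum of $\mu_1$, is an orthonormal basis of $L^2(\mu_1)$) and has no overlap ($\mu_1(\tau_{r_i}(X_1)\cap\tau_{r_j}(X_1))=0$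 for $i\ne j$). A subspace $V\subset\mathbb R^d$ is reducing if for some $r+t=d$ and some $U\in GL_d(\mathbb Z)$ the triple $(URU^{-1},UB,(U^T)^{-1}L)$ is reducible to $\mathbb R^r$ and $(U^T)^{-1}V=\mathbb R^r\times\{0\}$. **Proposition.** Let $M$ be a minimal compact invariant set, let $V$ be a reducing subspace, and let $\mathcal C=\{x_0,\tau_{l_1}x_0,\dots,\tau_{l_{m-1}}\cdots\tau_{l_1}x_0\}$ be a cycle of $m\ge1$ distinct points, with $l_1,\dots,l_m\in L$ and $\tau_{l_m}\cdots\tau_{l_1}x_0=x_0$, such that $M$ is contained in $\mathcal R:=\mathcal C+V$ and $\mathcal R$ is invariant. Then there is a set $\Lambda(M)\subset\mathbb R^d$ such that $$h_{\mathcal R}(x)=P_x(N(\mathcal R))=\sum_{\lambda\in\Lambda(M)}|\hat\mu_B(x+\lambda)|^2\qquad(x\in\mathbb R^d).$$ More precisely, for every $U$ as in the definition of a reducing subspace (with the notation above for the conjugate triple) and every spectrum $\Lambda_1$ of the corresponding measure $\mu_1$, one can take $$\Lambda(M)=\{U^T(\lambda_1,k_{\mathcal C}(\omega))\mid \lambda_1\in\Lambda_1,\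 n\ge0,\ \omega\in\{s_1,\dots,s_{N_2}\}^n\},\qquad k_{\mathcal C}(\omega)=\omega_0+S_2\omega_1+\dots+S_2^{n-1}\omega_{n-1}-S_2^{n}y_0,$$ where $y_0\in\mathbb R^t$ is the second component of $(U^T)^{-1}x_0$; each element of this set is counted once. If $\Lambda_1\subset\mathbb Z^r$ and $y_0\in\mathbb Z^t$, then $\Lambda(M)\subset\mathbb Z^d$. -/

import Mathlib

namespace AffineIFS

open MeasureTheory ProbabilityTheory Filter Topology
open scoped Matrix

noncomputable section

/-! Throughout, `ι → ℝ` is `ℝ^d` with `d = card ι`; its norm is only used through notions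
(limits, closed sets, compact sets, Borel sets) that do not depend on the choice of a norm. -/

variable {ι : Type} [Fintype ι] [DecidableEq ι]

set_option linter.unusedSectionVars false

/-- An integer matrix, seen as a real matrix. -/
def realMat {m n : Type} (R : Matrix m n ℤ) : Matrix m n ℝ := R.map (Int.cast : ℤ → ℝ)

/-- An integer vector, seen as a real vector. -/
def realVec {n : Type} (b : n → ℤ) : n → ℝ := fun i => (b i : ℝ)

/-- All (complex) eigenvalues have absolute value strictly bigger than one. -/
def IsExpansive (R : Matrix ι ι ℤ) : Prop :=
  ∀ z ∈ spectrum ℂ (R.map (Int.cast : ℤ → ℂ)), 1 < ‖z‖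

/-- The affine map `τ_b x = R⁻¹ (x + b)`. -/
def branch (R : Matrix ι ι ℤ) (b : ι → ℤ) (x : ι → ℝ) : ι → ℝ :=
  (realMat R)⁻¹ *ᵥ (x + realVec b)

/-- The exponential `e^{2πi x·y}`. -/
def character (x y : ι → ℝ) : ℂ := Complex.exp (2 * Real.pi * Complex.I * ((x ⬝ᵥ y : ℝ) : ℂ))

/-! ### The invariant measure, Fourier transforms and spectra -/

/-- The point `∑_{k ≥ 1} R^{-k} b_k` coded by a digit sequence (indexed from `0`). -/
def coding (R : Matrix ι ι ℤ) (ω : ℕ → ι → ℤ) : ι → ℝ :=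
  ∑' k : ℕ, ((realMat R)⁻¹ ^ (k + 1)) *ᵥ realVec (ω k)

/-- The attractor `X_B = {∑_{k ≥ 1} R^{-k} b_k | b_k ∈ B}`. -/
def attractor (R : Matrix ι ι ℤ) (B : Finset (ι → ℤ)) : Set (ι → ℝ) :=
  coding R '' {ω | ∀ k, ω k ∈ B}

open Classical in
/-- The invariant measure `μ_B` of the system `(τ_b)_{b ∈ B}` with equal weights: the law of
`∑_{k ≥ 1} R^{-k} b_k` with `b_k` independent and uniformly distributed in `B`
(`isInvariant_invariantMeasure` below is its invariance; the value for empty `B` is never used). -/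
def invariantMeasure (R : Matrix ι ι ℤ) (B : Finset (ι → ℤ)) : Measure (ι → ℝ) :=
  if hB : B.Nonempty then
    (Measure.infinitePi fun _ : ℕ => (PMF.uniformOfFinset B hB).toMeasure).map (coding R)
  else 0

/-- `μ` is a probability measure with `∫ f dμ = N⁻¹ ∑_{b ∈ B} ∫ f ∘ τ_b dμ` for all bounded
continuous `f`. -/
def IsInvariantMeasure (R : Matrix ι ι ℤ) (B : Finset (ι → ℤ)) (μ : Measure (ι → ℝ)) : Prop :=
  IsProbabilityMeasure μ ∧ ∀ f : BoundedContinuousFunction (ι → ℝ) ℝ,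
    ∫ x, f x ∂μ = (B.card : ℝ)⁻¹ * ∑ b ∈ B, ∫ x, f (branch R b x) ∂μ

/-- `μ̂(x) = ∫ e^{2πi x·y} dμ(y)`. -/
def fourier (μ : Measure (ι → ℝ)) (x : ι → ℝ) : ℂ := ∫ y, character x y ∂μ

/-- The exponentials `e^{2πi λ·x}`, `λ ∈ Λ`, form an orthonormal basis of `L²(μ)`. -/
def IsSpectrum (μ : Measure (ι → ℝ)) (Λ : Set (ι → ℝ)) : Prop :=
  ∃ e : HilbertBasis Λ ℂ (Lp ℂ 2 μ), ∀ l : Λ, (e l : (ι → ℝ) → ℂ) =ᵐ[μ] character (l : ι → ℝ)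

/-! ### Hadamard triples -/

/-- `N^{-1/2} (e^{2πi R⁻¹b·l})_{b,l}` for two families of integer vectors. -/
def hadamardMatrix {κ κ' : Type} [Fintype κ] (R : Matrix ι ι ℤ) (b : κ → ι → ℤ)
    (l : κ' → ι → ℤ) : Matrix κ κ' ℂ :=
  Matrix.of fun i j => ((Real.sqrt (Fintype.card κ))⁻¹ : ℂ) *
    character ((realMat R)⁻¹ *ᵥ realVec (b i)) (realVec (l j))

/-- Two families of the same size whose exponential matrix is unitary. -/
def IsHadamardFamily {κ κ' : Type} [Fintype κ] [Fintype κ'] [DecidableEq κ] [DecidableEq κ']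
    (R : Matrix ι ι ℤ) (b : κ → ι → ℤ) (l : κ' → ι → ℤ) : Prop :=
  Fintype.card κ = Fintype.card κ' ∧
  hadamardMatrix R b l * (hadamardMatrix R b l)ᴴ = 1 ∧
  (hadamardMatrix R b l)ᴴ * hadamardMatrix R b l = 1

/-- `(R, B, L)` is a Hadamard triple. -/
def IsHadamardTriple (R : Matrix ι ι ℤ) (B L : Finset (ι → ℤ)) : Prop :=
  IsHadamardFamily R (fun b : B => (b : ι → ℤ)) (fun l : L => (l : ι → ℤ))

/-! ### The random walk and its path measures -/

/-- `W_B(x) = |N⁻¹ ∑_{b ∈ B} e^{2πi b·x}|²`. -/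
def weight (B : Finset (ι → ℤ)) (x : ι → ℝ) : ℝ :=
  ‖(B.card : ℂ)⁻¹ * ∑ b ∈ B, character (realVec b) x‖ ^ 2

/-- `τ_{ω_n} ⋯ τ_{ω_1} x` for the dual maps `τ_l x = S⁻¹ (x + l)`, `S = Rᵀ` (the digits
`ω_1, ω_2, …` are `ω 0, ω 1, …`). -/
def walk (R : Matrix ι ι ℤ) (ω : ℕ → ι → ℤ) (x : ι → ℝ) : ℕ → ι → ℝ
  | 0 => x
  | n + 1 => branch Rᵀ (ω n) (walk R ω x n)

theorem character_add_right (x y z : ι → ℝ) :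
    character x (y + z) = character x y * character x z := by
  simp only [character, dotProduct_add, ← Complex.exp_add]
  congr 1; push_cast; ring

theorem star_character (x y : ι → ℝ) : star (character x y) = character (-x) y := by
  simp only [character, ← starRingEnd_apply, ← Complex.exp_conj, neg_dotProduct]
  congr 1
  simp only [map_mul, Complex.conj_I, Complex.conj_ofReal, map_ofNat]
  push_cast; ring

theorem star_character_mul_self (x y : ι → ℝ) : character x y * star (character x y) = 1 := by
  rw [star_character, character, character, ← Complex.exp_add, neg_dotProduct]
  push_cast
  rw [show (2 * Real.pi * Complex.I * ((x ⬝ᵥ y : ℝ) : ℂ) +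
    2 * Real.pi * Complex.I * -((x ⬝ᵥ y : ℝ) : ℂ)) = 0 by ring, Complex.exp_zero]

theorem character_inv_transpose (R : Matrix ι ι ℤ) (b : ι → ℤ) (x : ι → ℝ) :
    character (realVec b) ((realMat Rᵀ)⁻¹ *ᵥ x) = character ((realMat R)⁻¹ *ᵥ realVec b) x := by
  have h : (realMat Rᵀ)⁻¹ = ((realMat R)⁻¹)ᵀ := by
    rw [Matrix.transpose_nonsing_inv]; rfl
  rw [character, character, h, Matrix.mulVec_transpose, dotProduct_comm,
    ← Matrix.dotProduct_mulVec, dotProduct_comm]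

theorem weight_nonneg (B : Finset (ι → ℤ)) (x : ι → ℝ) : 0 ≤ weight B x := sq_nonneg _

/-- The transition probabilities out of a point add up to one. -/
theorem sum_weight {R : Matrix ι ι ℤ} {B L : Finset (ι → ℤ)} (hH : IsHadamardTriple R B L)
    (hB : B.Nonempty) (x : ι → ℝ) : ∑ l ∈ L, weight B (branch Rᵀ l x) = 1 := by
  classical
  have hN : (B.card : ℂ) ≠ 0 := by exact_mod_cast hB.card_pos.ne'
  -- orthogonality of the rows
  have horth : ∀ b b' : B, (B.card : ℂ)⁻¹ * ∑ l ∈ L,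
      character ((realMat R)⁻¹ *ᵥ realVec b) (realVec l) *
        star (character ((realMat R)⁻¹ *ᵥ realVec b') (realVec l)) = if b = b' then 1 else 0 := by
    intro b b'
    have h := congrFun (congrFun hH.2.1 b) b'
    rw [Matrix.mul_apply, Matrix.one_apply] at h
    rw [← h, ← Finset.sum_coe_sort, Finset.mul_sum]
    refine Finset.sum_congr rfl fun l _ => ?_
    simp only [hadamardMatrix, Matrix.conjTranspose_apply, Matrix.of_apply, star_mul',
      Fintype.card_coe]
    have hs : ((Real.sqrt B.card : ℝ) : ℂ)⁻¹ * star (((Real.sqrt B.card : ℝ) : ℂ)⁻¹)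
        = (B.card : ℂ)⁻¹ := by
      rw [← Complex.ofReal_inv, ← starRingEnd_apply, Complex.conj_ofReal, ← Complex.ofReal_mul,
        ← mul_inv, Real.mul_self_sqrt (Nat.cast_nonneg _)]
      push_cast; rfl
    rw [← hs]; ring
  have key : ∀ l : ι → ℤ, ((weight B (branch Rᵀ l x) : ℝ) : ℂ) =
      (B.card : ℂ)⁻¹ * ∑ b ∈ B.attach, ∑ b' ∈ B.attach,
        (character ((realMat R)⁻¹ *ᵥ realVec b) x *
          star (character ((realMat R)⁻¹ *ᵥ realVec b') x)) * ((B.card : ℂ)⁻¹ *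
        (character ((realMat R)⁻¹ *ᵥ realVec b) (realVec l) *
          star (character ((realMat R)⁻¹ *ᵥ realVec b') (realVec l)))) := by
    intro l
    rw [weight]
    push_cast
    rw [← Complex.mul_conj']
    rw [← Finset.sum_attach B]
    simp only [branch, character_inv_transpose, character_add_right, map_mul, map_sum, map_inv₀,
      Complex.conj_natCast]
    rw [show ∀ a s t : ℂ, a * s * (a * t) = a * (a * (s * t)) by intros; ring,
      Finset.sum_mul_sum, Finset.mul_sum]
    congr 1
    refine Finset.sum_congr rfl fun b _ => ?_
    rw [Finset.mul_sum]
    refine Finset.sum_congr rfl fun b' _ => ?_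
    simp only [starRingEnd_apply]
    ring
  have : ((∑ l ∈ L, weight B (branch Rᵀ l x) : ℝ) : ℂ) = 1 := by
    push_cast
    simp only [key]
    rw [← Finset.mul_sum, Finset.sum_comm]
    have : ∀ b ∈ B.attach, (∑ l ∈ L, ∑ b' ∈ B.attach,
        (character ((realMat R)⁻¹ *ᵥ realVec b) x *
          star (character ((realMat R)⁻¹ *ᵥ realVec b') x)) * ((B.card : ℂ)⁻¹ *
        (character ((realMat R)⁻¹ *ᵥ realVec b) (realVec l) *
          star (character ((realMat R)⁻¹ *ᵥ realVec b') (realVec l))))) = 1 := by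
      intro b _
      rw [Finset.sum_comm]
      simp only [← Finset.mul_sum, horth]
      rw [Finset.sum_eq_single b (fun b' _ h => by simp [h.symm]) (by simp), if_pos rfl, mul_one,
        star_character_mul_self]
    rw [Finset.sum_congr rfl this]
    simp [hN]
  exact_mod_cast this

/-- The law of the first digit of the walk started at `x`: the digit `l` has probability
`W_B(τ_l x)`. -/
def stepLaw {R : Matrix ι ι ℤ} {B L : Finset (ι → ℤ)} (hH : IsHadamardTriple R B L)
    (hB : B.Nonempty) (x : ι → ℝ) : PMF L :=
  PMF.ofFintype (fun l => ENNReal.ofReal (weight B (branch Rᵀ l x))) <| by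
    rw [← ENNReal.ofReal_sum_of_nonneg (fun _ _ => weight_nonneg _ _),
      Finset.sum_coe_sort L fun l => weight B (branch Rᵀ l x), sum_weight hH hB, ENNReal.ofReal_one]

/-- A finite sequence of digits, extended by zeros. -/
def extendWord {L : Finset (ι → ℤ)} {n : ℕ} (w : (i : Finset.Iic n) → (fun _ : ℕ => L) i) :
    ℕ → ι → ℤ :=
  fun i => if h : i ∈ Finset.Iic n then (w ⟨i, h⟩ : L) else 0

/-- The conditional law of the next digit of the walk started at `x`, given the first `n + 1`. -/
def stepKernel {R : Matrix ι ι ℤ} {B L : Finset (ι → ℤ)} (hH : IsHadamardTriple R B L)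
    (hB : B.Nonempty) (x : ι → ℝ) (n : ℕ) :
    Kernel ((i : Finset.Iic n) → (fun _ : ℕ => L) i) L :=
  Kernel.ofFunOfCountable fun w => (stepLaw hH hB (walk R (extendWord w) x (n + 1))).toMeasure

instance {R : Matrix ι ι ℤ} {B L : Finset (ι → ℤ)} (hH : IsHadamardTriple R B L)
    (hB : B.Nonempty) (x : ι → ℝ) (n : ℕ) : IsMarkovKernel (stepKernel hH hB x n) :=
  ⟨fun w => PMF.toMeasure.isProbabilityMeasure
    (stepLaw hH hB (walk R (extendWord w) x (n + 1)))⟩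

/-- The path measure `P_x` on `Ω = L^ℕ`. -/
def pathMeasure {R : Matrix ι ι ℤ} {B L : Finset (ι → ℤ)} (hH : IsHadamardTriple R B L)
    (hB : B.Nonempty) (x : ι → ℝ) : Measure (ℕ → L) :=
  (stepLaw hH hB x).toMeasure.bind fun l =>
    Kernel.traj (X := fun _ => L) (stepKernel hH hB x) 0 fun _ => l

theorem extendWord_frestrict {L : Finset (ι → ℤ)} (n : ℕ) (w : ℕ → L) (x : ι → ℝ)
    (R : Matrix ι ι ℤ) (k : ℕ) (hk : k ≤ n + 1) :
    walk R (extendWord (n := n) fun i => w i) x k = walk R (fun i => (w i : ι → ℤ)) x k := by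
  induction k with
  | zero => rfl
  | succ k ih =>
    have : k ∈ Finset.Iic n := by simp; omega
    simp only [walk, ih (by omega), extendWord, this, dif_pos]

/-- The cylinder probabilities that determine `P_x`. -/
theorem pathMeasure_cylinder {R : Matrix ι ι ℤ} {B L : Finset (ι → ℤ)}
    (hH : IsHadamardTriple R B L) (hB : B.Nonempty) (x : ι → ℝ) (w : ℕ → L) (n : ℕ) :
    pathMeasure hH hB x {ω | ∀ i < n, ω i = w i} = ENNReal.ofReal
      (∏ k ∈ Finset.range n, weight B (walk R (fun i => (w i : ι → ℤ)) x (k + 1))) := by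
  classical
  have hmeas : Measurable fun l : L =>
      Kernel.traj (X := fun _ => L) (stepKernel hH hB x) 0 fun _ => l :=
    measurable_of_countable _
  have hpart : ∀ (n : ℕ) (l : L),
      Kernel.partialTraj (X := fun _ => L) (stepKernel hH hB x) 0 n (fun _ => l)
        {fun i : Finset.Iic n => w i} = if l = w 0 then ENNReal.ofReal
      (∏ k ∈ Finset.range n, weight B (walk R (fun i => (w i : ι → ℤ)) x (k + 2))) else 0 := by
    intro n l
    induction n with
    | zero =>
      rw [Kernel.partialTraj_self, Kernel.id_apply, Measure.dirac_apply]
      by_cases h : l = w 0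
      · rw [if_pos h, Set.indicator_of_mem]
        · simp
        · ext i : 1
          obtain ⟨i, hi⟩ := i
          obtain rfl : i = 0 := by simpa using hi
          exact h
      · rw [if_neg h, Set.indicator_of_notMem]
        intro h'
        exact h (congrFun h' ⟨0, by simp⟩)
    | succ n ih =>
      have hsing : MeasurableSet ({fun i : Finset.Iic (n + 1) => w i} :
          Set ((i : Finset.Iic (n + 1)) → (fun _ : ℕ => L) i)) :=
        measurableSet_singleton (α := Finset.Iic (n + 1) → L) _
      rw [Kernel.partialTraj_succ_of_le (Nat.zero_le n),
        Kernel.map_apply' _ (measurable_IicProdIoc (X := fun _ => L)) _ hsing,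
        Kernel.comp_apply' _ _ _ (measurable_IicProdIoc (X := fun _ => L) hsing)]
      have hpre : (IicProdIoc (X := fun _ => L) n (n + 1)) ⁻¹'
          {fun i : Finset.Iic (n + 1) => w i} =
          {fun i : Finset.Iic n => w i} ×ˢ {fun i : Finset.Ioc n (n + 1) => w i} := by
        ext ⟨u, v⟩
        simp only [Set.mem_preimage, Set.mem_singleton_iff, Set.mem_prod]
        constructor
        · intro h
          constructor
          · ext i : 1
            have hi := Finset.mem_Iic.1 i.2
            have := congrFun h ⟨i.1, by simp; omega⟩
            simpa [IicProdIoc, hi] using this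
          · ext i : 1
            have hi := Finset.mem_Ioc.1 i.2
            have := congrFun h ⟨i.1, by simp; omega⟩
            simpa [IicProdIoc, show ¬ (i.1 ≤ n) by omega] using this
        · rintro ⟨rfl, rfl⟩
          ext i : 1
          by_cases h : i.1 ≤ n <;> simp [IicProdIoc, h]
      rw [hpre]
      have hfun : ∀ u : (i : Finset.Iic n) → L,
          (Kernel.id ×ₖ (stepKernel hH hB x n).map (MeasurableEquiv.piSingleton
            (X := fun _ => L) n)) u
            ({fun i : Finset.Iic n => w i} ×ˢ {fun i : Finset.Ioc n (n + 1) => w i}) =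
          Set.indicator {fun i : Finset.Iic n => w i} (fun _ => ENNReal.ofReal
            (weight B (walk R (fun i => (w i : ι → ℤ)) x (n + 2)))) u := by
        intro u
        rw [Kernel.prod_apply, Measure.prod_prod, Kernel.id_apply, Measure.dirac_apply]
        by_cases hu : u = fun i : Finset.Iic n => w i
        · subst hu
          simp only [Set.mem_singleton_iff, Set.indicator_of_mem, Pi.one_apply, one_mul]
          rw [Kernel.map_apply' _ (MeasurableEquiv.measurable _) _ (measurableSet_singleton _)]
          have : (MeasurableEquiv.piSingleton (X := fun _ => L) n) ⁻¹'
              {fun i : Finset.Ioc n (n + 1) => w i} = {w (n + 1)} := by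
            ext v
            simp only [Set.mem_preimage, Set.mem_singleton_iff]
            constructor
            · intro h
              exact congrFun h ⟨n + 1, by simp⟩
            · rintro rfl
              ext i : 1
              obtain ⟨i, hi⟩ := i
              obtain rfl : i = n + 1 := by simp at hi; omega
              rfl
          rw [this, stepKernel]
          change (stepLaw hH hB (walk R (extendWord (n := n) fun i => w i) x (n + 1))).toMeasure _ = _
          rw [PMF.toMeasure_apply_singleton _ _ (measurableSet_singleton _),
            extendWord_frestrict n w x R (n + 1) le_rfl]
          rfl
        · simp [hu]
      rw [lintegral_congr hfun, lintegral_indicator (measurableSet_singleton _),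
        setLIntegral_const, ih]
      split_ifs with h
      · rw [Finset.prod_range_succ, ENNReal.ofReal_mul
          (Finset.prod_nonneg fun _ _ => weight_nonneg _ _), mul_comm]
      · simp
  cases n with
  | zero =>
    have : (fun l : L => Kernel.traj (X := fun _ => L) (stepKernel hH hB x) 0 (fun _ => l)
        Set.univ) = fun _ => 1 := by
      ext l; exact measure_univ
    simp only [Nat.not_lt_zero, false_imp_iff, implies_true, Set.ofPred_true, Finset.range_zero,
      Finset.prod_empty, ENNReal.ofReal_one]
    rw [pathMeasure, Measure.bind_apply MeasurableSet.univ hmeas.aemeasurable, this]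
    simp
  | succ n =>
    have hset : {ω : ℕ → L | ∀ i < n + 1, ω i = w i} =
        (Preorder.frestrictLe (π := fun _ => L) n) ⁻¹' {fun i : Finset.Iic n => w i} := by
      ext ω
      simp only [Set.mem_ofPred_eq, Set.mem_preimage, Set.mem_singleton_iff]
      constructor
      · intro h
        ext i : 1
        exact h i (by have := Finset.mem_Iic.1 i.2; omega)
      · intro h i hi
        exact congrFun h ⟨i, by simp; omega⟩
    have hm : Measurable (Preorder.frestrictLe (π := fun _ => L) n) :=
      Preorder.measurable_frestrictLe n
    have hval : ∀ l : L, Kernel.traj (X := fun _ => L) (stepKernel hH hB x) 0 (fun _ => l)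
        {ω : ℕ → L | ∀ i < n + 1, ω i = w i} = Set.indicator {w 0} (fun _ => ENNReal.ofReal
      (∏ k ∈ Finset.range n, weight B (walk R (fun i => (w i : ι → ℤ)) x (k + 2)))) l := by
      intro l
      rw [hset, ← Measure.map_apply hm (measurableSet_singleton _),
        Kernel.traj_map_frestrictLe_apply, hpart]
      simp [Set.indicator_apply]
    have hms : MeasurableSet {ω : ℕ → L | ∀ i < n + 1, ω i = w i} := by
      rw [hset]; exact hm (measurableSet_singleton _)
    rw [pathMeasure, Measure.bind_apply hms hmeas.aemeasurable, lintegral_congr hval,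
      lintegral_indicator (measurableSet_singleton _), setLIntegral_const,
      PMF.toMeasure_apply_singleton _ _ (measurableSet_singleton _), Finset.prod_range_succ',
      ENNReal.ofReal_mul (Finset.prod_nonneg fun _ _ => weight_nonneg _ _)]
    rfl

/-! ### The invariant measure is invariant -/

section Invariance

attribute [local instance] Matrix.linftyOpNormedRing Matrix.linftyOpNormedAlgebra

theorem IsExpansive.isUnit {R : Matrix ι ι ℤ} (hR : IsExpansive R) :
    IsUnit (R.map (Int.cast : ℤ → ℂ)) := by
  rw [← spectrum.zero_notMem_iff ℂ]
  intro h
  have := hR 0 h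
  simp at this
  linarith

theorem IsExpansive.det_ne_zero {R : Matrix ι ι ℤ} (hR : IsExpansive R) :
    (realMat R).det ≠ 0 := by
  have h := (Matrix.isUnit_iff_isUnit_det _).1 hR.isUnit
  have e1 : (R.map (Int.cast : ℤ → ℂ)).det = ((R.det : ℤ) : ℂ) :=
    ((Int.castRingHom ℂ).map_det R).symm
  have e2 : (realMat R).det = ((R.det : ℤ) : ℝ) := ((Int.castRingHom ℝ).map_det R).symm
  rw [e1] at h
  rw [e2]
  intro h0
  apply h.ne_zero
  have : R.det = 0 := by exact_mod_cast h0
  simp [this]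

theorem IsExpansive.summable_norm_pow {R : Matrix ι ι ℤ} (hR : IsExpansive R) :
    Summable fun k : ℕ => ‖(realMat R)⁻¹ ^ k‖ := by
  rcases subsingleton_or_nontrivial (Matrix ι ι ℂ) with hs | hs
  · have : IsEmpty ι := by
      by_contra h
      rw [not_isEmpty_iff] at h
      exact one_ne_zero (α := ℂ) (by
        simpa using congrFun (congrFun (Subsingleton.elim (1 : Matrix ι ι ℂ) 0) h.some) h.some)
    have h0 : ∀ k : ℕ, ‖(realMat R)⁻¹ ^ k‖ = 0 := fun k => by
      rw [Subsingleton.elim ((realMat R)⁻¹ ^ k) 0, norm_zero]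
    simp only [h0]
    exact summable_zero
  set A : Matrix ι ι ℂ := R.map (Int.cast : ℤ → ℂ) with hA
  have hnorm : ∀ k : ℕ, ‖(realMat R)⁻¹ ^ k‖ = ‖A⁻¹ ^ k‖ := by
    have hmap : ∀ k : ℕ, A⁻¹ ^ k = ((realMat R)⁻¹ ^ k).map (Complex.ofRealHom) := by
      intro k
      have h1 : A = Complex.ofRealHom.mapMatrix (realMat R) := by
        ext i j; simp [hA, realMat]
      have h2 : A⁻¹ = Complex.ofRealHom.mapMatrix (realMat R)⁻¹ := by
        apply Matrix.inv_eq_right_inv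
        rw [h1, ← map_mul, Matrix.mul_nonsing_inv _ (isUnit_iff_ne_zero.2 hR.det_ne_zero), map_one]
      rw [h2, ← map_pow]; rfl
    intro k
    rw [hmap, Matrix.linfty_opNorm_def, Matrix.linfty_opNorm_def]
    simp
  simp only [hnorm]
  obtain ⟨u, hu⟩ := hR.isUnit
  have hinv : A⁻¹ = ((u⁻¹ : (Matrix ι ι ℂ)ˣ) : Matrix ι ι ℂ) := by
    rw [hA, ← hu, Matrix.coe_units_inv]
  have hsr : spectralRadius ℂ A⁻¹ < 1 := by
    have := spectrum.spectralRadius_lt_of_forall_lt (A⁻¹) (r := 1) ?_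
    · simpa using this
    · intro k hk
      rw [hinv] at hk
      have h' := spectrum.inv₀_mem_inv_iff (R := ℂ) (r := k⁻¹) (a := u)
      rw [inv_inv] at h'
      have hm := h'.1 hk
      rw [hu] at hm
      have := hR _ hm
      rw [norm_inv] at this
      have hk0 : 0 < ‖k‖ := by
        by_contra h0
        have : ‖k‖ = 0 := le_antisymm (not_lt.1 h0) (norm_nonneg _)
        simp [this] at *
        linarith
      have := (one_lt_inv₀ hk0).1 this
      exact_mod_cast this
  obtain ⟨q, hq1, hq2⟩ := ENNReal.lt_iff_exists_nnreal_btwn.1 hsr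
  have hev := (spectrum.pow_nnnorm_pow_one_div_tendsto_nhds_spectralRadius A⁻¹).eventually_lt_const hq1
  have hq : (q : ℝ) < 1 := by exact_mod_cast hq2
  refine Summable.of_norm_bounded_eventually_nat (summable_geometric_of_lt_one q.2 hq) ?_
  filter_upwards [hev, eventually_gt_atTop 0] with n hn hn0
  rw [norm_norm]
  have h3 : (‖A⁻¹ ^ n‖₊ : ENNReal) ≤ (q : ENNReal) ^ n := by
    have := ENNReal.rpow_le_rpow hn.le (Nat.cast_nonneg n : (0 : ℝ) ≤ n)
    rwa [← ENNReal.rpow_mul, one_div_mul_cancel (by exact_mod_cast hn0.ne'), ENNReal.rpow_one,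
      ENNReal.rpow_natCast] at this
  exact_mod_cast h3

theorem summable_coding {R : Matrix ι ι ℤ} (hR : IsExpansive R) {B : Finset (ι → ℤ)}
    {ω : ℕ → ι → ℤ} (hω : ∀ k, ω k ∈ B) :
    Summable fun k : ℕ => ((realMat R)⁻¹ ^ (k + 1)) *ᵥ realVec (ω k) := by
  have hs := ((summable_nat_add_iff 1).2 hR.summable_norm_pow).mul_right
    (∑ b ∈ B, ‖realVec b‖)
  refine Summable.of_norm_bounded hs fun k => ?_
  refine (Matrix.linfty_opNorm_mulVec _ _).trans ?_
  gcongr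
  exact Finset.single_le_sum (f := fun b : ι → ℤ => ‖realVec b‖) (fun _ _ => norm_nonneg _) (hω k)

/-- Put a digit in front of a sequence. -/
def consDigit (b : ι → ℤ) (ω : ℕ → ι → ℤ) : ℕ → ι → ℤ
  | 0 => b
  | n + 1 => ω n

theorem coding_consDigit {R : Matrix ι ι ℤ} (hR : IsExpansive R) {B : Finset (ι → ℤ)}
    {b : ι → ℤ} {ω : ℕ → ι → ℤ} (hω : ∀ k, ω k ∈ B) :
    coding R (consDigit b ω) = branch R b (coding R ω) := by
  have hs := summable_coding hR hω
  have hL := (Matrix.mulVecLin (realMat R)⁻¹).toContinuousLinearMap.map_tsum hs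
  have hterm : ∀ k : ℕ, ((realMat R)⁻¹ ^ (k + 1 + 1)) *ᵥ realVec (consDigit b ω (k + 1)) =
      (Matrix.mulVecLin (realMat R)⁻¹).toContinuousLinearMap
        (((realMat R)⁻¹ ^ (k + 1)) *ᵥ realVec (ω k)) := by
    intro k
    change _ = (realMat R)⁻¹ *ᵥ (((realMat R)⁻¹ ^ (k + 1)) *ᵥ realVec (ω k))
    rw [Matrix.mulVec_mulVec, ← pow_succ']
    rfl
  have hs' : Summable fun k : ℕ =>
      ((realMat R)⁻¹ ^ (k + 1)) *ᵥ realVec (consDigit b ω k) := by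
    rw [← summable_nat_add_iff 1]
    simp only [hterm]
    exact (Matrix.mulVecLin (realMat R)⁻¹).toContinuousLinearMap.summable hs
  rw [coding, hs'.tsum_eq_zero_add]
  simp only [hterm]
  rw [← hL, branch, Matrix.mulVec_add, add_comm]
  simp [consDigit, coding]

theorem measurable_consDigit (b : ι → ℤ) : Measurable (consDigit b) := by
  refine measurable_pi_lambda _ fun n => ?_
  cases n with
  | zero => exact measurable_const
  | succ n => exact measurable_pi_apply n

theorem uniform_apply {B : Finset (ι → ℤ)} (hB : B.Nonempty) (t : Set (ι → ℤ)) :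
    (PMF.uniformOfFinset B hB).toMeasure t = (B.card : ENNReal)⁻¹ * ∑ b ∈ B, t.indicator 1 b := by
  classical
  rw [PMF.toMeasure_uniformOfFinset_apply hB t (Set.to_countable t).measurableSet,
    div_eq_mul_inv, mul_comm]
  congr 1
  simp [Set.indicator_apply]

theorem infinitePi_eq_sum {B : Finset (ι → ℤ)} (hB : B.Nonempty) :
    (Measure.infinitePi fun _ : ℕ => (PMF.uniformOfFinset B hB).toMeasure) =
      (B.card : ENNReal)⁻¹ • ∑ b ∈ B, (Measure.infinitePi fun _ : ℕ =>
        (PMF.uniformOfFinset B hB).toMeasure).map (consDigit b) := by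
  classical
  symm
  refine Measure.eq_infinitePi _ fun s t ht => ?_
  set p := (PMF.uniformOfFinset B hB).toMeasure
  set t' : ℕ → Set (ι → ℤ) := fun i => if i ∈ s then t i else Set.univ with ht'
  have htm : ∀ i, MeasurableSet (t' i) := fun i => (Set.to_countable _).measurableSet
  obtain ⟨n, hn⟩ : ∃ n, s ⊆ Finset.range (n + 1) :=
    ⟨s.sup id, fun i hi => Finset.mem_range_succ_iff.2 (Finset.le_sup (f := id) hi)⟩
  have hpi : Set.pi (s : Set ℕ) t = Set.pi (Finset.range (n + 1) : Set ℕ) t' := by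
    ext ω
    simp only [Set.mem_pi, ht']
    constructor
    · intro h i _
      by_cases hi : i ∈ s
      · simpa [hi] using h i hi
      · simp [hi]
    · intro h i hi
      have := h i (hn hi)
      simpa [Finset.mem_coe.1 hi] using this
  have hprod : ∏ i ∈ s, p (t i) = ∏ i ∈ Finset.range (n + 1), p (t' i) := by
    rw [← Finset.prod_subset hn]
    · exact Finset.prod_congr rfl fun i hi => by simp [ht', hi]
    · intro i _ hi
      simp [ht', hi, p]
  have hmeas : MeasurableSet (Set.pi (Finset.range (n + 1) : Set ℕ) t') :=
    MeasurableSet.pi (Set.to_countable _) fun i _ => htm i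
  rw [hpi, hprod, Finset.prod_range_succ', Measure.smul_apply, Measure.finsetSum_apply]
  have hb : ∀ b ∈ B, ((Measure.infinitePi fun _ : ℕ => p).map (consDigit b))
      (Set.pi (Finset.range (n + 1) : Set ℕ) t') =
      (∏ i ∈ Finset.range n, p (t' (i + 1))) * (t' 0).indicator 1 b := by
    intro b _
    rw [Measure.map_apply (measurable_consDigit b) hmeas]
    by_cases hb0 : b ∈ t' 0
    · rw [← Measure.infinitePi_pi (fun _ : ℕ => p) (s := Finset.range n) (t := fun i => t' (i + 1))
        (fun i _ => htm _)]
      simp only [hb0, Set.indicator_of_mem, Pi.one_apply, mul_one]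
      congr 1
      ext ω
      simp only [Set.mem_preimage, Set.mem_pi, Finset.coe_range, Set.mem_Iio]
      constructor
      · intro h i hi
        exact h (i + 1) (by omega)
      · intro h i hi
        cases i with
        | zero => exact hb0
        | succ i => exact h i (by omega)
    · simp only [hb0, not_false_eq_true, Set.indicator_of_notMem, mul_zero]
      have : consDigit b ⁻¹' (Set.pi (Finset.range (n + 1) : Set ℕ) t') = ∅ :=
        Set.eq_empty_of_forall_notMem fun ω h => hb0 (h 0 (by simp))
      rw [this, measure_empty]
  rw [Finset.sum_congr rfl hb, ← Finset.mul_sum, uniform_apply hB (t' 0), smul_eq_mul]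
  ring

/-- For an expansive `R`, the measure `invariantMeasure R B` is indeed an invariant probability
measure. -/
theorem isInvariant_invariantMeasure {R : Matrix ι ι ℤ} (hR : IsExpansive R)
    {B : Finset (ι → ℤ)} (hB : B.Nonempty) : IsInvariantMeasure R B (invariantMeasure R B) := by
  classical
  set ν := Measure.infinitePi fun _ : ℕ => (PMF.uniformOfFinset B hB).toMeasure with hν
  have hae : ∀ᵐ ω ∂ν, ∀ k, ω k ∈ B := by
    rw [ae_all_iff]
    intro k
    have h := (measurePreserving_eval_infinitePi
      (fun _ : ℕ => (PMF.uniformOfFinset B hB).toMeasure) k)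
    refine h.quasiMeasurePreserving.ae (p := fun b => b ∈ B) ?_
    rw [ae_iff, uniform_apply]
    simp +contextual
  have hmeas : AEMeasurable (coding R) ν := by
    refine aemeasurable_of_tendsto_metrizable_ae atTop
      (f := fun (n : ℕ) (ω : ℕ → ι → ℤ) => ∑ k ∈ Finset.range n,
        ((realMat R)⁻¹ ^ (k + 1)) *ᵥ realVec (ω k)) (fun n => ?_) ?_
    · refine (Finset.measurable_sum _ fun k _ => ?_).aemeasurable
      exact (measurable_of_countable fun b : ι → ℤ =>
        ((realMat R)⁻¹ ^ (k + 1)) *ᵥ realVec b).comp (measurable_pi_apply k)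
    · filter_upwards [hae] with ω hω
      exact (summable_coding hR hω).hasSum.tendsto_sum_nat
  have hdef : invariantMeasure R B = ν.map (coding R) := by
    rw [invariantMeasure, dif_pos hB]
  have hbr : ∀ b, Continuous (branch R b) := fun b => by unfold branch; fun_prop
  refine ⟨?_, fun f => ?_⟩
  · rw [hdef]
    exact Measure.isProbabilityMeasure_map hmeas
  · rw [hdef, integral_map hmeas f.continuous.aestronglyMeasurable]
    have hac : ∀ b ∈ B, ν.map (consDigit b) ≪ ν := by
      intro b hb
      refine Measure.AbsolutelyContinuous.mk fun s _ hs => ?_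
      rw [hν, infinitePi_eq_sum hB, Measure.smul_apply, smul_eq_mul,
        mul_eq_zero, Measure.finsetSum_apply, Finset.sum_eq_zero_iff] at hs
      rcases hs with hs | hs
      · simp at hs
      · exact hs b hb
    have hcod : ∀ b : ι → ℤ, b ∈ B → ∫ ω, f (coding R ω) ∂(ν.map (consDigit b)) =
        ∫ x, f (branch R b x) ∂(ν.map (coding R)) := by
      intro b hb
      rw [integral_map hmeas (f := fun x => f (branch R b x))
          ((f.continuous.comp (hbr b)).aestronglyMeasurable),
        integral_map (f := fun ω => f (coding R ω)) (measurable_consDigit b).aemeasurable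
          ((f.continuous.measurable.comp_aemeasurable (hmeas.mono_ac (hac b hb))).aestronglyMeasurable)]
      refine integral_congr_ae ?_
      filter_upwards [hae] with ω hω
      rw [coding_consDigit hR hω]
    have hint : ∀ b ∈ B, Integrable (fun ω => f (coding R ω)) (ν.map (consDigit b)) := by
      intro b hb
      have : IsProbabilityMeasure (ν.map (consDigit b)) :=
        Measure.isProbabilityMeasure_map (measurable_consDigit b).aemeasurable
      exact Integrable.of_bound
        ((f.continuous.measurable.comp_aemeasurable (hmeas.mono_ac (hac b hb))).aestronglyMeasurable)
        ‖f‖ (Eventually.of_forall fun ω => f.norm_coe_le_norm _)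
    conv_lhs => rw [hν, infinitePi_eq_sum hB]
    rw [integral_smul_measure, integral_finsetSum_measure hint, Finset.sum_congr rfl hcod]
    simp

end Invariance

/-! ### Invariant sets of the random walk -/

/-- `𝒪(x)`: the union of all trajectories `{τ_{ω_n} ⋯ τ_{ω_1} x | n ≥ 1}` of `x`, where `ω` is a
sequence in `L` all of whose transitions have positive probability. -/
def trajectories (R : Matrix ι ι ℤ) (B L : Finset (ι → ℤ)) (x : ι → ℝ) : Set (ι → ℝ) :=
  {y | ∃ ω : ℕ → ι → ℤ, (∀ i, ω i ∈ L) ∧ (∀ n, weight B (walk R ω x (n + 1)) ≠ 0) ∧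
    ∃ n, y = walk R ω x (n + 1)}

/-- A closed set that contains the orbit `closure 𝒪(x)` of each of its points. -/
def IsInvariantSet (R : Matrix ι ι ℤ) (B L : Finset (ι → ℤ)) (F : Set (ι → ℝ)) : Prop :=
  IsClosed F ∧ ∀ x ∈ F, closure (trajectories R B L x) ⊆ F

/-- A minimal compact (nonempty) invariant set. -/
def IsMinimalCompactInvariant (R : Matrix ι ι ℤ) (B L : Finset (ι → ℤ)) (M : Set (ι → ℝ)) :
    Prop :=
  IsCompact M ∧ M.Nonempty ∧ IsInvariantSet R B L M ∧
    ∀ F : Set (ι → ℝ), F ⊆ M → F.Nonempty → IsInvariantSet R B L F → F = M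

/-- `N(F)`: the paths `ω` with `d(τ_{ω_n} ⋯ τ_{ω_1} x, F) → 0` (which does not depend on `x`). -/
def basin (R : Matrix ι ι ℤ) (L : Finset (ι → ℤ)) (F : Set (ι → ℝ)) (x : ι → ℝ) :
    Set (ℕ → L) :=
  {ω | Tendsto (fun n => Metric.infDist (walk R (fun i => (ω i : ι → ℤ)) x n) F) atTop (𝓝 0)}

/-- `h_F(x) = P_x(N(F))`. -/
def harmonic {R : Matrix ι ι ℤ} {B L : Finset (ι → ℤ)} (hH : IsHadamardTriple R B L)
    (hB : B.Nonempty) (F : Set (ι → ℝ)) (x : ι → ℝ) : ℝ :=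
  (pathMeasure hH hB x).real (basin R L F x)

/-- The distinct points `x₀, τ_{l_1} x₀, …, τ_{l_{m-1}} ⋯ τ_{l_1} x₀`, with
`τ_{l_m} ⋯ τ_{l_1} x₀ = x₀` and `l_1, …, l_m ∈ L`, form a cycle (`l_1, …, l_m` are
`l 0, …, l (m - 1)`; the other values of `l` play no role). -/
structure IsCycle (R : Matrix ι ι ℤ) (L : Finset (ι → ℤ)) (m : ℕ) (l : ℕ → ι → ℤ)
    (x₀ : ι → ℝ) : Prop where
  pos : 0 < m
  mem : ∀ i < m, l i ∈ L
  distinct : Set.InjOn (walk R l x₀) (Set.Iio m)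
  closed : walk R l x₀ m = x₀

/-- The points of the cycle. -/
def cyclePoints (R : Matrix ι ι ℤ) (m : ℕ) (l : ℕ → ι → ℤ) (x₀ : ι → ℝ) : Set (ι → ℝ) :=
  walk R l x₀ '' Set.Iio m

/-- The union `ℛ` of the translates of `V` by the points of the cycle. -/
def cycleTranslates (R : Matrix ι ι ℤ) (m : ℕ) (l : ℕ → ι → ℤ) (x₀ : ι → ℝ)
    (V : Submodule ℝ (ι → ℝ)) : Set (ι → ℝ) :=
  {x | ∃ c ∈ cyclePoints R m l x₀, x - c ∈ V}

/-! ### Reducibility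

Vectors of `ℤ^r × ℤ^t` and `ℝ^r × ℝ^t` are functions on `Fin r ⊕ Fin t`. -/

/-- The first components `r_i` of the elements of `B`. -/
def firstDigits {r t : ℕ} (B : Finset (Fin r ⊕ Fin t → ℤ)) : Finset (Fin r → ℤ) :=
  B.image fun v i => v (Sum.inl i)

/-- The second components `s_j` of the elements of `L`. -/
def secondDigits {r t : ℕ} (L : Finset (Fin r ⊕ Fin t → ℤ)) : Finset (Fin t → ℤ) :=
  L.image fun v j => v (Sum.inr j)

/-- The invariant measure `μ₁` of the system `τ_{r_i} x = (S₁ᵀ)⁻¹ (x + r_i)` on `ℝ^r`, where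
`S₁ᵀ` is the upper left block of `R`. -/
def firstMeasure {r t : ℕ} (R : Matrix (Fin r ⊕ Fin t) (Fin r ⊕ Fin t) ℤ)
    (B : Finset (Fin r ⊕ Fin t → ℤ)) : Measure (Fin r → ℝ) :=
  invariantMeasure R.toBlocks₁₁ (firstDigits B)

/-- The triple `(R, B, L)` in `ℤ^r × ℤ^t` is reducible to `ℝ^r`. -/
structure IsReducible {r t : ℕ} (R : Matrix (Fin r ⊕ Fin t) (Fin r ⊕ Fin t) ℤ)
    (B L : Finset (Fin r ⊕ Fin t → ℤ)) : Prop where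
  /-- `ℝ^r × {0}` is invariant under `S = Rᵀ`. -/
  block : R.toBlocks₁₂ = 0
  /-- `B = {(r_i, η_ij)}`, `L = {(γ_ij, s_j)}`, and both components give Hadamard triples. -/
  digits : ∃ (N₁ N₂ : ℕ) (ρ : Fin N₁ → Fin r → ℤ) (η : Fin N₁ → Fin N₂ → Fin t → ℤ)
    (γ : Fin N₁ → Fin N₂ → Fin r → ℤ) (s : Fin N₂ → Fin t → ℤ),
    (∀ v, v ∈ B ↔ ∃ i j, v = Sum.elim (ρ i) (η i j)) ∧
    (∀ v, v ∈ L ↔ ∃ i j, v = Sum.elim (γ i j) (s j)) ∧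
    (∀ j, IsHadamardFamily R.toBlocks₁₁ ρ fun i => γ i j) ∧
    (∀ i, IsHadamardFamily R.toBlocks₂₂ (η i) s)
  spectral : ∃ Λ₁, IsSpectrum (firstMeasure R B) Λ₁
  no_overlap : ∀ b ∈ firstDigits B, ∀ b' ∈ firstDigits B, b ≠ b' →
    firstMeasure R B (branch R.toBlocks₁₁ b '' attractor R.toBlocks₁₁ (firstDigits B) ∩
      branch R.toBlocks₁₁ b' '' attractor R.toBlocks₁₁ (firstDigits B)) = 0

/-- The unimodular integer matrix `U`, with inverse `U'`, conjugates `(R, B, L)` to the triple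
`(U R U⁻¹, U B, (Uᵀ)⁻¹ L)`, which is reducible to `ℝ^r`, and `(Uᵀ)⁻¹`, the change of variables on
the side of `L`, maps `V` onto `ℝ^r × {0}`. (Invertibility of `U` forces `r + t = d`.) -/
structure IsReduction {d r t : ℕ} (R : Matrix (Fin d) (Fin d) ℤ) (B L : Finset (Fin d → ℤ))
    (V : Submodule ℝ (Fin d → ℝ)) (U : Matrix (Fin r ⊕ Fin t) (Fin d) ℤ)
    (U' : Matrix (Fin d) (Fin r ⊕ Fin t) ℤ) : Prop where
  mul_inv : U * U' = 1
  inv_mul : U' * U = 1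
  reducible : IsReducible (U * R * U') (B.image fun b => U *ᵥ b) (L.image fun l => U'ᵀ *ᵥ l)
  map_subspace : (V.map (Matrix.mulVecLin (realMat U'ᵀ)) : Set (Fin r ⊕ Fin t → ℝ)) =
    {v : Fin r ⊕ Fin t → ℝ | ∀ j : Fin t, v (Sum.inr j) = 0}

/-- `V` is a reducing subspace for `(R, B, L)`. -/
def IsReducing {d : ℕ} (R : Matrix (Fin d) (Fin d) ℤ) (B L : Finset (Fin d → ℤ))
    (V : Submodule ℝ (Fin d → ℝ)) : Prop :=
  ∃ (r t : ℕ) (U : Matrix (Fin r ⊕ Fin t) (Fin d) ℤ) (U' : Matrix (Fin d) (Fin r ⊕ Fin t) ℤ),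
    IsReduction R B L V U U'

/-! ### The frequencies -/

/-- The second component `y₀` of the point `(Uᵀ)⁻¹ x₀`. -/
def secondPoint {d r t : ℕ} (U' : Matrix (Fin d) (Fin r ⊕ Fin t) ℤ) (x₀ : Fin d → ℝ) :
    Fin t → ℝ :=
  fun j => (realMat U'ᵀ *ᵥ x₀) (Sum.inr j)

/-- `k(ω) = ω_0 + S₂ ω_1 + ⋯ + S₂^{n-1} ω_{n-1} - S₂^n y₀`. -/
def shift {t n : ℕ} (S₂ : Matrix (Fin t) (Fin t) ℤ) (y₀ : Fin t → ℝ) (ω : Fin n → Fin t → ℤ) :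
    Fin t → ℝ :=
  ∑ i : Fin n, (realMat S₂ ^ (i : ℕ)) *ᵥ realVec (ω i) - (realMat S₂ ^ n) *ᵥ y₀

/-- The set of the vectors `Uᵀ (λ₁, k(ω))`, with `λ₁ ∈ Λ₁` and `ω` a finite word in the second
components of `(Uᵀ)⁻¹ L`; here `S₂` is the lower right block of `(U R U⁻¹)ᵀ`. -/
def frequencies {d r t : ℕ} (R : Matrix (Fin d) (Fin d) ℤ) (L : Finset (Fin d → ℤ))
    (U : Matrix (Fin r ⊕ Fin t) (Fin d) ℤ) (U' : Matrix (Fin d) (Fin r ⊕ Fin t) ℤ)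
    (x₀ : Fin d → ℝ) (Λ₁ : Set (Fin r → ℝ)) : Set (Fin d → ℝ) :=
  {v | ∃ a ∈ Λ₁, ∃ (n : ℕ) (ω : Fin n → Fin t → ℤ),
    (∀ i, ω i ∈ secondDigits (L.image fun l => U'ᵀ *ᵥ l)) ∧
    v = realMat Uᵀ *ᵥ Sum.elim a (shift (U * R * U')ᵀ.toBlocks₂₂ (secondPoint U' x₀) ω)}

end

end AffineIFS

namespace AffineIFS

open MeasureTheory ProbabilityTheory Filter Topology
open scoped Matrix

noncomputable section

variable {ι : Type} [Fintype ι] [DecidableEq ι]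

set_option linter.unusedSectionVars false

/-! ### Expansive matrices -/

/-! After the change of variables `(Uᵀ)⁻¹`, the matrix `S` is block upper triangular, so the second
component `y` of the point performs a walk of its own under the maps `τ_{s_j}`. The Hadamard
property of the first components makes its transition weights depend on `y` alone: they are the
values of `w(y) = N₁⁻¹ ∑_i |N₂⁻¹ ∑_j e^{2πi η_ij·y}|²`, which is `fiberWeight` (`sum_weight_fiber`,
`isFactor`). The set `ℛ` is the preimage of a periodic orbit of the second component. Thus `h_ℛ(x)`
is the probability that the sequence `p` of second digits leads to this orbit.

The orbit is finite and `S₂^{-n}` tends to zero, so `p` leads to the orbit exactly when, from some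
starting point `-z`, the walk with digits `p` is eventually in the orbit
(`exists_lands_of_tendsto`). Such a walk stays congruent to the orbit modulo `ℤ^t` at all times. As
the `s_j` are incongruent modulo `S₂ ℤ^t`, `z` and `p` determine each other, and the points `z` are
the `k(ω)` (`exists_lands_iff`). Invariance of `ℛ` forces `w = 1` on the orbit
(`weight_orbit_eq_one`). The exponentials in each inner mean then coincide there, which makes `w`
periodic with respect to the orbit points and `ℤ^t` (`fiberWeight_add_latticeHull`). The walks with
digits `p` from `y` and from `-z` differ by `S₂^{-k}(y + z)` at time `k`, hence `p` has probability
`∏_{k ≥ 1} w(S₂^{-k}(y + z))` (`pathMeasure_basin`).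

The same product comes from the Fourier side. In the new coordinates, for a fixed `z`, the transform
at `x + (λ₁, z)` is the integral of `e^{2πi λ₁·u}` times a product `Φ` of functions of the
independent digits of `u`. Without overlap `Φ` is a function of `u` almost everywhere, so Parseval's
identity for `Λ₁` gives `∫ |Φ|²` as the sum over `λ₁`, and independence turns this integral into the
product above (`hasSum_fourier`). Summation over the countably many `z` gives the formula. -/

theorem mem_spectrum_iff_det (A : Matrix ι ι ℂ) (z : ℂ) :
    z ∈ spectrum ℂ A ↔ (z • (1 : Matrix ι ι ℂ) - A).det = 0 := by
  rw [spectrum.mem_iff, Matrix.isUnit_iff_isUnit_det, isUnit_iff_ne_zero, not_not,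
    Algebra.algebraMap_eq_smul_one]

theorem isExpansive_transpose {R : Matrix ι ι ℤ} (hR : IsExpansive R) : IsExpansive Rᵀ := by
  intro z hz
  apply hR z
  rw [mem_spectrum_iff_det] at hz ⊢
  rw [← hz, ← Matrix.det_transpose, Matrix.transpose_sub, Matrix.transpose_smul,
    Matrix.transpose_one]
  rfl

/-- Here `U` and `U'` have different index types, so similarity is argued by hand: if `z - R` had an
inverse, conjugating that inverse would invert `z - U R U'`. -/
theorem isExpansive_conj {κ : Type} [Fintype κ] [DecidableEq κ] {R : Matrix ι ι ℤ}
    (hR : IsExpansive R) {U : Matrix κ ι ℤ} {U' : Matrix ι κ ℤ} (h : U * U' = 1)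
    (h' : U' * U = 1) : IsExpansive (U * R * U') := by
  intro z hz
  apply hR z
  rw [mem_spectrum_iff_det] at hz ⊢
  have hm : ∀ {m n p : Type} [Fintype n] (X : Matrix m n ℤ) (Y : Matrix n p ℤ),
      (X * Y).map (Int.cast : ℤ → ℂ) = X.map (Int.cast : ℤ → ℂ) * Y.map (Int.cast : ℤ → ℂ) :=
    fun X Y => Matrix.map_mul (f := Int.castRingHom ℂ)
  have h1 : U.map (Int.cast : ℤ → ℂ) * U'.map (Int.cast : ℤ → ℂ) = 1 := by
    rw [← hm, h]; exact Matrix.map_one _ (by simp) (by simp)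
  have h2 : U'.map (Int.cast : ℤ → ℂ) * U.map (Int.cast : ℤ → ℂ) = 1 := by
    rw [← hm, h']; exact Matrix.map_one _ (by simp) (by simp)
  rw [hm, hm] at hz
  have : z • (1 : Matrix κ κ ℂ) - U.map (Int.cast : ℤ → ℂ) * R.map (Int.cast : ℤ → ℂ) *
        U'.map (Int.cast : ℤ → ℂ) =
      U.map (Int.cast : ℤ → ℂ) * (z • (1 : Matrix ι ι ℂ) - R.map (Int.cast : ℤ → ℂ)) *
        U'.map (Int.cast : ℤ → ℂ) := by
    rw [Matrix.mul_sub, Matrix.sub_mul, Matrix.mul_smul, Matrix.smul_mul, Matrix.mul_one, h1]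
  rw [this] at hz
  by_contra hne
  have hu : IsUnit (z • (1 : Matrix ι ι ℂ) - R.map (Int.cast : ℤ → ℂ)).det :=
    isUnit_iff_ne_zero.2 hne
  set X := z • (1 : Matrix ι ι ℂ) - R.map (Int.cast : ℤ → ℂ)
  -- An explicit right inverse of the conjugated matrix, against the vanishing of its determinant.
  have hX : (U.map (Int.cast : ℤ → ℂ) * X * U'.map (Int.cast : ℤ → ℂ)) *
      (U.map (Int.cast : ℤ → ℂ) * X⁻¹ * U'.map (Int.cast : ℤ → ℂ)) = 1 := by
    calc _ = U.map (Int.cast : ℤ → ℂ) *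
          (X * (U'.map (Int.cast : ℤ → ℂ) * U.map (Int.cast : ℤ → ℂ)) * X⁻¹) *
          U'.map (Int.cast : ℤ → ℂ) := by simp only [Matrix.mul_assoc]
      _ = 1 := by rw [h2, Matrix.mul_one, Matrix.mul_nonsing_inv _ hu, Matrix.mul_one, h1]
  have := congrArg Matrix.det hX
  rw [Matrix.det_mul, hz] at this
  simp at this

/-! ### Spectra of block triangular matrices -/

section Blocks

variable {κ : Type} [Fintype κ] [DecidableEq κ]

theorem det_of_toBlocks₁₂_eq_zero {R : Matrix (ι ⊕ κ) (ι ⊕ κ) ℤ} (hR : R.toBlocks₁₂ = 0) (z : ℂ) :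
    (z • (1 : Matrix (ι ⊕ κ) (ι ⊕ κ) ℂ) - R.map (Int.cast : ℤ → ℂ)).det =
      (z • (1 : Matrix ι ι ℂ) - R.toBlocks₁₁.map (Int.cast : ℤ → ℂ)).det *
        (z • (1 : Matrix κ κ ℂ) - R.toBlocks₂₂.map (Int.cast : ℤ → ℂ)).det := by
  have : z • (1 : Matrix (ι ⊕ κ) (ι ⊕ κ) ℂ) - R.map (Int.cast : ℤ → ℂ) =
      Matrix.fromBlocks (z • (1 : Matrix ι ι ℂ) - R.toBlocks₁₁.map (Int.cast : ℤ → ℂ)) 0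
        (- R.toBlocks₂₁.map (Int.cast : ℤ → ℂ))
        (z • (1 : Matrix κ κ ℂ) - R.toBlocks₂₂.map (Int.cast : ℤ → ℂ)) := by
    ext (i | i) (j | j)
    · simp [Matrix.one_apply, Matrix.toBlocks₁₁]
    · have := congrFun (congrFun hR i) j
      simp only [Matrix.toBlocks₁₂, Matrix.of_apply, Matrix.zero_apply] at this
      simp [this]
    · simp [Matrix.toBlocks₂₁]
    · simp [Matrix.one_apply, Matrix.toBlocks₂₂]
  rw [this, Matrix.det_fromBlocks_zero₁₂]

theorem isExpansive_toBlocks₁₁ {R : Matrix (ι ⊕ κ) (ι ⊕ κ) ℤ} (hR : IsExpansive R)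
    (h : R.toBlocks₁₂ = 0) : IsExpansive R.toBlocks₁₁ := by
  intro z hz
  apply hR z
  rw [mem_spectrum_iff_det] at hz ⊢
  rw [det_of_toBlocks₁₂_eq_zero h, hz, zero_mul]

theorem isExpansive_toBlocks₂₂ {R : Matrix (ι ⊕ κ) (ι ⊕ κ) ℤ} (hR : IsExpansive R)
    (h : R.toBlocks₁₂ = 0) : IsExpansive R.toBlocks₂₂ := by
  intro z hz
  apply hR z
  rw [mem_spectrum_iff_det] at hz ⊢
  rw [det_of_toBlocks₁₂_eq_zero h, hz, mul_zero]

end Blocks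

theorem IsExpansive.inv_mul {R : Matrix ι ι ℤ} (hR : IsExpansive R) :
    (realMat R)⁻¹ * realMat R = 1 :=
  Matrix.nonsing_inv_mul _ (isUnit_iff_ne_zero.2 hR.det_ne_zero)

theorem IsExpansive.mul_inv {R : Matrix ι ι ℤ} (hR : IsExpansive R) :
    realMat R * (realMat R)⁻¹ = 1 :=
  Matrix.mul_nonsing_inv _ (isUnit_iff_ne_zero.2 hR.det_ne_zero)

theorem IsExpansive.pow_mul_inv_pow {R : Matrix ι ι ℤ} (hR : IsExpansive R) (n : ℕ) :
    realMat R ^ n * (realMat R)⁻¹ ^ n = 1 := by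
  have hc : Commute (realMat R) (realMat R)⁻¹ := by
    rw [Commute, SemiconjBy, hR.mul_inv, hR.inv_mul]
  rw [← hc.mul_pow, hR.mul_inv, one_pow]

theorem IsExpansive.inv_pow_mul_pow {R : Matrix ι ι ℤ} (hR : IsExpansive R) (n : ℕ) :
    (realMat R)⁻¹ ^ n * realMat R ^ n = 1 := by
  have hc : Commute (realMat R)⁻¹ (realMat R) := by
    rw [Commute, SemiconjBy, hR.mul_inv, hR.inv_mul]
  rw [← hc.mul_pow, hR.inv_mul, one_pow]

section Norm

attribute [local instance] Matrix.linftyOpNormedRing Matrix.linftyOpNormedAlgebra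

theorem IsExpansive.summable_norm_pow_mulVec {R : Matrix ι ι ℤ} (hR : IsExpansive R)
    (x : ι → ℝ) : Summable fun n : ℕ => ‖(realMat R)⁻¹ ^ n *ᵥ x‖ :=
  Summable.of_nonneg_of_le (fun _ => norm_nonneg _) (fun _ => Matrix.linfty_opNorm_mulVec _ _)
    (hR.summable_norm_pow.mul_right ‖x‖)

end Norm

theorem IsExpansive.tendsto_pow_mulVec {R : Matrix ι ι ℤ} (hR : IsExpansive R) (x : ι → ℝ) :
    Tendsto (fun n : ℕ => (realMat R)⁻¹ ^ n *ᵥ x) atTop (𝓝 0) :=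
  tendsto_zero_iff_norm_tendsto_zero.2 (hR.summable_norm_pow_mulVec x).tendsto_atTop_zero

/-! ### Passage from integer to real matrices and vectors -/

theorem realMat_transpose_inv (R : Matrix ι ι ℤ) : (realMat Rᵀ)⁻¹ = ((realMat R)⁻¹)ᵀ := by
  rw [Matrix.transpose_nonsing_inv]; rfl

theorem realMat_mulVec {m n : Type} [Fintype n] (A : Matrix m n ℤ) (v : n → ℤ) :
    realMat A *ᵥ realVec v = realVec (A *ᵥ v) := by
  ext i
  simp [realMat, realVec, Matrix.mulVec, dotProduct]

theorem realMat_mul {m n p : Type} [Fintype n] (A : Matrix m n ℤ) (A' : Matrix n p ℤ) :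
    realMat (A * A') = realMat A * realMat A' :=
  Matrix.map_mul (f := Int.castRingHom ℝ)

theorem realMat_one : realMat (1 : Matrix ι ι ℤ) = 1 :=
  Matrix.map_one _ (by simp) (by simp)

theorem realMat_pow (A : Matrix ι ι ℤ) (n : ℕ) : realMat (A ^ n) = realMat A ^ n := by
  induction n with
  | zero => simp [realMat_one]
  | succ n ih => rw [pow_succ, pow_succ, realMat_mul, ih]

theorem realVec_add {n : Type} (a b : n → ℤ) : realVec (a + b) = realVec a + realVec b := by
  ext i; simp [realVec]

theorem realVec_sub {n : Type} (a b : n → ℤ) : realVec (a - b) = realVec a - realVec b := by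
  ext i; simp [realVec]

theorem realVec_neg {n : Type} (a : n → ℤ) : realVec (-a) = - realVec a := by
  ext i; simp [realVec]

theorem realVec_zero {n : Type} : realVec (0 : n → ℤ) = 0 := by
  ext i; simp [realVec]

theorem realVec_injective {n : Type} : Function.Injective (realVec : (n → ℤ) → n → ℝ) := by
  intro a b h
  ext i
  have := congrFun h i
  simpa [realVec] using this

/-! ### Characters -/

theorem character_add_left (x y z : ι → ℝ) :
    character (x + y) z = character x z * character y z := by
  simp only [character, add_dotProduct, ← Complex.exp_add]
  congr 1; push_cast; ring

theorem character_comm (x y : ι → ℝ) : character x y = character y x := by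
  rw [character, character, dotProduct_comm]

theorem character_zero_left (x : ι → ℝ) : character 0 x = 1 := by simp [character]

theorem norm_character (x y : ι → ℝ) : ‖character x y‖ = 1 := by
  rw [character, show (2 * Real.pi * Complex.I * ((x ⬝ᵥ y : ℝ) : ℂ)) =
    ((2 * Real.pi * (x ⬝ᵥ y) : ℝ) : ℂ) * Complex.I by push_cast; ring,
    Complex.norm_exp_ofReal_mul_I]

theorem character_realVec_realVec (a b : ι → ℤ) : character (realVec a) (realVec b) = 1 := by
  rw [character, Complex.exp_eq_one_iff]
  refine ⟨a ⬝ᵥ b, ?_⟩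
  simp only [dotProduct, realVec]
  push_cast
  ring

theorem character_sum_left {α : Type} (s : Finset α) (f : α → ι → ℝ) (x : ι → ℝ) :
    character (∑ a ∈ s, f a) x = ∏ a ∈ s, character (f a) x := by
  classical
  induction s using Finset.induction_on with
  | empty => simp [character_zero_left]
  | insert a s ha ih => rw [Finset.sum_insert ha, Finset.prod_insert ha, character_add_left, ih]

theorem character_mulVec {κ : Type} [Fintype κ] (A : Matrix κ ι ℝ) (x : ι → ℝ) (y : κ → ℝ) :
    character (A *ᵥ x) y = character x (Aᵀ *ᵥ y) := by
  rw [character, character, Matrix.mulVec_transpose, dotProduct_comm, Matrix.dotProduct_mulVec,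
    dotProduct_comm]

theorem continuous_character_right (x : ι → ℝ) : Continuous (character x) := by
  unfold character dotProduct; fun_prop

/-- `m_B(x) = N⁻¹ ∑_{b ∈ B} e^{2πi b·x}`, so that `W_B = |m_B|²`. -/
def mask (B : Finset (ι → ℤ)) (x : ι → ℝ) : ℂ :=
  (B.card : ℂ)⁻¹ * ∑ b ∈ B, character (realVec b) x

/-! ### Independence of the digits, and the infinite product for the Fourier transform -/

/-- The law of a sequence of independent digits uniformly distributed in `B`. -/
def digitLaw (B : Finset (ι → ℤ)) (hB : B.Nonempty) : Measure (ℕ → ι → ℤ) := by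
  classical exact Measure.infinitePi fun _ : ℕ => (PMF.uniformOfFinset B hB).toMeasure

instance (B : Finset (ι → ℤ)) (hB : B.Nonempty) : IsProbabilityMeasure (digitLaw B hB) := by
  unfold digitLaw; infer_instance

theorem invariantMeasure_eq (R : Matrix ι ι ℤ) {B : Finset (ι → ℤ)} (hB : B.Nonempty) :
    invariantMeasure R B = (digitLaw B hB).map (coding R) := by
  rw [invariantMeasure, dif_pos hB]; rfl

theorem ae_digitLaw_mem {B : Finset (ι → ℤ)} (hB : B.Nonempty) :
    ∀ᵐ ω ∂digitLaw B hB, ∀ k, ω k ∈ B := by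
  classical
  rw [ae_all_iff]
  intro k
  have h := (measurePreserving_eval_infinitePi
    (fun _ : ℕ => (PMF.uniformOfFinset B hB).toMeasure) k)
  refine h.quasiMeasurePreserving.ae (p := fun b => b ∈ B) ?_
  rw [ae_iff, uniform_apply]
  simp +contextual

theorem aemeasurable_coding {R : Matrix ι ι ℤ} (hR : IsExpansive R) {B : Finset (ι → ℤ)}
    (hB : B.Nonempty) : AEMeasurable (coding R) (digitLaw B hB) := by
  refine aemeasurable_of_tendsto_metrizable_ae atTop
    (f := fun (n : ℕ) (ω : ℕ → ι → ℤ) => ∑ k ∈ Finset.range n,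
      ((realMat R)⁻¹ ^ (k + 1)) *ᵥ realVec (ω k)) (fun n => ?_) ?_
  · refine (Finset.measurable_sum _ fun k _ => ?_).aemeasurable
    exact (measurable_of_countable fun b : ι → ℤ =>
      ((realMat R)⁻¹ ^ (k + 1)) *ᵥ realVec b).comp (measurable_pi_apply k)
  · filter_upwards [ae_digitLaw_mem hB] with ω hω
    exact (summable_coding hR hω).hasSum.tendsto_sum_nat

theorem integral_uniform {B : Finset (ι → ℤ)} (hB : B.Nonempty) (f : (ι → ℤ) → ℂ) :
    ∫ b, f b ∂(PMF.uniformOfFinset B hB).toMeasure = (B.card : ℂ)⁻¹ * ∑ b ∈ B, f b := by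
  classical
  have h : (PMF.uniformOfFinset B hB).toMeasure =
      (B.card : ENNReal)⁻¹ • ∑ b ∈ B, Measure.dirac b := by
    ext t ht
    rw [uniform_apply, Measure.smul_apply, Measure.finsetSum_apply, smul_eq_mul]
    congr 1
    exact Finset.sum_congr rfl fun b _ => (Measure.dirac_apply b t).symm
  rw [h, integral_smul_measure, integral_finsetSum_measure]
  · simp
  · intro b _
    exact integrable_dirac (by simp)

/-- Independence of the digits: the integral of a product is the product of the means over `B`. -/
theorem integral_prod_digitLaw {B : Finset (ι → ℤ)} (hB : B.Nonempty) (f : ℕ → (ι → ℤ) → ℂ)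
    (n : ℕ) : ∫ ω, ∏ k ∈ Finset.range n, f k (ω k) ∂digitLaw B hB =
      ∏ k ∈ Finset.range n, ((B.card : ℂ)⁻¹ * ∑ b ∈ B, f k b) := by
  classical
  have hind : iIndepFun (fun (i : ℕ) (ω : ℕ → ι → ℤ) => f i (ω i)) (digitLaw B hB) :=
    iIndepFun_infinitePi (P := fun _ : ℕ => (PMF.uniformOfFinset B hB).toMeasure)
      (fun i => measurable_of_countable (f i))
  have hind' : iIndepFun (fun (i : Fin n) (ω : ℕ → ι → ℤ) => f i (ω i)) (digitLaw B hB) :=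
    hind.precomp Fin.val_injective
  simp only [Finset.prod_range]
  rw [hind'.integral_fun_prod_eq_prod_integral]
  · refine Finset.prod_congr rfl fun i _ => ?_
    rw [← integral_uniform hB]
    have := measurePreserving_eval_infinitePi
      (fun _ : ℕ => (PMF.uniformOfFinset B hB).toMeasure) (i : ℕ)
    rw [← this.map_eq, integral_map (measurable_pi_apply _).aemeasurable
      (measurable_of_countable _).aestronglyMeasurable]
    rfl
  · intro i
    exact ((measurable_of_countable (f i)).comp (measurable_pi_apply _)).aestronglyMeasurable

/-- The integral of an infinite product of functions of independent digits. -/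
theorem tendsto_prod_integral_digitLaw {B : Finset (ι → ℤ)} (hB : B.Nonempty)
    (f : ℕ → (ι → ℤ) → ℂ) (hf : ∀ k, ∀ b ∈ B, ‖f k b‖ ≤ 1) (F : (ℕ → ι → ℤ) → ℂ)
    (hF : ∀ ω, (∀ k, ω k ∈ B) →
      Tendsto (fun n => ∏ k ∈ Finset.range n, f k (ω k)) atTop (𝓝 (F ω))) :
    Tendsto (fun n => ∏ k ∈ Finset.range n, ((B.card : ℂ)⁻¹ * ∑ b ∈ B, f k b)) atTop
      (𝓝 (∫ ω, F ω ∂digitLaw B hB)) := by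
  simp only [← integral_prod_digitLaw hB f]
  refine tendsto_integral_of_dominated_convergence (fun _ => 1) (fun n => ?_)
    (integrable_const _) (fun n => ?_) ?_
  · exact (Finset.measurable_fun_prod _ fun k _ =>
      (measurable_of_countable (f k)).comp (measurable_pi_apply _)).aestronglyMeasurable
  · filter_upwards [ae_digitLaw_mem hB] with ω hω
    rw [norm_prod]
    exact Finset.prod_le_one (fun _ _ => norm_nonneg _) fun k _ => hf k _ (hω k)
  · filter_upwards [ae_digitLaw_mem hB] with ω hω using hF ω hω

/-- Transposition moves the powers of the inverse matrix from the digits to `x`; the partial sums of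
the coding then become partial products. -/
theorem character_coding {R : Matrix ι ι ℤ} (hR : IsExpansive R) {B : Finset (ι → ℤ)}
    {ω : ℕ → ι → ℤ} (hω : ∀ k, ω k ∈ B) (x : ι → ℝ) :
    Tendsto (fun n => ∏ k ∈ Finset.range n,
      character (realVec (ω k)) ((realMat Rᵀ)⁻¹ ^ (k + 1) *ᵥ x)) atTop
      (𝓝 (character x (coding R ω))) := by
  have h := (summable_coding hR hω).hasSum.tendsto_sum_nat
  have h2 := ((continuous_character_right x).tendsto _).comp h
  refine h2.congr fun n => ?_
  simp only [Function.comp_apply]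
  rw [character_comm, character_sum_left]
  refine Finset.prod_congr rfl fun k _ => ?_
  rw [character_mulVec, Matrix.transpose_pow, realMat_transpose_inv]

/-- `μ̂_B(x) = ∏_{k ≥ 1} m_B(S^{-k} x)`. -/
theorem tendsto_prod_mask {R : Matrix ι ι ℤ} (hR : IsExpansive R) {B : Finset (ι → ℤ)}
    (hB : B.Nonempty) (x : ι → ℝ) :
    Tendsto (fun n => ∏ k ∈ Finset.range n, mask B ((realMat Rᵀ)⁻¹ ^ (k + 1) *ᵥ x)) atTop
      (𝓝 (fourier (invariantMeasure R B) x)) := by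
  have h := tendsto_prod_integral_digitLaw hB
    (fun k b => character (realVec b) ((realMat Rᵀ)⁻¹ ^ (k + 1) *ᵥ x))
    (fun k b _ => (norm_character _ _).le) (fun ω => character x (coding R ω))
    (fun ω hω => character_coding hR hω x)
  rwa [fourier, invariantMeasure_eq R hB, integral_map (aemeasurable_coding hR hB)
    (continuous_character_right x).aestronglyMeasurable]

/-! ### Walks ending in a cycle -/

theorem branch_eq_iff {A : Matrix ι ι ℤ} (hA : IsExpansive A) (b : ι → ℤ) (x y : ι → ℝ) :
    y = branch A b x ↔ realMat A *ᵥ y = x + realVec b := by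
  constructor
  · rintro rfl
    rw [branch, Matrix.mulVec_mulVec, hA.mul_inv, Matrix.one_mulVec]
  · intro h
    rw [branch, ← h, Matrix.mulVec_mulVec, hA.inv_mul, Matrix.one_mulVec]

theorem branch_sub_branch (A : Matrix ι ι ℤ) (b : ι → ℤ) (x y : ι → ℝ) :
    branch A b x - branch A b y = (realMat A)⁻¹ *ᵥ (x - y) := by
  rw [branch, branch, ← Matrix.mulVec_sub, add_sub_add_right_eq_sub]

/-- The translation parts cancel. This one identity compares all walks that share their digits: with
the walk that lands in the orbit, and with the reference point of a product of weights. -/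
theorem walk_sub (A : Matrix ι ι ℤ) (ω : ℕ → ι → ℤ) (x y : ι → ℝ) (n : ℕ) :
    walk A ω x n - walk A ω y n = (realMat Aᵀ)⁻¹ ^ n *ᵥ (x - y) := by
  induction n with
  | zero => simp [walk]
  | succ n ih => rw [walk, walk, branch_sub_branch, ih, Matrix.mulVec_mulVec, pow_succ']

theorem walk_add (A : Matrix ι ι ℤ) (ω : ℕ → ι → ℤ) (x : ι → ℝ) (n k : ℕ) :
    walk A ω x (n + k) = walk A (fun i => ω (n + i)) (walk A ω x n) k := by
  induction k with
  | zero => rfl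
  | succ k ih => rw [← add_assoc, walk, walk, ih]

theorem walk_congr (A : Matrix ι ι ℤ) {ω ω' : ℕ → ι → ℤ} (x : ι → ℝ) {n : ℕ}
    (h : ∀ i < n, ω i = ω' i) : walk A ω x n = walk A ω' x n := by
  induction n with
  | zero => rfl
  | succ n ih => rw [walk, walk, ih fun i hi => h i (by omega), h n (by omega)]

theorem pow_mulVec_walk {A : Matrix ι ι ℤ} (hA : IsExpansive Aᵀ) (ω : ℕ → ι → ℤ) (x : ι → ℝ)
    (n : ℕ) : realMat Aᵀ ^ n *ᵥ walk A ω x n =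
      x + ∑ i ∈ Finset.range n, realMat Aᵀ ^ i *ᵥ realVec (ω i) := by
  induction n with
  | zero => simp [walk]
  | succ n ih =>
    rw [walk, pow_succ, ← Matrix.mulVec_mulVec, (branch_eq_iff hA (ω n) _ _).1 rfl,
      Matrix.mulVec_add, ih, Finset.sum_range_succ, add_assoc]

/-- The points `c 0, c 1, …` form a periodic orbit, of period `m`, under the maps
`τ_s`, `s ∈ S`. -/
structure IsPeriodicOrbit (A : Matrix ι ι ℤ) (S : Finset (ι → ℤ)) (m : ℕ) (c : ℕ → ι → ℝ)
    (σ : ℕ → ι → ℤ) : Prop where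
  pos : 0 < m
  mem : ∀ n, σ n ∈ S
  step : ∀ n, c (n + 1) = branch Aᵀ (σ n) (c n)
  periodic : ∀ n, c (n + m) = c n

/-- The points that are congruent to a point of the orbit modulo integer vectors. -/
def latticeHull (c : ℕ → ι → ℝ) : Set (ι → ℝ) :=
  {v | ∃ (n : ℕ) (z : ι → ℤ), v = c n + realVec z}

/-- The walk started at `z` with digits `p` is eventually in the orbit. -/
def Lands (A : Matrix ι ι ℤ) (c : ℕ → ι → ℝ) (z : ι → ℝ) (p : ℕ → ι → ℤ) : Prop :=
  ∃ n₀, ∀ n ≥ n₀, walk A p z n ∈ Set.range c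

/-! ### Walks modulo the integer lattice and landing in a periodic orbit -/

namespace IsPeriodicOrbit

variable {A : Matrix ι ι ℤ} {S : Finset (ι → ℤ)} {m : ℕ} {c : ℕ → ι → ℝ} {σ : ℕ → ι → ℤ}

theorem mul_periodic (h : IsPeriodicOrbit A S m c σ) (a : ℕ) : c (a * m) = c 0 := by
  induction a with
  | zero => simp
  | succ a ih => rw [Nat.succ_mul, h.periodic, ih]

theorem finite_range (h : IsPeriodicOrbit A S m c σ) : (Set.range c).Finite := by
  have hp : Function.Periodic c m := h.periodic
  refine ((Set.finite_Iio m).image c).subset ?_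
  rintro _ ⟨n, rfl⟩
  exact ⟨n % m, Nat.mod_lt _ h.pos, hp.map_mod_nat n⟩

theorem mulVec_step (h : IsPeriodicOrbit A S m c σ) (hA : IsExpansive Aᵀ) (n : ℕ) :
    realMat Aᵀ *ᵥ c (n + 1) = c n + realVec (σ n) :=
  (branch_eq_iff hA _ _ _).1 (h.step n)

theorem mulVec_mem_latticeHull (h : IsPeriodicOrbit A S m c σ) (hA : IsExpansive Aᵀ)
    {v : ι → ℝ} (hv : v ∈ latticeHull c) : realMat Aᵀ *ᵥ v ∈ latticeHull c := by
  obtain ⟨n, z, rfl⟩ := hv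
  -- The index `n` is replaced by `n + m`, which has a predecessor even for `n = 0`.
  obtain ⟨k, hk⟩ : ∃ k, n + m = k + 1 := ⟨n + m - 1, by have := h.pos; omega⟩
  refine ⟨k, σ k + Aᵀ *ᵥ z, ?_⟩
  rw [Matrix.mulVec_add, ← h.periodic n, hk, h.mulVec_step hA, realMat_mulVec, realVec_add,
    add_assoc]

theorem add_mem_latticeHull {v : ι → ℝ} (hv : v ∈ latticeHull c) (z : ι → ℤ) :
    v + realVec z ∈ latticeHull c := by
  obtain ⟨n, z', rfl⟩ := hv
  exact ⟨n, z' + z, by rw [realVec_add, add_assoc]⟩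

theorem mem_latticeHull (n : ℕ) : c n ∈ latticeHull c := ⟨n, 0, by simp [realVec_zero]⟩

/-- The `m`-th power of the matrix acts trivially on the orbit modulo integer vectors. -/
theorem pow_mulVec (h : IsPeriodicOrbit A S m c σ) (hA : IsExpansive Aᵀ) {v : ι → ℝ}
    (hv : v ∈ latticeHull c) : ∃ z : ι → ℤ, realMat Aᵀ ^ m *ᵥ v = v + realVec z := by
  -- `S` moves one step back along the orbit modulo integer vectors; `m` steps back lead around the
  -- whole orbit.
  have key : ∀ k n, ∃ z : ι → ℤ, realMat Aᵀ ^ k *ᵥ c (n + k) = c n + realVec z := by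
    intro k
    induction k with
    | zero => exact fun n => ⟨0, by simp [realVec_zero]⟩
    | succ k ih =>
      intro n
      obtain ⟨z, hz⟩ := ih n
      refine ⟨z + Aᵀ ^ k *ᵥ σ (n + k), ?_⟩
      rw [pow_succ, ← Matrix.mulVec_mulVec, ← add_assoc, h.mulVec_step hA, Matrix.mulVec_add, hz,
        ← realMat_pow, realMat_mulVec, realVec_add, add_assoc]
  obtain ⟨n, z, rfl⟩ := hv
  obtain ⟨z', hz'⟩ := key m n
  refine ⟨z' + Aᵀ ^ m *ᵥ z - z, ?_⟩
  rw [Matrix.mulVec_add, ← h.periodic n, hz', ← realMat_pow, realMat_mulVec, realVec_sub,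
    realVec_add, h.periodic n]
  abel

/-- `S` is injective on the hull modulo the lattice, because its `m`-th power is the identity there.
This fails for general real vectors. -/
theorem congr_of_mulVec_congr (h : IsPeriodicOrbit A S m c σ) (hA : IsExpansive Aᵀ)
    {u v : ι → ℝ} (hu : u ∈ latticeHull c) (hv : v ∈ latticeHull c) {z : ι → ℤ}
    (huv : realMat Aᵀ *ᵥ (u - v) = realVec z) : ∃ z' : ι → ℤ, u - v = realVec z' := by
  obtain ⟨a, ha⟩ := h.pow_mulVec hA hu
  obtain ⟨b, hb⟩ := h.pow_mulVec hA hv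
  obtain ⟨k, rfl⟩ : ∃ k, m = k + 1 := ⟨m - 1, by have := h.pos; omega⟩
  refine ⟨Aᵀ ^ k *ᵥ z - a + b, ?_⟩
  have h1 : realMat Aᵀ ^ (k + 1) *ᵥ (u - v) = realVec (Aᵀ ^ k *ᵥ z) := by
    rw [pow_succ, ← Matrix.mulVec_mulVec, huv, ← realMat_pow, realMat_mulVec]
  rw [Matrix.mulVec_sub, ha, hb] at h1
  rw [realVec_add, realVec_sub, ← h1]
  abel

/-- At most one digit leads from a given point to a point congruent to the orbit. -/
theorem digit_unique (h : IsPeriodicOrbit A S m c σ) (hA : IsExpansive Aᵀ)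
    (hS : ∀ s ∈ S, ∀ s' ∈ S, ∀ z : ι → ℤ, s - s' = Aᵀ *ᵥ z → s = s') {s s' : ι → ℤ} (hs : s ∈ S)
    (hs' : s' ∈ S) {x : ι → ℝ} (h1 : branch Aᵀ s x ∈ latticeHull c)
    (h2 : branch Aᵀ s' x ∈ latticeHull c) : s = s' := by
  -- `S` times the difference of the two images is the integer vector `s - s'`, so the images are
  -- congruent, and `s - s'` lies in `S` applied to the lattice.
  have e : realMat Aᵀ *ᵥ (branch Aᵀ s x - branch Aᵀ s' x) = realVec (s - s') := by
    rw [Matrix.mulVec_sub, (branch_eq_iff hA s x _).1 rfl, (branch_eq_iff hA s' x _).1 rfl,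
      realVec_sub]
    abel
  obtain ⟨z, hz⟩ := h.congr_of_mulVec_congr hA h1 h2 e
  refine hS s hs s' hs' z (realVec_injective ?_)
  rw [← e, hz, realMat_mulVec]

/-- Only the tail of the walk is in the orbit, but the whole walk is congruent to it. This is what
allows periodic weights to be compared from the first step on. -/
theorem walk_mem_latticeHull (h : IsPeriodicOrbit A S m c σ) (hA : IsExpansive Aᵀ) {z : ι → ℝ}
    {p : ℕ → ι → ℤ} (hl : Lands A c z p) (n : ℕ) : walk A p z n ∈ latticeHull c := by
  obtain ⟨n₀, hn₀⟩ := hl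
  -- The walk is run backwards by `walk n = S (walk (n + 1)) - p n`, and both operations preserve
  -- the hull.
  have back : ∀ k n, walk A p z (n + k) ∈ latticeHull c → walk A p z n ∈ latticeHull c := by
    intro k
    induction k with
    | zero => exact fun n h => h
    | succ k ih =>
      intro n hn
      refine ih n ?_
      have h1 := h.mulVec_mem_latticeHull hA hn
      rw [← add_assoc, walk, (branch_eq_iff hA _ _ _).1 rfl] at h1
      have h2 := add_mem_latticeHull h1 (-p (n + k))
      rwa [realVec_neg, add_neg_cancel_right] at h2
  refine back n₀ n ?_
  obtain ⟨a, ha⟩ := hn₀ (n + n₀) (by omega)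
  rw [← ha]
  exact mem_latticeHull a

/-- The starting point determines the digits of a walk that lands in the orbit. -/
theorem lands_digits_unique (h : IsPeriodicOrbit A S m c σ) (hA : IsExpansive Aᵀ)
    (hS : ∀ s ∈ S, ∀ s' ∈ S, ∀ z : ι → ℤ, s - s' = Aᵀ *ᵥ z → s = s') {z : ι → ℝ}
    {p p' : ℕ → ι → ℤ} (hp : ∀ i, p i ∈ S) (hp' : ∀ i, p' i ∈ S) (hl : Lands A c z p)
    (hl' : Lands A c z p') : p = p' := by
  have key : ∀ n, ∀ i < n, p i = p' i := by
    intro n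
    induction n with
    | zero => intro i hi; omega
    | succ n ih =>
      intro i hi
      rcases Nat.lt_succ_iff_lt_or_eq.1 hi with hi | rfl
      · exact ih i hi
      · refine h.digit_unique hA hS (hp i) (hp' i) (x := walk A p z i)
          (h.walk_mem_latticeHull hA hl (i + 1)) ?_
        rw [walk_congr A z ih]
        exact h.walk_mem_latticeHull hA hl' (i + 1)
  ext1 i
  exact key (i + 1) i (by omega)

/-- The digits determine the starting point of a walk that lands in the orbit. -/
theorem lands_start_unique (h : IsPeriodicOrbit A S m c σ) (hA : IsExpansive Aᵀ) {z z' : ι → ℝ}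
    {p : ℕ → ι → ℤ} (hl : Lands A c z p) (hl' : Lands A c z' p) : z = z' := by
  obtain ⟨n₀, hn₀⟩ := hl
  obtain ⟨n₁, hn₁⟩ := hl'
  -- The nonzero differences of orbit points form a finite, hence closed, set that misses `0`, while
  -- the difference of the two walks tends to `0`. That difference is eventually zero, and `S^n`
  -- carries this back to the starting points.
  have hfin : (Set.image2 (fun u v => u - v) (Set.range c) (Set.range c) \ {0}).Finite :=
    (h.finite_range.image2 _ h.finite_range).sdiff
  have hev := (hA.tendsto_pow_mulVec (z - z')).eventually
    (hfin.isClosed.isOpen_compl.mem_nhds (by simp))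
  obtain ⟨n, hn, hn'⟩ := (hev.and (eventually_ge_atTop (max n₀ n₁))).exists
  have hd : walk A p z n - walk A p z' n = 0 := by
    by_contra hne
    rw [← walk_sub] at hn
    exact hn ⟨⟨_, hn₀ n (le_of_max_le_left hn'), _, hn₁ n (le_of_max_le_right hn'), rfl⟩, hne⟩
  rw [walk_sub] at hd
  have : realMat Aᵀ ^ n *ᵥ ((realMat Aᵀ)⁻¹ ^ n *ᵥ (z - z')) = 0 := by rw [hd, Matrix.mulVec_zero]
  rw [Matrix.mulVec_mulVec, hA.pow_mul_inv_pow, Matrix.one_mulVec] at this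
  exact sub_eq_zero.1 this

/-- The starting points of the walks that land in the orbit are the points `-k(ω)`. -/
theorem exists_lands_iff (h : IsPeriodicOrbit A S m c σ) (hA : IsExpansive Aᵀ)
    (hS : ∀ s ∈ S, ∀ s' ∈ S, ∀ z : ι → ℤ, s - s' = Aᵀ *ᵥ z → s = s') (z : ι → ℝ) :
    (∃ p : ℕ → ι → ℤ, (∀ i, p i ∈ S) ∧ Lands A c (-z) p) ↔
      ∃ (n : ℕ) (ω : Fin n → ι → ℤ), (∀ i, ω i ∈ S) ∧
        z = ∑ i : Fin n, (realMat Aᵀ ^ (i : ℕ)) *ᵥ realVec (ω i) - (realMat Aᵀ ^ n) *ᵥ c 0 := by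
  -- The walk from `-z` reaches `c 0` at time `n` exactly when `z` is `k` of the first `n` digits.
  have hformula : ∀ (p : ℕ → ι → ℤ) (n : ℕ), walk A p (-z) n = c 0 ↔
      z = ∑ i : Fin n, (realMat Aᵀ ^ (i : ℕ)) *ᵥ realVec (p i) - (realMat Aᵀ ^ n) *ᵥ c 0 := by
    intro p n
    have hw := pow_mulVec_walk hA p (-z) n
    rw [← Finset.sum_range fun i => (realMat Aᵀ ^ i) *ᵥ realVec (p i)]
    constructor
    · intro he
      rw [he] at hw
      rw [hw]; abel
    · intro he
      have h1 : realMat Aᵀ ^ n *ᵥ walk A p (-z) n = realMat Aᵀ ^ n *ᵥ c 0 := by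
        rw [hw, he]
        abel
      have h2 := congrArg (fun v => (realMat Aᵀ)⁻¹ ^ n *ᵥ v) h1
      simpa only [Matrix.mulVec_mulVec, hA.inv_pow_mul_pow, Matrix.one_mulVec] using h2
  constructor
  · rintro ⟨p, hp, n₀, hn₀⟩
    obtain ⟨a, ha⟩ := hn₀ n₀ le_rfl
    -- Once in the orbit, the walk follows it in order: the next digit is forced by `digit_unique`.
    have hk : ∀ k, walk A p (-z) (n₀ + k) = c (a + k) := by
      intro k
      induction k with
      | zero => exact ha.symm
      | succ k ih =>
        have hd : p (n₀ + k) = σ (a + k) := by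
          refine h.digit_unique hA hS (hp _) (h.mem _) (x := c (a + k)) ?_ ?_
          · rw [← ih]
            obtain ⟨b, hb⟩ := hn₀ (n₀ + k + 1) (by omega)
            rw [walk] at hb
            rw [← hb]
            exact mem_latticeHull b
          · rw [← h.step]
            exact mem_latticeHull _
        rw [← add_assoc, ← add_assoc, walk, ih, hd, h.step]
    have hm := h.pos
    -- The walk is at `c a`; after `a * m - a` more steps it is at `c (a * m) = c 0`, the point that
    -- occurs in the formula.
    obtain ⟨k, hak⟩ : ∃ k, a + k = a * m :=
      ⟨a * m - a, Nat.add_sub_cancel' (Nat.le_mul_of_pos_right a hm)⟩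
    have he := hk k
    rw [hak, h.mul_periodic] at he
    exact ⟨n₀ + k, fun i => p i, fun i => hp i, (hformula p _).1 he⟩
  · rintro ⟨n, ω, hω, he⟩
    -- The word `ω` leads to `c 0`, and the digits of the orbit then keep the walk in the orbit.
    set p : ℕ → ι → ℤ := fun i => if hi : i < n then ω ⟨i, hi⟩ else σ (i - n) with hp
    have hstart : walk A p (-z) n = c 0 := by
      rw [hformula, he]
      simp [hp]
    have hk : ∀ k, walk A p (-z) (n + k) = c k := by
      intro k
      induction k with
      | zero => exact hstart
      | succ k ih =>
        rw [← add_assoc, walk, ih, h.step]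
        simp [hp]
    refine ⟨p, fun i => ?_, n, fun k hk' => ?_⟩
    · by_cases hi : i < n
      · simpa [hp, hi] using hω _
      · simpa [hp, hi] using h.mem _
    · obtain ⟨j, rfl⟩ := Nat.exists_eq_add_of_le hk'
      exact ⟨j, (hk j).symm⟩

/-- A walk that approaches the orbit has the digits of a walk that lands in the orbit. -/
theorem exists_lands_of_tendsto (h : IsPeriodicOrbit A S m c σ) (hA : IsExpansive Aᵀ)
    {y : ι → ℝ} {p : ℕ → ι → ℤ} (hp : ∀ i, p i ∈ S) {a : ℕ → ι → ℝ}
    (ha : ∀ n, a n ∈ Set.range c)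
    (ht : Tendsto (fun n => walk A p y n - a n) atTop (𝓝 0)) : ∃ z, Lands A c z p := by
  -- The defect `τ_{p n} (a n) - a (n + 1)` is a combination of two consecutive distances to the
  -- walk, so it tends to `0`. It takes finitely many values, hence it eventually vanishes.
  have hv : Tendsto (fun n => branch Aᵀ (p n) (a n) - a (n + 1)) atTop (𝓝 0) := by
    have h1 := ht.comp (tendsto_add_atTop_nat 1)
    have h2 : Tendsto (fun n => (realMat Aᵀ)⁻¹ *ᵥ (walk A p y n - a n)) atTop (𝓝 0) := by
      have hcont : Continuous fun v : ι → ℝ => (realMat Aᵀ)⁻¹ *ᵥ v := by fun_prop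
      simpa [Function.comp_def] using (hcont.tendsto 0).comp ht
    have h3 := h1.sub h2
    rw [sub_zero] at h3
    refine h3.congr fun n => ?_
    rw [← branch_sub_branch Aᵀ (p n)]
    simp only [Function.comp_apply, walk]
    abel
  have hfin : (Set.image2 (fun (u : (ι → ℝ) × (ι → ℤ)) v => branch Aᵀ u.2 u.1 - v)
      (Set.range c ×ˢ (S : Set (ι → ℤ))) (Set.range c) \ {0}).Finite :=
    ((h.finite_range.prod S.finite_toSet).image2 _ h.finite_range).sdiff
  have hev := hv.eventually (hfin.isClosed.isOpen_compl.mem_nhds (by simp))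
  obtain ⟨n₀, hn₀⟩ := eventually_atTop.1 hev
  have hstep : ∀ n ≥ n₀, a (n + 1) = branch Aᵀ (p n) (a n) := by
    intro n hn
    by_contra hne
    exact hn₀ n hn ⟨⟨(a n, p n), ⟨ha n, hp n⟩, a (n + 1), ha _, rfl⟩,
      fun h0 => hne (sub_eq_zero.1 h0).symm⟩
  -- The start is corrected so that the walk with the same digits passes exactly through `a n₀` at
  -- time `n₀`.
  set z := y - realMat Aᵀ ^ n₀ *ᵥ (walk A p y n₀ - a n₀) with hz
  have hzn : walk A p z n₀ = a n₀ := by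
    have := walk_sub A p y z n₀
    rw [hz, sub_sub_cancel, Matrix.mulVec_mulVec, hA.inv_pow_mul_pow, Matrix.one_mulVec] at this
    exact sub_right_injective this
  refine ⟨z, n₀, fun n hn => ?_⟩
  have : walk A p z n = a n := by
    induction n, hn using Nat.le_induction with
    | base => exact hzn
    | succ n hn ih => rw [walk, ih, hstep n hn]
  rw [this]
  exact ha n

end IsPeriodicOrbit

/-! ### Hadamard families -/

section Hadamard

variable {κ κ' : Type} [Fintype κ] [Fintype κ'] [DecidableEq κ] [DecidableEq κ']
  {R : Matrix ι ι ℤ} {b : κ → ι → ℤ} {l : κ' → ι → ℤ}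

/-- Equal digits would give equal rows of a unitary matrix, whereas distinct rows are orthogonal. -/
theorem IsHadamardFamily.injective_left (h : IsHadamardFamily R b l) : Function.Injective b := by
  intro i i' hii
  by_contra hne
  have h1 := congrFun (congrFun h.2.1 i) i
  have h2 := congrFun (congrFun h.2.1 i) i'
  rw [Matrix.one_apply_eq] at h1
  rw [Matrix.one_apply_ne hne] at h2
  rw [Matrix.mul_apply] at h1 h2
  have : (1 : ℂ) = 0 := by
    rw [← h1, ← h2]
    refine Finset.sum_congr rfl fun j _ => ?_
    simp only [Matrix.conjTranspose_apply, hadamardMatrix, Matrix.of_apply, hii]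
  exact one_ne_zero this

/-- The vectors `l j` are incongruent modulo the lattice `Rᵀ ℤ^d`. -/
theorem IsHadamardFamily.eq_of_sub_eq (h : IsHadamardFamily R b l) (hR : IsExpansive Rᵀ)
    {j j' : κ'} {z : ι → ℤ} (hz : l j - l j' = Rᵀ *ᵥ z) : j = j' := by
  by_contra hne
  have h1 := congrFun (congrFun h.2.2 j) j
  have h2 := congrFun (congrFun h.2.2 j) j'
  rw [Matrix.one_apply_eq] at h1
  rw [Matrix.one_apply_ne hne] at h2
  rw [Matrix.mul_apply] at h1 h2
  -- Congruent vectors give equal columns, since `R⁻¹ b · Rᵀ z = b · z` is an integer.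
  have hc : ∀ i, character ((realMat R)⁻¹ *ᵥ realVec (b i)) (realVec (l j)) =
      character ((realMat R)⁻¹ *ᵥ realVec (b i)) (realVec (l j')) := by
    intro i
    have hl : realVec (l j) = realVec (l j') + realMat Rᵀ *ᵥ realVec z := by
      rw [realMat_mulVec, ← hz, realVec_sub]; abel
    rw [← character_inv_transpose, ← character_inv_transpose, hl, Matrix.mulVec_add,
      Matrix.mulVec_mulVec, hR.inv_mul, Matrix.one_mulVec, character_add_right,
      character_realVec_realVec, mul_one]
  have : (1 : ℂ) = 0 := by
    rw [← h1, ← h2]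
    refine Finset.sum_congr rfl fun i _ => ?_
    simp only [Matrix.conjTranspose_apply, hadamardMatrix, Matrix.of_apply, hc]
  exact one_ne_zero this

theorem IsHadamardFamily.injective_right (h : IsHadamardFamily R b l) (hR : IsExpansive Rᵀ) :
    Function.Injective l := fun j j' hjj =>
  h.eq_of_sub_eq hR (z := 0) (by rw [hjj, sub_self, Matrix.mulVec_zero])

/-- Unitarity preserves the norm of a row vector; the factor is the square of the normalisation
`N^{1/2}`, absent on the left. -/
theorem IsHadamardFamily.sum_norm_sq (h : IsHadamardFamily R b l) [Nonempty κ] (a : κ → ℂ) :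
    ∑ j, ‖∑ i, a i * character ((realMat R)⁻¹ *ᵥ realVec (b i)) (realVec (l j))‖ ^ 2 =
      Fintype.card κ * ∑ i, ‖a i‖ ^ 2 := by
  have hN : (0 : ℝ) < Fintype.card κ := by exact_mod_cast Fintype.card_pos
  set H := hadamardMatrix R b l with hH
  have key : (a ᵥ* H) ⬝ᵥ star (a ᵥ* H) = a ⬝ᵥ star a := by
    rw [Matrix.star_vecMul, Matrix.dotProduct_mulVec, Matrix.vecMul_vecMul, h.2.1,
      Matrix.vecMul_one]
  have hdot : ∀ {n : Type} [Fintype n] (v : n → ℂ), v ⬝ᵥ star v = ((∑ i, ‖v i‖ ^ 2 : ℝ) : ℂ) := by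
    intro n _ v
    rw [dotProduct]
    push_cast
    refine Finset.sum_congr rfl fun i _ => ?_
    rw [← Complex.mul_conj']; rfl
  rw [hdot, hdot] at key
  have key' : ∑ j, ‖(a ᵥ* H) j‖ ^ 2 = ∑ i, ‖a i‖ ^ 2 := by exact_mod_cast key
  rw [← key', Finset.mul_sum]
  refine Finset.sum_congr rfl fun j _ => ?_
  have : (a ᵥ* H) j = ((Real.sqrt (Fintype.card κ))⁻¹ : ℂ) *
      ∑ i, a i * character ((realMat R)⁻¹ *ᵥ realVec (b i)) (realVec (l j)) := by
    rw [Matrix.vecMul, dotProduct, Finset.mul_sum]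
    refine Finset.sum_congr rfl fun i _ => ?_
    simp only [hH, hadamardMatrix, Matrix.of_apply]
    ring
  rw [this, norm_mul, mul_pow, ← Complex.ofReal_inv, Complex.norm_real, Real.norm_eq_abs, sq_abs,
    inv_pow, Real.sq_sqrt hN.le, ← mul_assoc, mul_inv_cancel₀ hN.ne', one_mul]

end Hadamard

/-! ### Block triangular matrices -/

section Block

variable {α β : Type} [Fintype α] [DecidableEq α] [Fintype β] [DecidableEq β]
  {R : Matrix (α ⊕ β) (α ⊕ β) ℤ}

theorem realMat_transpose_mulVec_inr (h : R.toBlocks₁₂ = 0) (v : α ⊕ β → ℝ) :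
    (realMat Rᵀ *ᵥ v) ∘ Sum.inr = realMat R.toBlocks₂₂ᵀ *ᵥ (v ∘ Sum.inr) := by
  ext j
  have : ∀ i, R (Sum.inl i) (Sum.inr j) = 0 := fun i => congrFun (congrFun h i) j
  simp [Matrix.mulVec, dotProduct, realMat, this, Matrix.toBlocks₂₂]

theorem realMat_transpose_mulVec_inl (v : α ⊕ β → ℝ) :
    (realMat Rᵀ *ᵥ v) ∘ Sum.inl =
      realMat R.toBlocks₁₁ᵀ *ᵥ (v ∘ Sum.inl) + realMat R.toBlocks₂₁ᵀ *ᵥ (v ∘ Sum.inr) := by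
  ext j
  simp [Matrix.mulVec, dotProduct, realMat, Matrix.toBlocks₁₁, Matrix.toBlocks₂₁]

theorem branch_inr (hR : IsExpansive R) (h : R.toBlocks₁₂ = 0) (l : α ⊕ β → ℤ) (x : α ⊕ β → ℝ) :
    branch Rᵀ l x ∘ Sum.inr = branch R.toBlocks₂₂ᵀ (l ∘ Sum.inr) (x ∘ Sum.inr) := by
  rw [branch_eq_iff (isExpansive_transpose (isExpansive_toBlocks₂₂ hR h)),
    ← realMat_transpose_mulVec_inr h, (branch_eq_iff (isExpansive_transpose hR) l x _).1 rfl]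
  rfl

/-- The first block row of `S v = x + l` is solved for the first component. The coupling term
contains only the new second component, so it is the same for all digits `l` with a common second
part. -/
theorem branch_inl (hR : IsExpansive R) (h : R.toBlocks₁₂ = 0) (l : α ⊕ β → ℤ) (x : α ⊕ β → ℝ) :
    branch Rᵀ l x ∘ Sum.inl = branch R.toBlocks₁₁ᵀ (l ∘ Sum.inl)
      (x ∘ Sum.inl - realMat R.toBlocks₂₁ᵀ *ᵥ (branch Rᵀ l x ∘ Sum.inr)) := by
  rw [branch_eq_iff (isExpansive_transpose (isExpansive_toBlocks₁₁ hR h))]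
  have h1 := realMat_transpose_mulVec_inl (R := R) (branch Rᵀ l x)
  rw [(branch_eq_iff (isExpansive_transpose hR) l x _).1 rfl] at h1
  have h2 : (x + realVec l) ∘ Sum.inl = x ∘ Sum.inl + realVec (l ∘ Sum.inl) := rfl
  rw [h2] at h1
  rw [sub_add_eq_add_sub, h1, add_sub_cancel_right]

theorem inv_mulVec_inr (hR : IsExpansive R) (h : R.toBlocks₁₂ = 0) (v : α ⊕ β → ℝ) :
    ((realMat Rᵀ)⁻¹ *ᵥ v) ∘ Sum.inr = (realMat R.toBlocks₂₂ᵀ)⁻¹ *ᵥ (v ∘ Sum.inr) := by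
  have := branch_inr hR h 0 v
  simpa only [branch, realVec_zero, add_zero, show (0 : α ⊕ β → ℤ) ∘ Sum.inr = 0 from rfl]
    using this

theorem inv_pow_mulVec_inr (hR : IsExpansive R) (h : R.toBlocks₁₂ = 0) (v : α ⊕ β → ℝ) (n : ℕ) :
    ((realMat Rᵀ)⁻¹ ^ n *ᵥ v) ∘ Sum.inr = (realMat R.toBlocks₂₂ᵀ)⁻¹ ^ n *ᵥ (v ∘ Sum.inr) := by
  induction n with
  | zero => simp
  | succ n ih =>
    rw [pow_succ', pow_succ', ← Matrix.mulVec_mulVec, ← Matrix.mulVec_mulVec,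
      inv_mulVec_inr hR h, ih]

/-- The subspace of vectors `(a, 0)` is invariant, and no coupling arises on it; translation by
`(λ₁, 0)` therefore affects only the first components of the iterates. -/
theorem inv_pow_mulVec_inl (hR : IsExpansive R) (h : R.toBlocks₁₂ = 0) (a : α → ℝ) (n : ℕ) :
    ((realMat Rᵀ)⁻¹ ^ n *ᵥ Sum.elim a 0) ∘ Sum.inl = (realMat R.toBlocks₁₁ᵀ)⁻¹ ^ n *ᵥ a := by
  induction n with
  | zero => simp
  | succ n ih =>
    rw [pow_succ', pow_succ', ← Matrix.mulVec_mulVec, ← Matrix.mulVec_mulVec]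
    have h1 := branch_inl hR h 0 ((realMat Rᵀ)⁻¹ ^ n *ᵥ Sum.elim a 0)
    simp only [branch, realVec_zero, add_zero, show (0 : α ⊕ β → ℤ) ∘ Sum.inl = 0 from rfl] at h1
    rw [inv_mulVec_inr hR h, inv_pow_mulVec_inr hR h, Sum.elim_comp_inr, Matrix.mulVec_zero,
      Matrix.mulVec_zero, Matrix.mulVec_zero, sub_zero, ih] at h1
    exact h1

theorem character_sumElim (a : α → ℤ) (b : β → ℤ) (v : α ⊕ β → ℝ) :
    character (realVec (Sum.elim a b)) v =
      character (realVec a) (v ∘ Sum.inl) * character (realVec b) (v ∘ Sum.inr) := by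
  simp only [character, ← Complex.exp_add]
  congr 1
  simp [dotProduct, realVec]
  ring

end Block

/-! ### The weights of the second component -/

section FiberWeight

variable {β : Type} [Fintype β] [DecidableEq β] {N₁ N₂ : ℕ}

/-- `N₂⁻¹ ∑_j e^{2πi η_ij·y}`. -/
def fiberMask (η : Fin N₁ → Fin N₂ → β → ℤ) (i : Fin N₁) (y : β → ℝ) : ℂ :=
  (N₂ : ℂ)⁻¹ * ∑ j, character (realVec (η i j)) y

/-- The mean over `i` of `|N₂⁻¹ ∑_j e^{2πi η_ij·y}|²`. -/
def fiberWeight (η : Fin N₁ → Fin N₂ → β → ℤ) (y : β → ℝ) : ℝ :=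
  (N₁ : ℝ)⁻¹ * ∑ i, ‖fiberMask η i y‖ ^ 2

variable (η : Fin N₁ → Fin N₂ → β → ℤ)

theorem norm_fiberMask_le (i : Fin N₁) (y : β → ℝ) : ‖fiberMask η i y‖ ≤ 1 := by
  rw [fiberMask, norm_mul, norm_inv, Complex.norm_natCast]
  have : ‖∑ j, character (realVec (η i j)) y‖ ≤ N₂ := by
    refine (norm_sum_le _ _).trans ?_
    simp [norm_character]
  calc (N₂ : ℝ)⁻¹ * ‖∑ j, character (realVec (η i j)) y‖ ≤ (N₂ : ℝ)⁻¹ * N₂ := by gcongr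
    _ ≤ 1 := inv_mul_le_one

/-- A mean of numbers in `[0, 1]` equals one only if each of them does. -/
theorem norm_fiberMask_eq_one [NeZero N₁] {y : β → ℝ} (h : fiberWeight η y = 1) (i : Fin N₁) :
    ‖fiberMask η i y‖ = 1 := by
  have hN : (N₁ : ℝ) ≠ 0 := by exact_mod_cast NeZero.ne N₁
  have hsum : ∑ i : Fin N₁, (1 - ‖fiberMask η i y‖ ^ 2) = 0 := by
    rw [fiberWeight, inv_mul_eq_one₀ hN] at h
    rw [Finset.sum_sub_distrib, ← h]
    simp
  have h0 : ∀ i, 0 ≤ 1 - ‖fiberMask η i y‖ ^ 2 := fun i => by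
    have := norm_fiberMask_le η i y
    have := norm_nonneg (fiberMask η i y)
    nlinarith
  have := (Finset.sum_eq_zero_iff_of_nonneg fun i _ => h0 i).1 hsum i (Finset.mem_univ i)
  have h2 : ‖fiberMask η i y‖ ^ 2 = 1 := by linarith
  exact (pow_eq_one_iff_of_nonneg (norm_nonneg _) two_ne_zero).1 h2

/-- If the mean of finitely many numbers of modulus one has modulus one, they all agree with
it. -/
theorem eq_mean_of_norm_mean_eq_one {N : ℕ} {z : Fin N → ℂ} (hz : ∀ j, ‖z j‖ = 1)
    (h : ‖(N : ℂ)⁻¹ * ∑ j, z j‖ = 1) (j : Fin N) : z j = (N : ℂ)⁻¹ * ∑ j, z j := by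
  have hN : (N : ℂ) ≠ 0 := by
    have := j.pos
    exact_mod_cast this.ne'
  set w := (N : ℂ)⁻¹ * ∑ j, z j with hw
  have hs : ∑ j, z j = N * w := by rw [hw, mul_inv_cancel_left₀ hN]
  have hterm : ∀ j, ((‖z j - w‖ ^ 2 : ℝ) : ℂ) =
      2 - z j * (starRingEnd ℂ) w - w * (starRingEnd ℂ) (z j) := by
    intro j
    have h1 : z j * (starRingEnd ℂ) (z j) = 1 := by rw [Complex.mul_conj', hz j]; simp
    have h2 : w * (starRingEnd ℂ) w = 1 := by rw [Complex.mul_conj', h]; simp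
    push_cast
    rw [← Complex.mul_conj', map_sub]
    linear_combination h1 + h2
  -- The squared distances to the mean sum to `2N - 2N|w|² = 0`.
  have hsum : ((∑ j, ‖z j - w‖ ^ 2 : ℝ) : ℂ) = 0 := by
    rw [Complex.ofReal_sum, Finset.sum_congr rfl fun j _ => hterm j, Finset.sum_sub_distrib,
      Finset.sum_sub_distrib, ← Finset.sum_mul, ← Finset.mul_sum, ← map_sum, hs]
    have h2 : w * (starRingEnd ℂ) w = 1 := by rw [Complex.mul_conj', h]; simp
    simp only [Finset.sum_const, Finset.card_univ, Fintype.card_fin, nsmul_eq_mul, map_mul,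
      Complex.conj_natCast]
    linear_combination (-2 * (N : ℂ)) * h2
  have hsum' : ∑ j, ‖z j - w‖ ^ 2 = 0 := by exact_mod_cast hsum
  have := (Finset.sum_eq_zero_iff_of_nonneg fun j _ => sq_nonneg _).1 hsum' j (Finset.mem_univ j)
  simpa [sub_eq_zero] using this

/-- The weight is invariant under translation by a point where it is one. -/
theorem fiberWeight_add [NeZero N₁] {c : β → ℝ} (h : fiberWeight η c = 1) (y : β → ℝ) :
    fiberWeight η (y + c) = fiberWeight η y := by
  rw [fiberWeight, fiberWeight]
  congr 1
  refine Finset.sum_congr rfl fun i _ => ?_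
  have h1 := norm_fiberMask_eq_one η h i
  -- At `c` all the exponentials with index `i` share one value of modulus one; translation by `c`
  -- multiplies the inner mean by this value.
  have h2 := eq_mean_of_norm_mean_eq_one (fun j => norm_character (realVec (η i j)) c) h1
  have h3 : fiberMask η i (y + c) = fiberMask η i y * fiberMask η i c := by
    conv_lhs => rw [fiberMask]
    simp only [character_add_right]
    rw [Finset.sum_congr rfl fun j _ => by rw [h2 j], ← Finset.sum_mul, ← mul_assoc]
    rfl
  rw [h3, norm_mul, h1, mul_one]

theorem fiberWeight_add_realVec (y : β → ℝ) (z : β → ℤ) :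
    fiberWeight η (y + realVec z) = fiberWeight η y := by
  simp only [fiberWeight, fiberMask, character_add_right, character_realVec_realVec, mul_one]

theorem fiberWeight_add_latticeHull [NeZero N₁] {c : ℕ → β → ℝ}
    (h : ∀ n, fiberWeight η (c n) = 1) (y : β → ℝ) {v : β → ℝ} (hv : v ∈ latticeHull c) :
    fiberWeight η (y + v) = fiberWeight η y := by
  obtain ⟨n, z, rfl⟩ := hv
  rw [← add_assoc, fiberWeight_add_realVec, fiberWeight_add η (h n)]

end FiberWeight

/-! ### The marginal weights of a reducible triple -/

section Marginal

variable {α β : Type} [Fintype α] [DecidableEq α] [Fintype β] [DecidableEq β] {N₁ N₂ : ℕ}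

/-- The digits of a reducible triple. -/
structure IsDigitSplitting (R : Matrix (α ⊕ β) (α ⊕ β) ℤ) (B L : Finset (α ⊕ β → ℤ))
    (ρ : Fin N₁ → α → ℤ) (η : Fin N₁ → Fin N₂ → β → ℤ) (γ : Fin N₁ → Fin N₂ → α → ℤ)
    (s : Fin N₂ → β → ℤ) : Prop where
  expansive : IsExpansive R
  block : R.toBlocks₁₂ = 0
  nonempty : B.Nonempty
  mem_left : ∀ v, v ∈ B ↔ ∃ i j, v = Sum.elim (ρ i) (η i j)
  mem_right : ∀ v, v ∈ L ↔ ∃ i j, v = Sum.elim (γ i j) (s j)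
  hadamard₁ : ∀ j, IsHadamardFamily R.toBlocks₁₁ ρ fun i => γ i j
  hadamard₂ : ∀ i, IsHadamardFamily R.toBlocks₂₂ (η i) s

variable {R : Matrix (α ⊕ β) (α ⊕ β) ℤ} {B L : Finset (α ⊕ β → ℤ)} {ρ : Fin N₁ → α → ℤ}
  {η : Fin N₁ → Fin N₂ → β → ℤ} {γ : Fin N₁ → Fin N₂ → α → ℤ} {s : Fin N₂ → β → ℤ}

namespace IsDigitSplitting

theorem pos (h : IsDigitSplitting R B L ρ η γ s) : 0 < N₁ ∧ 0 < N₂ := by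
  obtain ⟨v, hv⟩ := h.nonempty
  obtain ⟨i, j, -⟩ := (h.mem_left v).1 hv
  exact ⟨i.pos, j.pos⟩

theorem expansive₁ (h : IsDigitSplitting R B L ρ η γ s) : IsExpansive R.toBlocks₁₁ :=
  isExpansive_toBlocks₁₁ h.expansive h.block

theorem expansive₂ (h : IsDigitSplitting R B L ρ η γ s) : IsExpansive R.toBlocks₂₂ :=
  isExpansive_toBlocks₂₂ h.expansive h.block

theorem injective_first (h : IsDigitSplitting R B L ρ η γ s) : Function.Injective ρ :=
  (h.hadamard₁ ⟨0, h.pos.2⟩).injective_left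

theorem injective_second (h : IsDigitSplitting R B L ρ η γ s) : Function.Injective s :=
  (h.hadamard₂ ⟨0, h.pos.1⟩).injective_right (isExpansive_transpose h.expansive₂)

theorem left_eq (h : IsDigitSplitting R B L ρ η γ s) :
    B = (Finset.univ : Finset (Fin N₁ × Fin N₂)).image
      fun q => Sum.elim (ρ q.1) (η q.1 q.2) := by
  ext v
  rw [h.mem_left]
  simp [eq_comm]

theorem left_injective (h : IsDigitSplitting R B L ρ η γ s) :
    Function.Injective fun q : Fin N₁ × Fin N₂ => Sum.elim (ρ q.1) (η q.1 q.2) := by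
  rintro ⟨i, j⟩ ⟨i', j'⟩ he
  have h1 : ρ i = ρ i' := congrArg (fun v => v ∘ Sum.inl) he
  obtain rfl := h.injective_first h1
  have h2 : η i j = η i j' := congrArg (fun v => v ∘ Sum.inr) he
  rw [(h.hadamard₂ i).injective_left h2]

theorem card_left (h : IsDigitSplitting R B L ρ η γ s) : B.card = N₁ * N₂ := by
  rw [h.left_eq, Finset.card_image_of_injective _ h.left_injective]
  simp

theorem mask_eq (h : IsDigitSplitting R B L ρ η γ s) (v : α ⊕ β → ℝ) :
    mask B v = (N₁ : ℂ)⁻¹ *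
      ∑ i, character (realVec (ρ i)) (v ∘ Sum.inl) * fiberMask η i (v ∘ Sum.inr) := by
  rw [mask, h.card_left]
  conv_lhs => rw [h.left_eq]
  rw [Finset.sum_image fun _ _ _ _ he => h.left_injective he, Fintype.sum_prod_type]
  simp only [character_sumElim, fiberMask, Finset.mul_sum]
  refine Finset.sum_congr rfl fun i _ => Finset.sum_congr rfl fun j _ => ?_
  push_cast
  rw [mul_inv]
  ring

/-- The probability that the second component of the digit is `s j`. -/
theorem sum_weight_fiber (h : IsDigitSplitting R B L ρ η γ s) (x : α ⊕ β → ℝ) (j : Fin N₂) :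
    ∑ i, weight B (branch Rᵀ (Sum.elim (γ i j) (s j)) x) =
      fiberWeight η (branch R.toBlocks₂₂ᵀ (s j) (x ∘ Sum.inr)) := by
  have hN := h.pos.1
  have : Nonempty (Fin N₁) := ⟨⟨0, hN⟩⟩
  set y := branch R.toBlocks₂₂ᵀ (s j) (x ∘ Sum.inr) with hy
  -- The coefficients do not involve the first digit: `y` and the coupling term depend only on `j`.
  -- The sum over `i` is thus a Parseval sum for the triple of `ρ` and `γ · j`, which erases the
  -- phases and leaves the numbers `|fiberMask η i y|²`.
  set a : Fin N₁ → ℂ := fun i => (N₁ : ℂ)⁻¹ *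
    (character ((realMat R.toBlocks₁₁)⁻¹ *ᵥ realVec (ρ i))
      (x ∘ Sum.inl - realMat R.toBlocks₂₁ᵀ *ᵥ y) * fiberMask η i y) with ha
  have hw : ∀ i, weight B (branch Rᵀ (Sum.elim (γ i j) (s j)) x) =
      ‖∑ i', a i' * character ((realMat R.toBlocks₁₁)⁻¹ *ᵥ realVec (ρ i'))
        (realVec (γ i j))‖ ^ 2 := by
    intro i
    change ‖mask B _‖ ^ 2 = _
    rw [h.mask_eq, branch_inl h.expansive h.block, branch_inr h.expansive h.block,
      Sum.elim_comp_inl, Sum.elim_comp_inr, ← hy, Finset.mul_sum]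
    congr 2
    refine Finset.sum_congr rfl fun i' _ => ?_
    rw [branch, character_inv_transpose, character_add_right, ha]
    ring
  rw [Finset.sum_congr rfl fun i _ => hw i, (h.hadamard₁ j).sum_norm_sq a, fiberWeight,
    Fintype.card_fin]
  have hn : ∀ i, ‖a i‖ ^ 2 = ((N₁ : ℝ)⁻¹) ^ 2 * ‖fiberMask η i y‖ ^ 2 := by
    intro i
    rw [ha, norm_mul, norm_mul, norm_character, one_mul, mul_pow, norm_inv, Complex.norm_natCast]
  have hN' : (N₁ : ℝ) ≠ 0 := by exact_mod_cast hN.ne'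
  rw [Finset.sum_congr rfl fun i _ => hn i, ← Finset.mul_sum, ← mul_assoc]
  congr 1
  field_simp

end IsDigitSplitting

end Marginal

/-! ### Decoding the digits of a system without overlap -/

section Compact

attribute [local instance] Matrix.linftyOpNormedRing Matrix.linftyOpNormedAlgebra

/-- The coding is a uniform limit of continuous functions on the compact space of digit sequences.
Compactness is used for the measurability of the pieces `τ_b (X_B)`. -/
theorem isCompact_attractor {A : Matrix ι ι ℤ} (hA : IsExpansive A) (B : Finset (ι → ℤ)) :
    IsCompact (attractor A B) := by
  have hset : {ω : ℕ → ι → ℤ | ∀ k, ω k ∈ B} = Set.univ.pi fun _ => (B : Set (ι → ℤ)) := by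
    ext ω; simp
  have hc : IsCompact {ω : ℕ → ι → ℤ | ∀ k, ω k ∈ B} := by
    rw [hset]
    exact isCompact_univ_pi fun _ => B.finite_toSet.isCompact
  refine hc.image_of_continuousOn ?_
  unfold coding
  refine continuousOn_tsum (u := fun k => ‖(realMat A)⁻¹ ^ (k + 1)‖ * ∑ b ∈ B, ‖realVec b‖)
    (fun k => Continuous.continuousOn ?_)
    (((summable_nat_add_iff 1).2 hA.summable_norm_pow).mul_right _) fun k ω hω => ?_
  · have h1 : Continuous fun b : ι → ℤ => realVec b := by
      unfold realVec
      exact continuous_pi fun i => continuous_of_discreteTopology.comp (continuous_apply i)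
    have h2 : Continuous fun v : ι → ℝ => ((realMat A)⁻¹ ^ (k + 1)) *ᵥ v := by fun_prop
    exact h2.comp (h1.comp (continuous_apply k))
  · refine (Matrix.linfty_opNorm_mulVec _ _).trans ?_
    gcongr
    exact Finset.single_le_sum (f := fun b : ι → ℤ => ‖realVec b‖) (fun _ _ => norm_nonneg _) (hω k)

end Compact

theorem measurableSet_branch_attractor {A : Matrix ι ι ℤ} (hA : IsExpansive A)
    (B : Finset (ι → ℤ)) (b : ι → ℤ) : MeasurableSet (branch A b '' attractor A B) :=
  ((isCompact_attractor hA B).image (by unfold branch; fun_prop)).measurableSet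

/-- The shift of digit sequences. -/
def shiftDigits (ω : ℕ → ι → ℤ) : ℕ → ι → ℤ := fun k => ω (k + 1)

theorem consDigit_shiftDigits (ω : ℕ → ι → ℤ) : consDigit (ω 0) (shiftDigits ω) = ω := by
  ext1 n
  cases n <;> rfl

/-- The digit law is the average of its images under `consDigit b`, and the shift undoes each of
these maps. -/
theorem measurePreserving_shiftDigits {B : Finset (ι → ℤ)} (hB : B.Nonempty) :
    MeasurePreserving (shiftDigits (ι := ι)) (digitLaw B hB) (digitLaw B hB) := by
  have hm : Measurable (shiftDigits (ι := ι)) :=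
    measurable_pi_lambda _ fun n => measurable_pi_apply (n + 1)
  refine ⟨hm, ?_⟩
  have h : digitLaw B hB = (B.card : ENNReal)⁻¹ • ∑ b ∈ B, (digitLaw B hB).map (consDigit b) :=
    infinitePi_eq_sum hB
  have hb : ∀ b, ((digitLaw B hB).map (consDigit b)).map shiftDigits = digitLaw B hB := by
    intro b
    rw [Measure.map_map hm (measurable_consDigit b)]
    exact Measure.map_id
  ext t ht
  rw [Measure.map_apply hm ht]
  conv_lhs => rw [h]
  rw [Measure.smul_apply, Measure.finsetSum_apply]
  have hb' : ∀ b ∈ B, ((digitLaw B hB).map (consDigit b)) (shiftDigits ⁻¹' t) =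
      digitLaw B hB t := by
    intro b _
    rw [← Measure.map_apply hm ht, hb]
  rw [Finset.sum_congr rfl hb', Finset.sum_const, nsmul_eq_mul, smul_eq_mul, ← mul_assoc,
    ENNReal.inv_mul_cancel (by exact_mod_cast hB.card_pos.ne') (ENNReal.natCast_ne_top _), one_mul]

theorem coding_eq_branch {A : Matrix ι ι ℤ} (hA : IsExpansive A) {B : Finset (ι → ℤ)}
    {ω : ℕ → ι → ℤ} (hω : ∀ k, ω k ∈ B) :
    coding A ω = branch A (ω 0) (coding A (shiftDigits ω)) := by
  rw [← coding_consDigit hA (B := B) (ω := shiftDigits ω) (fun k => hω (k + 1)),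
    consDigit_shiftDigits]

/-- The pieces are tested one after the other and the first that contains the point supplies the
digit. The set `T` of tested digits is separate from `B` so that the induction leaves the attractor
fixed. -/
theorem exists_measurable_selection {A : Matrix ι ι ℤ} (hA : IsExpansive A)
    (B T : Finset (ι → ℤ)) : ∃ D : (ι → ℝ) → ι → ℤ, Measurable D ∧
      ∀ u, ∀ b ∈ T, u ∈ branch A b '' attractor A B →
        D u ∈ T ∧ u ∈ branch A (D u) '' attractor A B := by
  classical
  induction T using Finset.induction_on with
  | empty => exact ⟨fun _ => 0, measurable_const, by simp⟩
  | insert a T ha ih =>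
    obtain ⟨D, hD, h⟩ := ih
    refine ⟨fun u => if u ∈ branch A a '' attractor A B then a else D u,
      Measurable.ite (measurableSet_branch_attractor hA B a) measurable_const hD,
      fun u b hb hu => ?_⟩
    by_cases h1 : u ∈ branch A a '' attractor A B
    · simpa only [if_pos h1, Finset.mem_insert_self, true_and] using h1
    · simp only [if_neg h1]
      rcases Finset.mem_insert.1 hb with rfl | hb
      · exact absurd hu h1
      · exact ⟨Finset.mem_insert_of_mem (h u b hb hu).1, (h u b hb hu).2⟩

/-- Without overlap, the digits are almost everywhere a measurable function of the point. -/
theorem exists_measurable_decoding {A : Matrix ι ι ℤ} (hA : IsExpansive A) {B : Finset (ι → ℤ)}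
    (hB : B.Nonempty) (hno : ∀ b ∈ B, ∀ b' ∈ B, b ≠ b' → invariantMeasure A B
      (branch A b '' attractor A B ∩ branch A b' '' attractor A B) = 0) :
    ∃ D : (ι → ℝ) → ℕ → ι → ℤ, Measurable D ∧ ∀ᵐ ω ∂digitLaw B hB, D (coding A ω) = ω := by
  obtain ⟨D, hD, hsel⟩ := exists_measurable_selection hA B B
  have hnull : ∀ᵐ u ∂invariantMeasure A B, ∀ q ∈ B ×ˢ B, q.1 ≠ q.2 →
      u ∉ branch A q.1 '' attractor A B ∩ branch A q.2 '' attractor A B := by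
    rw [Filter.eventually_all_finset]
    intro q hq
    obtain ⟨h1, h2⟩ := Finset.mem_product.1 hq
    by_cases hne : q.1 = q.2
    · simp [hne]
    · filter_upwards [measure_eq_zero_iff_ae_notMem.1 (hno _ h1 _ h2 hne)] with u hu _ using hu
  rw [invariantMeasure_eq A hB] at hnull
  -- The selected digit and the true first digit both have pieces that contain the point; if they
  -- differed, the point would lie in a null overlap.
  have hfirst : ∀ᵐ ω ∂digitLaw B hB, D (coding A ω) = ω 0 ∧ coding A ω =
      branch A (ω 0) (coding A (shiftDigits ω)) := by
    filter_upwards [ae_digitLaw_mem hB, ae_of_ae_map (aemeasurable_coding hA hB) hnull]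
      with ω hω hn
    have hmem : coding A ω ∈ branch A (ω 0) '' attractor A B :=
      ⟨coding A (shiftDigits ω), ⟨shiftDigits ω, fun k => hω (k + 1), rfl⟩,
        (coding_eq_branch hA hω).symm⟩
    have hs := hsel _ _ (hω 0) hmem
    refine ⟨?_, coding_eq_branch hA hω⟩
    by_contra hne
    exact hn (D (coding A ω), ω 0) (Finset.mk_mem_product hs.1 (hω 0)) hne ⟨hs.2, hmem⟩
  -- The expanding map that removes the first digit: under the coding it corresponds almost
  -- everywhere to the shift, so the `k`-th digit is read off its `k`-th iterate.
  set T : (ι → ℝ) → ι → ℝ := fun u => realMat A *ᵥ u - realVec (D u) with hT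
  have hTm : Measurable T := by
    refine Measurable.sub ?_ ((measurable_of_countable realVec).comp hD)
    exact Continuous.measurable (by fun_prop)
  have hall : ∀ᵐ ω ∂digitLaw B hB, ∀ k, D (coding A (shiftDigits^[k] ω)) = (shiftDigits^[k] ω) 0 ∧
      coding A (shiftDigits^[k] ω) =
        branch A ((shiftDigits^[k] ω) 0) (coding A (shiftDigits (shiftDigits^[k] ω))) := by
    rw [ae_all_iff]
    intro k
    exact ((measurePreserving_shiftDigits hB).iterate k).quasiMeasurePreserving.ae hfirst
  have hiter : ∀ (ω : ℕ → ι → ℤ) (k j : ℕ), (shiftDigits^[k] ω) j = ω (j + k) := by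
    intro ω k
    induction k with
    | zero => intro j; rfl
    | succ k ih =>
      intro j
      rw [Function.iterate_succ_apply', shiftDigits, ih]
      congr 1
      omega
  refine ⟨fun u k => D (T^[k] u), measurable_pi_lambda _ fun k => hD.comp (hTm.iterate k), ?_⟩
  filter_upwards [hall] with ω hω
  have hTk : ∀ k, T^[k] (coding A ω) = coding A (shiftDigits^[k] ω) := by
    intro k
    induction k with
    | zero => rfl
    | succ k ih =>
      rw [Function.iterate_succ_apply', ih, Function.iterate_succ_apply', hT]
      simp only []
      rw [(hω k).1, (branch_eq_iff hA _ _ _).1 (hω k).2, add_sub_cancel_right]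
  ext1 k
  rw [hTk, (hω k).1, hiter, zero_add]

/-- Parseval's identity for a spectrum of the invariant measure of a system without overlap, for
functions of the digits. -/
theorem hasSum_norm_sq_of_isSpectrum {A : Matrix ι ι ℤ} (hA : IsExpansive A)
    {B : Finset (ι → ℤ)} (hB : B.Nonempty)
    (hno : ∀ b ∈ B, ∀ b' ∈ B, b ≠ b' → invariantMeasure A B
      (branch A b '' attractor A B ∩ branch A b' '' attractor A B) = 0)
    {Λ : Set (ι → ℝ)} (hΛ : IsSpectrum (invariantMeasure A B) Λ) {Φ : (ℕ → ι → ℤ) → ℂ}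
    (hm : AEStronglyMeasurable Φ (digitLaw B hB)) (hb : ∀ᵐ ω ∂digitLaw B hB, ‖Φ ω‖ ≤ 1) :
    HasSum (fun v : Λ => ‖∫ ω, character (v : ι → ℝ) (coding A ω) * Φ ω ∂digitLaw B hB‖ ^ 2)
      (∫ ω, ‖Φ ω‖ ^ 2 ∂digitLaw B hB) := by
  obtain ⟨D, hD, hDc⟩ := exists_measurable_decoding hA hB hno
  set μ := invariantMeasure A B with hμ
  obtain ⟨e, he⟩ := hΛ
  have hμ' : μ = (digitLaw B hB).map (coding A) := invariantMeasure_eq A hB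
  have hc := aemeasurable_coding hA hB
  set g : (ι → ℝ) → ℂ := fun u => hm.mk Φ (D u) with hg
  have hgm : StronglyMeasurable g := hm.stronglyMeasurable_mk.comp_measurable hD
  have hgc : ∀ᵐ ω ∂digitLaw B hB, g (coding A ω) = Φ ω := by
    filter_upwards [hDc, hm.ae_eq_mk] with ω h1 h2
    rw [hg]
    simp only []
    rw [h1, ← h2]
  -- The conjugate compensates for the conjugate linear first argument of the inner product.
  set f : (ι → ℝ) → ℂ := fun u => (starRingEnd ℂ) (g u) with hf
  have hfm : StronglyMeasurable f := by
    exact (Complex.continuous_conj.comp_stronglyMeasurable hgm)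
  have hLp : MemLp f 2 μ := by
    rw [hμ', memLp_map_measure_iff hfm.aestronglyMeasurable hc]
    refine MemLp.of_bound (hfm.aestronglyMeasurable.comp_aemeasurable hc) 1 ?_
    filter_upwards [hgc, hb] with ω h1 h2
    simpa [hf, h1] using h2
  have hsum := e.hasSum_inner_mul_inner (hLp.toLp f) (hLp.toLp f)
  have hint : ∀ F : (ι → ℝ) → ℂ, AEStronglyMeasurable F μ →
      ∫ u, F u ∂μ = ∫ ω, F (coding A ω) ∂digitLaw B hB := by
    intro F hF
    rw [hμ'] at hF ⊢
    exact integral_map hc hF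
  have hinner : ∀ v : Λ, inner ℂ (hLp.toLp f) (e v) =
      ∫ ω, character (v : ι → ℝ) (coding A ω) * Φ ω ∂digitLaw B hB := by
    intro v
    rw [L2.inner_def]
    have h1 : ∫ u, inner ℂ ((hLp.toLp f : (ι → ℝ) → ℂ) u) ((e v : (ι → ℝ) → ℂ) u) ∂μ =
        ∫ u, character (v : ι → ℝ) u * g u ∂μ := by
      refine integral_congr_ae ?_
      filter_upwards [he v, hLp.coeFn_toLp] with u h1 h2
      rw [h1, h2, RCLike.inner_apply, hf]
      simp
    rw [h1, hint (fun u => character (v : ι → ℝ) u * g u)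
      ((continuous_character_right _).aestronglyMeasurable.mul
      hgm.aestronglyMeasurable)]
    refine integral_congr_ae ?_
    filter_upwards [hgc] with ω h
    rw [h]
  have hself : inner ℂ (hLp.toLp f) (hLp.toLp f) =
      ((∫ ω, ‖Φ ω‖ ^ 2 ∂digitLaw B hB : ℝ) : ℂ) := by
    rw [L2.inner_def]
    have h1 : ∫ u, inner ℂ ((hLp.toLp f : (ι → ℝ) → ℂ) u) ((hLp.toLp f : (ι → ℝ) → ℂ) u) ∂μ =
        ∫ u, ((‖g u‖ ^ 2 : ℝ) : ℂ) ∂μ := by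
      refine integral_congr_ae ?_
      filter_upwards [hLp.coeFn_toLp] with u h2
      rw [h2, inner_self_eq_norm_sq_to_K, hf]
      simp
    rw [h1, hint _ (by
      exact (Complex.continuous_ofReal.comp_stronglyMeasurable
        (hgm.norm.pow 2)).aestronglyMeasurable), ← integral_complex_ofReal]
    refine integral_congr_ae ?_
    filter_upwards [hgc] with ω h
    rw [h]
  rw [hself] at hsum
  rw [← Complex.hasSum_ofReal]
  refine hsum.congr_fun ?_
  intro v
  rw [← inner_conj_symm (e v), Complex.mul_conj', hinner v]
  push_cast
  rfl

/-! ### The Fourier transform of the invariant measure of a reducible system -/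

theorem norm_character_sub_one_le (b : ι → ℤ) (x : ι → ℝ) :
    ‖character (realVec b) x - 1‖ ≤ 2 * Real.pi * (∑ i, |(b i : ℝ)|) * ‖x‖ := by
  rw [character, show (2 * Real.pi * Complex.I * ((realVec b ⬝ᵥ x : ℝ) : ℂ)) =
    Complex.I * ((2 * Real.pi * (realVec b ⬝ᵥ x) : ℝ) : ℂ) by push_cast; ring]
  refine Real.norm_exp_I_mul_ofReal_sub_one_le.trans ?_
  have h : ‖realVec b ⬝ᵥ x‖ ≤ (∑ i, |(b i : ℝ)|) * ‖x‖ := by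
    rw [dotProduct, Finset.sum_mul]
    refine (norm_sum_le _ _).trans (Finset.sum_le_sum fun i _ => ?_)
    rw [norm_mul]
    exact mul_le_mul_of_nonneg_left (norm_le_pi_norm x i) (norm_nonneg _)
  rw [norm_mul, Real.norm_of_nonneg (show 0 ≤ 2 * Real.pi by positivity), mul_assoc (2 * Real.pi)]
  exact mul_le_mul_of_nonneg_left h (by positivity)

namespace IsDigitSplitting

variable {α β : Type} [Fintype α] [DecidableEq α] [Fintype β] [DecidableEq β] {N₁ N₂ : ℕ}
  {R : Matrix (α ⊕ β) (α ⊕ β) ℤ} {B L : Finset (α ⊕ β → ℤ)} {ρ : Fin N₁ → α → ℤ}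
  {η : Fin N₁ → Fin N₂ → β → ℤ} {γ : Fin N₁ → Fin N₂ → α → ℤ} {s : Fin N₂ → β → ℤ}

/-- For convergence of the infinite product defining `Φ`: the expression is a mean of exponentials
of integer vectors, each within a multiple of `‖v‖` of `1`, and `‖S^{-k} x‖` is summable. Summing
the constants over `i` makes the bound uniform. -/
theorem exists_norm_sub_one_le (h : IsDigitSplitting R B L ρ η γ s) :
    ∃ C : ℝ, ∀ i (v : α ⊕ β → ℝ),
      ‖character (realVec (ρ i)) (v ∘ Sum.inl) * fiberMask η i (v ∘ Sum.inr) - 1‖ ≤ C * ‖v‖ := by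
  refine ⟨∑ i, (N₂ : ℝ)⁻¹ * ∑ j, 2 * Real.pi *
    ∑ k, |((Sum.elim (ρ i) (η i j) : α ⊕ β → ℤ) k : ℝ)|, fun i v => ?_⟩
  have hN : (N₂ : ℂ) ≠ 0 := by exact_mod_cast h.pos.2.ne'
  have he : character (realVec (ρ i)) (v ∘ Sum.inl) * fiberMask η i (v ∘ Sum.inr) - 1 =
      (N₂ : ℂ)⁻¹ * ∑ j, (character (realVec (Sum.elim (ρ i) (η i j))) v - 1) := by
    rw [Finset.sum_sub_distrib]
    simp only [character_sumElim, fiberMask, ← Finset.mul_sum, Finset.sum_const, Finset.card_univ,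
      Fintype.card_fin, nsmul_eq_mul, mul_one]
    rw [mul_sub, inv_mul_cancel₀ hN]
    ring
  rw [he, norm_mul, norm_inv, Complex.norm_natCast]
  refine le_trans (b := ((N₂ : ℝ)⁻¹ * ∑ j, 2 * Real.pi *
    ∑ k, |((Sum.elim (ρ i) (η i j) : α ⊕ β → ℤ) k : ℝ)|) * ‖v‖) ?_ ?_
  · rw [mul_assoc, Finset.sum_mul]
    gcongr
    exact (norm_sum_le _ _).trans (Finset.sum_le_sum fun j _ => norm_character_sub_one_le _ _)
  · gcongr
    exact Finset.single_le_sum (f := fun i => (N₂ : ℝ)⁻¹ * ∑ j, 2 * Real.pi *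
      ∑ k, |((Sum.elim (ρ i) (η i j) : α ⊕ β → ℤ) k : ℝ)|) (fun i _ => by positivity)
      (Finset.mem_univ i)

/-- Summing over the translates of a point by a spectrum of the first component leaves the
infinite product of the weights of the second component. -/
theorem hasSum_fourier (h : IsDigitSplitting R B L ρ η γ s)
    (hno : ∀ b ∈ Finset.univ.image ρ, ∀ b' ∈ Finset.univ.image ρ, b ≠ b' →
      invariantMeasure R.toBlocks₁₁ (Finset.univ.image ρ)
        (branch R.toBlocks₁₁ b '' attractor R.toBlocks₁₁ (Finset.univ.image ρ) ∩
          branch R.toBlocks₁₁ b' '' attractor R.toBlocks₁₁ (Finset.univ.image ρ)) = 0)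
    {Λ : Set (α → ℝ)} (hΛ : IsSpectrum (invariantMeasure R.toBlocks₁₁ (Finset.univ.image ρ)) Λ)
    (x : α ⊕ β → ℝ) : ∃ G : ℝ,
      Tendsto (fun n => ∏ k ∈ Finset.range n,
        fiberWeight η ((realMat R.toBlocks₂₂ᵀ)⁻¹ ^ (k + 1) *ᵥ (x ∘ Sum.inr))) atTop (𝓝 G) ∧
      HasSum (fun v : Λ => ‖fourier (invariantMeasure R B) (x + Sum.elim (v : α → ℝ) 0)‖ ^ 2)
        G := by
  set B₁ := Finset.univ.image ρ with hB₁def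
  have hB₁ : B₁.Nonempty := ⟨ρ ⟨0, h.pos.1⟩, by simp [hB₁def]⟩
  set z : ℕ → α ⊕ β → ℝ := fun k => (realMat Rᵀ)⁻¹ ^ (k + 1) *ᵥ x with hz
  -- The factors that `x` contributes, as functions of the first digit. The value `0` away from the
  -- digits `ρ i` is immaterial, as almost all sequences stay in `B₁`.
  set f : ℕ → (α → ℤ) → ℂ := fun k => Function.extend ρ (fun i =>
    character (realVec (ρ i)) (z k ∘ Sum.inl) * fiberMask η i (z k ∘ Sum.inr)) 0 with hf
  have hfρ : ∀ k i, f k (ρ i) =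
      character (realVec (ρ i)) (z k ∘ Sum.inl) * fiberMask η i (z k ∘ Sum.inr) :=
    fun k i => h.injective_first.extend_apply _ _ _
  have hmean : ∀ F : (α → ℤ) → ℂ,
      (B₁.card : ℂ)⁻¹ * ∑ b ∈ B₁, F b = (N₁ : ℂ)⁻¹ * ∑ i, F (ρ i) := by
    intro F
    rw [hB₁def, Finset.card_image_of_injective _ h.injective_first,
      Finset.sum_image fun _ _ _ _ he => h.injective_first he]
    simp
  have hnf : ∀ k, ∀ b ∈ B₁, ‖f k b‖ ≤ 1 := by
    intro k b hb
    obtain ⟨i, -, rfl⟩ := Finset.mem_image.1 hb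
    rw [hfρ, norm_mul, norm_character, one_mul]
    exact norm_fiberMask_le η i _
  obtain ⟨C, hC⟩ := h.exists_norm_sub_one_le
  set Φ : (ℕ → α → ℤ) → ℂ := fun ω => ∏' k, f k (ω k) with hΦ
  -- The unconditional product has its intended value on sequences in `B₁`, where the distances of
  -- the factors to `1` are summable.
  have hlim : ∀ ω, (∀ k, ω k ∈ B₁) →
      Tendsto (fun n => ∏ k ∈ Finset.range n, f k (ω k)) atTop (𝓝 (Φ ω)) := by
    intro ω hω
    have hs : Summable fun k => ‖f k (ω k) - 1‖ := by
      refine Summable.of_nonneg_of_le (fun _ => norm_nonneg _) (fun k => ?_)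
        (((summable_nat_add_iff 1).2
          ((isExpansive_transpose h.expansive).summable_norm_pow_mulVec x)).mul_left C)
      obtain ⟨i, -, hi⟩ := Finset.mem_image.1 (hω k)
      rw [← hi, hfρ]
      exact hC i (z k)
    have hmul := (multipliable_one_add_of_summable hs).hasProd.tendsto_prod_nat
    simpa only [add_sub_cancel] using hmul
  have hΦm : AEStronglyMeasurable Φ (digitLaw B₁ hB₁) := by
    refine aestronglyMeasurable_of_tendsto_ae atTop
      (f := fun n ω => ∏ k ∈ Finset.range n, f k (ω k)) (fun n => ?_) ?_
    · exact (Finset.measurable_fun_prod _ fun k _ =>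
        (measurable_of_countable (f k)).comp (measurable_pi_apply _)).aestronglyMeasurable
    · filter_upwards [ae_digitLaw_mem hB₁] with ω hω using hlim ω hω
  have hΦb : ∀ᵐ ω ∂digitLaw B₁ hB₁, ‖Φ ω‖ ≤ 1 := by
    filter_upwards [ae_digitLaw_mem hB₁] with ω hω
    refine le_of_tendsto (hlim ω hω).norm (Eventually.of_forall fun n => ?_)
    rw [norm_prod]
    exact Finset.prod_le_one (fun _ _ => norm_nonneg _) fun k _ => hnf k _ (hω k)
  -- Both sides are limits of the same products: the mask at the `k`-th iterate is the mean over `i`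
  -- of the exponential coming from `v` times `f k (ρ i)`, and independence integrates factor by
  -- factor.
  have hfour : ∀ v : α → ℝ, fourier (invariantMeasure R B) (x + Sum.elim v 0) =
      ∫ ω, character v (coding R.toBlocks₁₁ ω) * Φ ω ∂digitLaw B₁ hB₁ := by
    intro v
    refine tendsto_nhds_unique (tendsto_prod_mask h.expansive h.nonempty _) ?_
    have h1 := tendsto_prod_integral_digitLaw hB₁
      (fun k b => character (realVec b) ((realMat R.toBlocks₁₁ᵀ)⁻¹ ^ (k + 1) *ᵥ v) * f k b)
      (fun k b hb => by
        rw [norm_mul, norm_character, one_mul]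
        exact hnf k b hb)
      (fun ω => character v (coding R.toBlocks₁₁ ω) * Φ ω) (fun ω hω => by
        simp only [Finset.prod_mul_distrib]
        exact (character_coding h.expansive₁ hω v).mul (hlim ω hω))
    refine h1.congr fun n => Finset.prod_congr rfl fun k _ => ?_
    rw [hmean, h.mask_eq]
    congr 1
    refine Finset.sum_congr rfl fun i _ => ?_
    rw [hfρ, Matrix.mulVec_add, ← inv_pow_mulVec_inl h.expansive h.block v (k + 1)]
    have e1 : ((realMat Rᵀ)⁻¹ ^ (k + 1) *ᵥ x + (realMat Rᵀ)⁻¹ ^ (k + 1) *ᵥ Sum.elim v 0) ∘ Sum.inl =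
      z k ∘ Sum.inl + ((realMat Rᵀ)⁻¹ ^ (k + 1) *ᵥ Sum.elim v 0) ∘ Sum.inl := rfl
    have e2 : ((realMat Rᵀ)⁻¹ ^ (k + 1) *ᵥ x + (realMat Rᵀ)⁻¹ ^ (k + 1) *ᵥ Sum.elim v 0) ∘ Sum.inr =
      z k ∘ Sum.inr + ((realMat Rᵀ)⁻¹ ^ (k + 1) *ᵥ Sum.elim v 0) ∘ Sum.inr := rfl
    rw [e1, e2, inv_pow_mulVec_inr h.expansive h.block (Sum.elim v 0), Sum.elim_comp_inr,
      Matrix.mulVec_zero, add_zero, character_add_right]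
    ring
  -- Independence expresses this integral as the product of the means of `|f k|²`. The unimodular
  -- exponentials disappear and `fiberWeight` remains.
  refine ⟨∫ ω, ‖Φ ω‖ ^ 2 ∂digitLaw B₁ hB₁, ?_, ?_⟩
  · have h1 := tendsto_prod_integral_digitLaw hB₁ (fun k b => ((‖f k b‖ ^ 2 : ℝ) : ℂ))
      (fun k b hb => by
        rw [Complex.norm_real, Real.norm_of_nonneg (sq_nonneg _)]
        exact pow_le_one₀ (norm_nonneg _) (hnf k b hb))
      (fun ω => ((‖Φ ω‖ ^ 2 : ℝ) : ℂ)) (fun ω hω => by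
        have h2 := (Complex.continuous_ofReal.tendsto _).comp ((hlim ω hω).norm.pow 2)
        refine h2.congr fun n => ?_
        simp only [Function.comp_apply, norm_prod, ← Finset.prod_pow, Complex.ofReal_prod])
    rw [integral_complex_ofReal] at h1
    rw [← Filter.tendsto_ofReal_iff]
    refine h1.congr fun n => ?_
    rw [Complex.ofReal_prod]
    refine Finset.prod_congr rfl fun k _ => ?_
    rw [hmean, fiberWeight, ← inv_pow_mulVec_inr h.expansive h.block]
    simp only [hfρ, norm_mul, norm_character, one_mul, hz]
    push_cast
    rfl
  · simp only [hfour]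
    exact hasSum_norm_sq_of_isSpectrum h.expansive₁ hB₁ hno hΛ hΦm hΦb

end IsDigitSplitting

/-! ### The path measure of a factor of the random walk -/

variable {β : Type} [Fintype β] [DecidableEq β]

/-- A factor of the random walk of `(R, B, L)`: the maps `π` and `sec` intertwine the dual maps
with the maps `τ_s`, `s ∈ S`, and `w` gives the transition probabilities of the image. -/
structure IsFactor (R : Matrix ι ι ℤ) (B L : Finset (ι → ℤ)) (A : Matrix β β ℤ)
    (S : Finset (β → ℤ)) (π : (ι → ℝ) → β → ℝ) (sec : (ι → ℤ) → β → ℤ)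
    (w : (β → ℝ) → ℝ) : Prop where
  mem : ∀ l ∈ L, sec l ∈ S
  map_branch : ∀ l x, π (branch Rᵀ l x) = branch Aᵀ (sec l) (π x)
  sum_eq : ∀ s ∈ S, ∀ x, ∑ l ∈ L with sec l = s, weight B (branch Rᵀ l x) =
    w (branch Aᵀ s (π x))

/-- A finite sequence in `L`, extended by a constant. -/
def padWord {L : Finset (ι → ℤ)} (l₀ : L) {n : ℕ} (u : Fin n → L) : ℕ → L :=
  fun i => if h : i < n then u ⟨i, h⟩ else l₀

theorem padWord_cons_zero {L : Finset (ι → ℤ)} (l₀ : L) {n : ℕ} (a : L) (u : Fin n → L) :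
    padWord l₀ (Fin.cons a u : Fin (n + 1) → L) 0 = a := by
  simp [padWord]

theorem padWord_cons_succ {L : Finset (ι → ℤ)} (l₀ : L) {n : ℕ} (a : L) (u : Fin n → L) (i : ℕ) :
    padWord l₀ (Fin.cons a u : Fin (n + 1) → L) (i + 1) = padWord l₀ u i := by
  unfold padWord
  by_cases h : i < n
  · rw [dif_pos (by omega), dif_pos h]
    exact Fin.cons_succ (α := fun _ => (L : Type)) a u ⟨i, h⟩
  · rw [dif_neg (by omega), dif_neg h]

theorem walk_succ' (R : Matrix ι ι ℤ) (ω : ℕ → ι → ℤ) (x : ι → ℝ) (n : ℕ) :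
    walk R ω x (n + 1) = walk R (fun i => ω (i + 1)) (branch Rᵀ (ω 0) x) n := by
  rw [add_comm n 1, walk_add]
  simp only [add_comm 1]
  rfl

namespace IsFactor

variable {R : Matrix ι ι ℤ} {B L : Finset (ι → ℤ)} {A : Matrix β β ℤ}
    {S : Finset (β → ℤ)} {π : (ι → ℝ) → β → ℝ} {sec : (ι → ℤ) → β → ℤ}
    {w : (β → ℝ) → ℝ}

theorem map_walk (h : IsFactor R B L A S π sec w) (ω : ℕ → ι → ℤ) (x : ι → ℝ) (n : ℕ) :
    π (walk R ω x n) = walk A (fun i => sec (ω i)) (π x) n := by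
  induction n with
  | zero => rfl
  | succ n ih => rw [walk, walk, h.map_branch, ih]

/-- The total weight of the letters over a given second digit depends only on the image point, so
the sum over words factors. The induction removes the first letter and restarts the walk at its
image. The padding letter `l₀` is never read by the product. -/
theorem sum_words (h : IsFactor R B L A S π sec w) (l₀ : L) (n : ℕ) (x : ι → ℝ)
    (p : ℕ → β → ℤ) (hp : ∀ i, p i ∈ S) :
    (∑ u : Fin n → L, if ∀ i, sec (u i) = p i then ∏ k ∈ Finset.range n,
      weight B (walk R (fun i => (padWord l₀ u i : ι → ℤ)) x (k + 1)) else 0) =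
      ∏ k ∈ Finset.range n, w (walk A p (π x) (k + 1)) := by
  induction n generalizing x p with
  | zero => simp
  | succ n ih =>
    rw [← (Fin.consEquiv fun _ => (L : Type)).sum_comp, Fintype.sum_prod_type]
    have hinner : ∀ a : L, (∑ u : Fin n → L,
        if ∀ i, sec ((Fin.consEquiv fun _ => (L : Type)) (a, u) i) = p i
        then ∏ k ∈ Finset.range (n + 1), weight B (walk R
          (fun i => (padWord l₀ ((Fin.consEquiv fun _ => (L : Type)) (a, u)) i : ι → ℤ)) x (k + 1))
        else 0) =
        if sec a = p 0 then weight B (branch Rᵀ a x) * ∏ k ∈ Finset.range n,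
          w (walk A p (π x) (k + 2)) else 0 := by
      intro a
      by_cases ha : sec a = p 0
      · rw [if_pos ha]
        have h1 := ih (branch Rᵀ a x) (fun i => p (i + 1)) fun i => hp (i + 1)
        have h2 : ∀ k, walk A (fun i => p (i + 1)) (π (branch Rᵀ a x)) (k + 1) =
            walk A p (π x) (k + 2) := by
          intro k
          rw [h.map_branch, ha, ← walk_succ']
        simp only [h2] at h1
        rw [← h1, Finset.mul_sum]
        refine Finset.sum_congr rfl fun u _ => ?_
        have hc : (∀ i, sec ((Fin.consEquiv fun _ => (L : Type)) (a, u) i) = p i) ↔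
            ∀ i : Fin n, sec (u i) = p (i + 1) := by
          rw [Fin.forall_fin_succ]
          simp [Fin.consEquiv, ha]
        simp only [hc]
        split_ifs with hu
        · rw [Finset.prod_range_succ', mul_comm]
          congr 1
          refine Finset.prod_congr rfl fun k _ => ?_
          rw [walk_succ']
          rw [show padWord l₀ ((Fin.consEquiv fun _ => (L : Type)) (a, u)) 0 = a from
            padWord_cons_zero l₀ a u]
          have : (fun i =>
              (padWord l₀ ((Fin.consEquiv fun _ => (L : Type)) (a, u)) (i + 1) : ι → ℤ)) =
              fun i => (padWord l₀ u i : ι → ℤ) := by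
            ext1 i
            exact congrArg _ (padWord_cons_succ l₀ a u i)
          rw [this]
        · simp
      · rw [if_neg ha]
        refine Finset.sum_eq_zero fun u _ => if_neg fun hall => ha ?_
        exact hall 0
    rw [Finset.sum_congr rfl fun a _ => hinner a, Finset.prod_range_succ',
      Finset.sum_coe_sort L fun a => if sec a = p 0 then weight B (branch Rᵀ a x) *
        ∏ k ∈ Finset.range n, w (walk A p (π x) (k + 2)) else 0, ← Finset.sum_filter,
      ← Finset.sum_mul, h.sum_eq _ (hp 0), mul_comm]
    rfl

theorem measurableSet_cylinder {L : Finset (ι → ℤ)} (n : ℕ) (P : ℕ → L → Prop) :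
    MeasurableSet {ω : ℕ → L | ∀ i < n, P i (ω i)} := by
  have : {ω : ℕ → L | ∀ i < n, P i (ω i)} = ⋂ i, ⋂ _ : i < n, (fun ω => ω i) ⁻¹' {a | P i a} := by
    ext ω; simp
  rw [this]
  exact MeasurableSet.iInter fun i => MeasurableSet.iInter fun _ =>
    measurable_pi_apply i (Set.to_countable _).measurableSet

theorem pathMeasure_cylinder_sec (h : IsFactor R B L A S π sec w) (hH : IsHadamardTriple R B L)
    (hB : B.Nonempty) (x : ι → ℝ) (p : ℕ → β → ℤ) (hp : ∀ i, p i ∈ S) (n : ℕ) :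
    pathMeasure hH hB x {ω | ∀ i < n, sec (ω i) = p i} =
      ENNReal.ofReal (∏ k ∈ Finset.range n, w (walk A p (π x) (k + 1))) := by
  classical
  obtain ⟨l₀, hl₀⟩ : L.Nonempty := by
    by_contra hL
    have := sum_weight hH hB x
    rw [Finset.not_nonempty_iff_eq_empty.1 hL] at this
    simp at this
  -- A cylinder of second digits is the disjoint union of the cylinders of the words that project to
  -- it.
  have hset : {ω : ℕ → L | ∀ i < n, sec (ω i) = p i} =
      ⋃ u ∈ (Finset.univ.filter fun u : Fin n → L => ∀ i, sec (u i) = p i),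
        {ω : ℕ → L | ∀ i < n, ω i = padWord ⟨l₀, hl₀⟩ u i} := by
    ext ω
    simp only [Set.mem_ofPred_eq, Finset.mem_filter, Finset.mem_univ, true_and, Set.mem_iUnion,
      exists_prop]
    constructor
    · intro hω
      exact ⟨fun i => ω i, fun i => hω i i.2, fun i hi => by simp [padWord, hi]⟩
    · rintro ⟨u, hu, hω⟩ i hi
      rw [hω i hi]
      simpa [padWord, hi] using hu ⟨i, hi⟩
  rw [hset, measure_biUnion_finset]
  · rw [Finset.sum_congr rfl fun u _ => pathMeasure_cylinder hH hB x (padWord ⟨l₀, hl₀⟩ u) n,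
      ← ENNReal.ofReal_sum_of_nonneg fun u _ => Finset.prod_nonneg fun _ _ => weight_nonneg _ _,
      Finset.sum_filter, h.sum_words ⟨l₀, hl₀⟩ n x p hp]
  · intro u _ u' _ hne
    refine Set.disjoint_left.2 fun ω h1 h2 => hne ?_
    ext1 i
    have := (h1 i i.2).symm.trans (h2 i i.2)
    simpa [padWord] using this
  · intro u _
    exact measurableSet_cylinder n fun i a => a = padWord ⟨l₀, hl₀⟩ u i

theorem measurableSet_path {L : Finset (ι → ℤ)} (sec : (ι → ℤ) → β → ℤ) (p : ℕ → β → ℤ) :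
    MeasurableSet {ω : ℕ → L | ∀ i, sec (ω i) = p i} := by
  have : {ω : ℕ → L | ∀ i, sec (ω i) = p i} =
      ⋂ n, {ω : ℕ → L | ∀ i < n, sec (ω i) = p i} := by
    ext ω
    simp only [Set.mem_ofPred_eq, Set.mem_iInter]
    exact ⟨fun hω n i _ => hω i, fun hω i => hω (i + 1) i (Nat.lt_succ_self i)⟩
  rw [this]
  exact MeasurableSet.iInter fun n => measurableSet_cylinder n fun i (a : L) => sec a = p i

theorem pathMeasure_path (h : IsFactor R B L A S π sec w) (hH : IsHadamardTriple R B L)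
    (hB : B.Nonempty) (x : ι → ℝ) (p : ℕ → β → ℤ) (hp : ∀ i, p i ∈ S) {G : ℝ}
    (hG : Tendsto (fun n => ∏ k ∈ Finset.range n, w (walk A p (π x) (k + 1))) atTop (𝓝 G)) :
    pathMeasure hH hB x {ω | ∀ i, sec (ω i) = p i} = ENNReal.ofReal G := by
  have hset : {ω : ℕ → L | ∀ i, sec (ω i) = p i} =
      ⋂ n, {ω : ℕ → L | ∀ i < n, sec (ω i) = p i} := by
    ext ω
    simp only [Set.mem_ofPred_eq, Set.mem_iInter]
    exact ⟨fun hω n i _ => hω i, fun hω i => hω (i + 1) i (Nat.lt_succ_self i)⟩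
  have hlim : Tendsto (fun n => pathMeasure hH hB x {ω | ∀ i < n, sec (ω i) = p i}) atTop
      (𝓝 (pathMeasure hH hB x {ω | ∀ i, sec (ω i) = p i})) := by
    rw [hset]
    refine tendsto_measure_iInter_atTop
      (fun n => (measurableSet_cylinder n fun i (a : L) => sec a = p i).nullMeasurableSet)
      (fun m n hmn ω hω i hi => hω i (hi.trans_le hmn)) ⟨0, ?_⟩
    rw [h.pathMeasure_cylinder_sec hH hB x p hp]
    exact ENNReal.ofReal_ne_top
  simp only [h.pathMeasure_cylinder_sec hH hB x p hp] at hlim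
  exact tendsto_nhds_unique hlim (ENNReal.tendsto_ofReal hG)

end IsFactor

/-! ### The basin of the preimage of a periodic orbit -/

section Basin

variable {R : Matrix ι ι ℤ} {B L : Finset (ι → ℤ)} {A : Matrix β β ℤ} {S : Finset (β → ℤ)}
  {π : (ι → ℝ) →L[ℝ] (β → ℝ)} {sec : (ι → ℤ) → β → ℤ} {w : (β → ℝ) → ℝ} {m : ℕ}
  {c : ℕ → β → ℝ} {σ : ℕ → β → ℤ}

/-- Convergence to the preimage of the orbit can be tested after projection: `π` is continuous, and
the linear section `θ` lifts a small error in the image to a small error above. -/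
theorem mem_basin_iff (h : IsFactor R B L A S π sec w) (hc : IsPeriodicOrbit A S m c σ)
    (hA : IsExpansive Aᵀ) (θ : (β → ℝ) →L[ℝ] (ι → ℝ)) (hθ : ∀ y, π (θ y) = y) (x : ι → ℝ)
    (ω : ℕ → L) : ω ∈ basin R L (π ⁻¹' Set.range c) x ↔ ∃ z, Lands A c z fun i => sec (ω i) := by
  have hpi : ∀ n, π (walk R (fun i => (ω i : ι → ℤ)) x n) =
      walk A (fun i => sec (ω i)) (π x) n := h.map_walk _ x
  have hne : (π ⁻¹' Set.range c).Nonempty := ⟨θ (c 0), 0, (hθ _).symm⟩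
  constructor
  · intro hω
    -- The slack `1 / (n + 1)` provides a point that almost realises the distance, without asking
    -- that it be attained.
    have hex : ∀ n : ℕ, ∃ f ∈ π ⁻¹' Set.range c, dist (walk R (fun i => (ω i : ι → ℤ)) x n) f <
        Metric.infDist (walk R (fun i => (ω i : ι → ℤ)) x n) (π ⁻¹' Set.range c) +
          1 / (n + 1 : ℝ) :=
      fun n => (Metric.infDist_lt_iff hne).1 (lt_add_of_pos_right _ (by positivity))
    choose f hf hd using hex
    refine hc.exists_lands_of_tendsto hA (y := π x) (fun i => h.mem _ (ω i).2)
      (a := fun n => π (f n)) hf ?_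
    have h0 : Tendsto (fun n => walk R (fun i => (ω i : ι → ℤ)) x n - f n) atTop (𝓝 0) := by
      rw [tendsto_zero_iff_norm_tendsto_zero]
      have hlim := Tendsto.add (show Tendsto _ _ _ from hω)
        (tendsto_one_div_add_atTop_nhds_zero_nat (𝕜 := ℝ))
      rw [add_zero] at hlim
      refine squeeze_zero (fun _ => norm_nonneg _) (fun n => ?_) hlim
      rw [← dist_eq_norm]
      exact (hd n).le
    have h1 := (π.continuous.tendsto 0).comp h0
    rw [map_zero] at h1
    refine h1.congr fun n => ?_
    rw [Function.comp_apply, map_sub, hpi]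
  · rintro ⟨z, n₀, hn₀⟩
    have h0 : Tendsto (fun n => ‖θ ((realMat Aᵀ)⁻¹ ^ n *ᵥ (π x - z))‖) atTop (𝓝 0) := by
      have := ((θ.continuous.norm).tendsto 0).comp (hA.tendsto_pow_mulVec (π x - z))
      simpa [Function.comp_def] using this
    refine squeeze_zero' (Eventually.of_forall fun _ => Metric.infDist_nonneg) ?_ h0
    filter_upwards [eventually_ge_atTop n₀] with n hn
    -- Subtracting the lifted error gives a point whose projection is the walk started at `z`, which
    -- is in the orbit from time `n₀` on.
    have hmem : walk R (fun i => (ω i : ι → ℤ)) x n - θ ((realMat Aᵀ)⁻¹ ^ n *ᵥ (π x - z)) ∈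
        π ⁻¹' Set.range c := by
      rw [Set.mem_preimage, map_sub, hθ, hpi, ← walk_sub A (fun i => sec (ω i)) (π x) z n,
        sub_sub_cancel]
      exact hn₀ n hn
    refine (Metric.infDist_le_dist_of_mem hmem).trans ?_
    rw [dist_eq_norm, sub_sub_cancel]

/-- The points `-z`, where `z` starts a walk that lands in the orbit. -/
def landingSet (A : Matrix β β ℤ) (S : Finset (β → ℤ)) (c : ℕ → β → ℝ) : Set (β → ℝ) :=
  {z | ∃ p : ℕ → β → ℤ, (∀ i, p i ∈ S) ∧ Lands A c (-z) p}

/-- The basin decomposes into one event for each landing point, that of following its digit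
sequence. Countably many words describe all landing points, so the probabilities add up, and
periodicity of `w` identifies each of them with the limit `G z`. -/
theorem pathMeasure_basin (h : IsFactor R B L A S π sec w) (hH : IsHadamardTriple R B L)
    (hB : B.Nonempty) (hc : IsPeriodicOrbit A S m c σ) (hA : IsExpansive Aᵀ)
    (hS : ∀ s ∈ S, ∀ s' ∈ S, ∀ z : β → ℤ, s - s' = Aᵀ *ᵥ z → s = s')
    (hw : ∀ y, ∀ v ∈ latticeHull c, w (y + v) = w y)
    (θ : (β → ℝ) →L[ℝ] (ι → ℝ)) (hθ : ∀ y, π (θ y) = y) (x : ι → ℝ)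
    (G : landingSet A S c → ℝ)
    (hG : ∀ z : landingSet A S c, Tendsto (fun n => ∏ k ∈ Finset.range n,
      w ((realMat Aᵀ)⁻¹ ^ (k + 1) *ᵥ (π x + z))) atTop (𝓝 (G z))) :
    pathMeasure hH hB x (basin R L (π ⁻¹' Set.range c) x) = ∑' z, ENNReal.ofReal (G z) := by
  have hcount : Countable (landingSet A S c) := by
    have hsub : landingSet A S c ⊆ Set.range fun q : Σ n : ℕ, Fin n → β → ℤ =>
        ∑ i : Fin q.1, (realMat Aᵀ ^ (i : ℕ)) *ᵥ realVec (q.2 i) - (realMat Aᵀ ^ q.1) *ᵥ c 0 := by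
      intro z hz
      obtain ⟨n, ω, -, rfl⟩ := (hc.exists_lands_iff hA hS z).1 hz
      exact ⟨⟨n, ω⟩, rfl⟩
    exact ((Set.countable_range _).mono hsub).to_subtype
  choose p hp hl using fun z : landingSet A S c => z.2
  have hset : basin R L (π ⁻¹' Set.range c) x =
      ⋃ z : landingSet A S c, {ω : ℕ → L | ∀ i, sec (ω i) = p z i} := by
    ext ω
    rw [mem_basin_iff h hc hA θ hθ, Set.mem_iUnion]
    constructor
    · rintro ⟨z, hz⟩
      -- Elements of `landingSet` are frequencies, the negatives of starting points.
      have hmem : -z ∈ landingSet A S c :=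
        ⟨fun i => sec (ω i), fun i => h.mem _ (ω i).2, by rwa [neg_neg]⟩
      refine ⟨⟨-z, hmem⟩, fun i => ?_⟩
      have hz' : Lands A c (-(-z)) fun i => sec (ω i) := by rwa [neg_neg]
      exact congrFun (hc.lands_digits_unique hA hS (fun i => h.mem _ (ω i).2) (hp ⟨-z, hmem⟩) hz'
        (hl ⟨-z, hmem⟩)) i
    · rintro ⟨z, hz⟩
      refine ⟨-z, ?_⟩
      have : (fun i => sec (ω i)) = p z := funext hz
      rw [this]
      exact hl z
  rw [hset, measure_iUnion]
  · refine tsum_congr fun z => ?_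
    refine h.pathMeasure_path hH hB x (p z) (hp z) ((hG z).congr fun n => ?_)
    refine Finset.prod_congr rfl fun k _ => ?_
    -- The walks from `π x` and `-z` differ by the inverse power applied to `π x + z`; the second
    -- one lies in the lattice hull, which `w` does not see.
    have h1 := walk_sub A (p z) (π x) (-z) (k + 1)
    rw [sub_neg_eq_add] at h1
    rw [← h1, ← hw (_ - _) _ (hc.walk_mem_latticeHull hA (hl z) (k + 1)), sub_add_cancel]
  · intro z z' hne
    refine Set.disjoint_left.2 fun ω h1 h2 => hne ?_
    have he : p z = p z' := by
      ext1 i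
      rw [← h1 i, ← h2 i]
    have := hc.lands_start_unique hA (hl z) (he ▸ hl z')
    exact Subtype.ext (neg_injective this)
  · exact fun z => IsFactor.measurableSet_path sec (p z)

end Basin

/-! ### Conjugation by a unimodular matrix -/

section Conjugation

variable {κ : Type} [Fintype κ] [DecidableEq κ] {R : Matrix ι ι ℤ} {B : Finset (ι → ℤ)}
  {U : Matrix κ ι ℤ} {U' : Matrix ι κ ℤ}

theorem realMat_mul_transpose {m n : Type} [Fintype m] [Fintype n] [DecidableEq m]
    {X : Matrix m n ℤ} {Y : Matrix n m ℤ} (h : X * Y = 1) : realMat Yᵀ * realMat Xᵀ = 1 := by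
  rw [← realMat_mul, ← Matrix.transpose_mul, h, Matrix.transpose_one, realMat_one]

theorem branch_conj (hR : IsExpansive R) (h : U * U' = 1) (h' : U' * U = 1) (l : ι → ℤ)
    (x : ι → ℝ) : realMat U'ᵀ *ᵥ branch Rᵀ l x =
      branch (U * R * U')ᵀ (U'ᵀ *ᵥ l) (realMat U'ᵀ *ᵥ x) := by
  rw [branch_eq_iff (isExpansive_transpose (isExpansive_conj hR h h')), Matrix.transpose_mul,
    Matrix.transpose_mul, realMat_mul, realMat_mul, Matrix.mulVec_mulVec, Matrix.mul_assoc,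
    Matrix.mul_assoc, realMat_mul_transpose h', Matrix.mul_one, ← Matrix.mulVec_mulVec,
    (branch_eq_iff (isExpansive_transpose hR) l x _).1 rfl, Matrix.mulVec_add, realMat_mulVec]

theorem mask_conj (h' : U' * U = 1) (x : ι → ℝ) :
    mask (B.image fun b => U *ᵥ b) (realMat U'ᵀ *ᵥ x) = mask B x := by
  have hinj : Function.Injective fun b : ι → ℤ => U *ᵥ b := by
    intro a b hab
    have := congrArg (fun v => U' *ᵥ v) hab
    simpa [Matrix.mulVec_mulVec, h'] using this
  rw [mask, mask, Finset.card_image_of_injective _ hinj,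
    Finset.sum_image fun _ _ _ _ he => hinj he]
  congr 1
  refine Finset.sum_congr rfl fun b _ => ?_
  have : realMat U'ᵀ = (realMat U')ᵀ := rfl
  rw [this, ← character_mulVec, realMat_mulVec, Matrix.mulVec_mulVec, h', Matrix.one_mulVec]

theorem weight_conj (h' : U' * U = 1) (x : ι → ℝ) :
    weight (B.image fun b => U *ᵥ b) (realMat U'ᵀ *ᵥ x) = weight B x := by
  change ‖mask _ _‖ ^ 2 = ‖mask _ _‖ ^ 2
  rw [mask_conj h']

/-- The factors of the two infinite products agree one by one, so the measure itself need not be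
transported. -/
theorem fourier_conj (hR : IsExpansive R) (hB : B.Nonempty) (h : U * U' = 1) (h' : U' * U = 1)
    (x : ι → ℝ) : fourier (invariantMeasure (U * R * U') (B.image fun b => U *ᵥ b))
      (realMat U'ᵀ *ᵥ x) = fourier (invariantMeasure R B) x := by
  refine tendsto_nhds_unique (tendsto_prod_mask (isExpansive_conj hR h h') (hB.image _) _)
    ((tendsto_prod_mask hR hB x).congr fun n => Finset.prod_congr rfl fun k _ => ?_)
  have hpow : ∀ k : ℕ, (realMat (U * R * U')ᵀ)⁻¹ ^ k *ᵥ (realMat U'ᵀ *ᵥ x) =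
      realMat U'ᵀ *ᵥ ((realMat Rᵀ)⁻¹ ^ k *ᵥ x) := by
    intro k
    induction k with
    | zero => simp
    | succ k ih =>
      rw [pow_succ', pow_succ', ← Matrix.mulVec_mulVec, ih, ← Matrix.mulVec_mulVec]
      have := branch_conj hR h h' 0 ((realMat Rᵀ)⁻¹ ^ k *ᵥ x)
      simpa only [branch, realVec_zero, Matrix.mulVec_zero, add_zero] using this.symm
  rw [hpow, mask_conj h']

end Conjugation

/-! ### Trajectories -/

/-- Trajectories come from infinite admissible sequences. A single admissible step extends to one
because the transition weights at each point sum to one, so some digit has nonzero weight. -/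
theorem branch_mem_trajectories {R : Matrix ι ι ℤ} {B L : Finset (ι → ℤ)}
    (hH : IsHadamardTriple R B L) (hB : B.Nonempty) {x : ι → ℝ} {l : ι → ℤ} (hl : l ∈ L)
    (hw : weight B (branch Rᵀ l x) ≠ 0) : branch Rᵀ l x ∈ trajectories R B L x := by
  have hex : ∀ y, ∃ l ∈ L, weight B (branch Rᵀ l y) ≠ 0 := by
    intro y
    by_contra! hne
    have := sum_weight hH hB y
    rw [Finset.sum_eq_zero hne] at this
    exact zero_ne_one this
  choose nxt hnxt hnw using hex
  set pts : ℕ → ι → ℝ := fun n => (fun y => branch Rᵀ (nxt y) y)^[n] (branch Rᵀ l x) with hpts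
  have hsucc : ∀ n, pts (n + 1) = branch Rᵀ (nxt (pts n)) (pts n) := fun n =>
    Function.iterate_succ_apply' _ n _
  set ω : ℕ → ι → ℤ := fun n => Nat.casesOn n l fun k => nxt (pts k) with hω
  have hwalk : ∀ n, walk R ω x (n + 1) = pts n := by
    intro n
    induction n with
    | zero => rfl
    | succ n ih => rw [walk, ih, hsucc]
  refine ⟨ω, fun i => ?_, fun n => ?_, 0, rfl⟩
  · cases i with
    | zero => exact hl
    | succ i => exact hnxt _
  · rw [hwalk]
    cases n with
    | zero => exact hw
    | succ n =>
      rw [hsucc]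
      exact hnw _

/-! ### The reduction of the random walk -/

theorem firstDigits_eq {r t N₁ N₂ : ℕ} {R : Matrix (Fin r ⊕ Fin t) (Fin r ⊕ Fin t) ℤ}
    {B L : Finset (Fin r ⊕ Fin t → ℤ)} {ρ : Fin N₁ → Fin r → ℤ} {η : Fin N₁ → Fin N₂ → Fin t → ℤ}
    {γ : Fin N₁ → Fin N₂ → Fin r → ℤ} {s : Fin N₂ → Fin t → ℤ}
    (h : IsDigitSplitting R B L ρ η γ s) : firstDigits B = Finset.univ.image ρ := by
  ext a
  simp only [firstDigits, Finset.mem_image, Finset.mem_univ, true_and]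
  constructor
  · rintro ⟨v, hv, rfl⟩
    obtain ⟨i, j, rfl⟩ := (h.mem_left v).1 hv
    exact ⟨i, rfl⟩
  · rintro ⟨i, rfl⟩
    exact ⟨_, (h.mem_left _).2 ⟨i, ⟨0, h.pos.2⟩, rfl⟩, rfl⟩

theorem secondDigits_eq {r t N₁ N₂ : ℕ} {R : Matrix (Fin r ⊕ Fin t) (Fin r ⊕ Fin t) ℤ}
    {B L : Finset (Fin r ⊕ Fin t → ℤ)} {ρ : Fin N₁ → Fin r → ℤ} {η : Fin N₁ → Fin N₂ → Fin t → ℤ}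
    {γ : Fin N₁ → Fin N₂ → Fin r → ℤ} {s : Fin N₂ → Fin t → ℤ}
    (h : IsDigitSplitting R B L ρ η γ s) : secondDigits L = Finset.univ.image s := by
  ext a
  simp only [secondDigits, Finset.mem_image, Finset.mem_univ, true_and]
  constructor
  · rintro ⟨v, hv, rfl⟩
    obtain ⟨i, j, rfl⟩ := (h.mem_right v).1 hv
    exact ⟨j, rfl⟩
  · rintro ⟨j, rfl⟩
    exact ⟨_, (h.mem_right _).2 ⟨⟨0, h.pos.1⟩, j, rfl⟩, rfl⟩

/-- The second component of `(Uᵀ)⁻¹ x`. -/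
def secondMap {d r t : ℕ} (U' : Matrix (Fin d) (Fin r ⊕ Fin t) ℤ) :
    (Fin d → ℝ) →L[ℝ] (Fin t → ℝ) :=
  ((LinearMap.funLeft ℝ ℝ Sum.inr).comp (Matrix.mulVecLin (realMat U'ᵀ))).toContinuousLinearMap

theorem secondMap_apply {d r t : ℕ} (U' : Matrix (Fin d) (Fin r ⊕ Fin t) ℤ) (x : Fin d → ℝ) :
    secondMap U' x = (realMat U'ᵀ *ᵥ x) ∘ Sum.inr := rfl

/-- The section `y ↦ Uᵀ (0, y)` of `secondMap`. -/
def secondSection {d r t : ℕ} (U : Matrix (Fin r ⊕ Fin t) (Fin d) ℤ) :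
    (Fin t → ℝ) →L[ℝ] (Fin d → ℝ) :=
  ((Matrix.mulVecLin (realMat Uᵀ)).comp
    (LinearMap.pi (Sum.elim (fun _ => 0) fun j => LinearMap.proj j) :
      (Fin t → ℝ) →ₗ[ℝ] (Fin r ⊕ Fin t → ℝ))).toContinuousLinearMap

section Reduction

variable {d r t : ℕ} {R : Matrix (Fin d) (Fin d) ℤ} {B L : Finset (Fin d → ℤ)}
  {V : Submodule ℝ (Fin d → ℝ)} {U : Matrix (Fin r ⊕ Fin t) (Fin d) ℤ}
  {U' : Matrix (Fin d) (Fin r ⊕ Fin t) ℤ}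

namespace IsReduction

theorem secondMap_secondSection (h : IsReduction R B L V U U') (y : Fin t → ℝ) :
    secondMap U' (secondSection U y) = y := by
  have : secondSection U y = realMat Uᵀ *ᵥ (fun k => (Sum.elim (fun _ => 0)
    (fun j => LinearMap.proj j) k : (Fin t → ℝ) →ₗ[ℝ] ℝ) y) := rfl
  rw [secondMap_apply, this, Matrix.mulVec_mulVec, realMat_mul_transpose h.mul_inv,
    Matrix.one_mulVec]
  ext j
  simp

theorem mem_subspace_iff (h : IsReduction R B L V U U') (v : Fin d → ℝ) :
    v ∈ V ↔ secondMap U' v = 0 := by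
  have hs := h.map_subspace
  constructor
  · intro hv
    have : realMat U'ᵀ *ᵥ v ∈ {v : Fin r ⊕ Fin t → ℝ | ∀ j : Fin t, v (Sum.inr j) = 0} := by
      rw [← hs]
      exact Submodule.mem_map_of_mem (f := Matrix.mulVecLin (realMat U'ᵀ)) hv
    ext j
    exact this j
  · intro hv
    have hm : realMat U'ᵀ *ᵥ v ∈ (V.map (Matrix.mulVecLin (realMat U'ᵀ)) :
        Set (Fin r ⊕ Fin t → ℝ)) := by
      rw [hs]
      exact fun j => congrFun hv j
    obtain ⟨v', hv', he⟩ := hm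
    have := congrArg (fun y => realMat Uᵀ *ᵥ y) he
    simp only [Matrix.mulVecLin_apply, Matrix.mulVec_mulVec, realMat_mul_transpose h.inv_mul,
      Matrix.one_mulVec] at this
    rwa [← this]

/-- The digits of `L` over `s j` are, after conjugation, exactly the `(γ i j, s j)` with `i` free;
the marginal weight `sum_weight_fiber` then applies. -/
theorem isFactor (h : IsReduction R B L V U U') (hR : IsExpansive R) {N₁ N₂ : ℕ}
    {ρ : Fin N₁ → Fin r → ℤ} {η : Fin N₁ → Fin N₂ → Fin t → ℤ} {γ : Fin N₁ → Fin N₂ → Fin r → ℤ}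
    {s : Fin N₂ → Fin t → ℤ} (hs : IsDigitSplitting (U * R * U') (B.image fun b => U *ᵥ b)
      (L.image fun l => U'ᵀ *ᵥ l) ρ η γ s) :
    IsFactor R B L (U * R * U').toBlocks₂₂ (Finset.univ.image s) (secondMap U')
      (fun l => (U'ᵀ *ᵥ l) ∘ Sum.inr) (fiberWeight η) where
  mem l hl := by
    obtain ⟨i, j, he⟩ := (hs.mem_right _).1 (Finset.mem_image_of_mem _ hl)
    rw [he]
    simp
  map_branch l x := by
    rw [secondMap_apply, branch_conj hR h.mul_inv h.inv_mul, branch_inr hs.expansive hs.block]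
    rfl
  sum_eq a ha x := by
    obtain ⟨j, -, rfl⟩ := Finset.mem_image.1 ha
    have hinj : Function.Injective fun l : Fin d → ℤ => U'ᵀ *ᵥ l := by
      intro a b hab
      have := congrArg (fun v => Uᵀ *ᵥ v) hab
      simpa [Matrix.mulVec_mulVec, ← Matrix.transpose_mul, h.inv_mul] using this
    rw [secondMap_apply, ← hs.sum_weight_fiber]
    have hinj' : Function.Injective fun i => Sum.elim (γ i j) (s j) := by
      intro i i' hii
      exact (hs.hadamard₁ j).injective_right (isExpansive_transpose hs.expansive₁)
        (congrArg (fun v => v ∘ Sum.inl) hii)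
    have himg : (L.filter fun l => (U'ᵀ *ᵥ l) ∘ Sum.inr = s j).image (fun l => U'ᵀ *ᵥ l) =
        Finset.univ.image fun i => Sum.elim (γ i j) (s j) := by
      ext v
      simp only [Finset.mem_image, Finset.mem_filter, Finset.mem_univ, true_and]
      constructor
      · rintro ⟨l, ⟨hl, he⟩, rfl⟩
        obtain ⟨i, j', hv⟩ := (hs.mem_right _).1 (Finset.mem_image_of_mem _ hl)
        rw [hv, Sum.elim_comp_inr] at he
        obtain rfl := hs.injective_second he
        exact ⟨i, hv.symm⟩
      · rintro ⟨i, rfl⟩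
        obtain ⟨l, hl, he⟩ := Finset.mem_image.1 ((hs.mem_right _).2 ⟨i, j, rfl⟩)
        exact ⟨l, ⟨hl, by rw [he, Sum.elim_comp_inr]⟩, he⟩
    have h1 : ∑ v ∈ (L.filter fun l => (U'ᵀ *ᵥ l) ∘ Sum.inr = s j).image (fun l => U'ᵀ *ᵥ l),
        weight (B.image fun b => U *ᵥ b) (branch (U * R * U')ᵀ v (realMat U'ᵀ *ᵥ x)) =
        ∑ i, weight (B.image fun b => U *ᵥ b)
          (branch (U * R * U')ᵀ (Sum.elim (γ i j) (s j)) (realMat U'ᵀ *ᵥ x)) := by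
      rw [himg, Finset.sum_image fun _ _ _ _ he => hinj' he]
    rw [← h1, Finset.sum_image fun _ _ _ _ he => hinj he]
    refine Finset.sum_congr rfl fun l _ => ?_
    rw [← branch_conj hR h.mul_inv h.inv_mul, weight_conj h.inv_mul]

/-- The second components of the points of a cycle form a periodic orbit. -/
theorem isPeriodicOrbit (h : IsReduction R B L V U U') (hR : IsExpansive R) {N₁ N₂ : ℕ}
    {ρ : Fin N₁ → Fin r → ℤ} {η : Fin N₁ → Fin N₂ → Fin t → ℤ} {γ : Fin N₁ → Fin N₂ → Fin r → ℤ}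
    {s : Fin N₂ → Fin t → ℤ} (hs : IsDigitSplitting (U * R * U') (B.image fun b => U *ᵥ b)
      (L.image fun l => U'ᵀ *ᵥ l) ρ η γ s) {m : ℕ} {l : ℕ → Fin d → ℤ} {x₀ : Fin d → ℝ}
    (hC : IsCycle R L m l x₀) :
    IsPeriodicOrbit (U * R * U').toBlocks₂₂ (Finset.univ.image s) m
      (fun n => secondMap U' (walk R l x₀ (n % m))) fun n => (U'ᵀ *ᵥ l (n % m)) ∘ Sum.inr where
  pos := hC.pos
  mem n := (h.isFactor hR hs).mem _ (hC.mem _ (Nat.mod_lt _ hC.pos))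
  step n := by
    rw [← (h.isFactor hR hs).map_branch]
    congr 1
    change _ = walk R l x₀ (n % m + 1)
    have hlt := Nat.mod_lt n hC.pos
    -- Either the step stays inside the listed points, or `n % m` is the last index and the cycle
    -- closes up at `x₀`.
    rcases Nat.lt_or_eq_of_le (Nat.succ_le_of_lt hlt) with hlt' | he
    · rw [Nat.add_mod, Nat.mod_eq_of_lt (show n % m + 1 % m < m from
        (Nat.add_le_add_left (Nat.mod_le 1 m) _).trans_lt hlt')]
      rw [Nat.mod_eq_of_lt (show 1 < m by omega)]
    · have he' : n % m + 1 = m := he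
      have h0 : (n + 1) % m = 0 := by
        rw [← Nat.div_add_mod n m, add_assoc, he']
        simp
      rw [h0, he', hC.closed]
      rfl
  periodic n := by simp

theorem cycleTranslates_eq (h : IsReduction R B L V U U') {m : ℕ} (hm : 0 < m)
    (l : ℕ → Fin d → ℤ) (x₀ : Fin d → ℝ) : cycleTranslates R m l x₀ V =
      secondMap U' ⁻¹' Set.range fun n => secondMap U' (walk R l x₀ (n % m)) := by
  ext v
  simp only [cycleTranslates, cyclePoints, Set.mem_ofPred_eq, Set.mem_preimage, Set.mem_range]
  constructor
  · rintro ⟨_, ⟨n, hn, rfl⟩, hv⟩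
    refine ⟨n, ?_⟩
    rw [h.mem_subspace_iff, map_sub, sub_eq_zero] at hv
    rw [Nat.mod_eq_of_lt hn, hv]
  · rintro ⟨n, hn⟩
    refine ⟨_, ⟨n % m, Nat.mod_lt _ hm, rfl⟩, ?_⟩
    rw [h.mem_subspace_iff, map_sub, hn, sub_self]

end IsReduction

/-- Where the preimage of the orbit is an invariant set, the walk on the orbit is
deterministic. -/
theorem weight_orbit_eq_one {β : Type} [Fintype β] [DecidableEq β] {R : Matrix ι ι ℤ}
    {B L : Finset (ι → ℤ)} {A : Matrix β β ℤ} {S : Finset (β → ℤ)}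
    {π : (ι → ℝ) →L[ℝ] (β → ℝ)} {sec : (ι → ℤ) → β → ℤ} {w : (β → ℝ) → ℝ} {m : ℕ}
    {c : ℕ → β → ℝ} {σ : ℕ → β → ℤ} (h : IsFactor R B L A S π sec w)
    (hH : IsHadamardTriple R B L) (hB : B.Nonempty) (hc : IsPeriodicOrbit A S m c σ)
    (hA : IsExpansive Aᵀ) (hS : ∀ s ∈ S, ∀ s' ∈ S, ∀ z : β → ℤ, s - s' = Aᵀ *ᵥ z → s = s')
    (hπ : Function.Surjective π) (hinv : IsInvariantSet R B L (π ⁻¹' Set.range c)) (n : ℕ) :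
    w (c n) = 1 := by
  have hsucc : ∀ n, w (c (n + 1)) = 1 := by
    intro n
    obtain ⟨x, hx⟩ := hπ (c n)
    -- The weights of all digits sum to one, so it suffices that a digit over another second part
    -- has weight zero. Otherwise invariance puts its image over the orbit, and `digit_unique` makes
    -- the second parts equal.
    rw [hc.step, ← hx, ← h.sum_eq _ (hc.mem n) x, ← sum_weight hH hB x, Finset.sum_filter]
    refine Finset.sum_congr rfl fun l hl => ?_
    split_ifs with he
    · rfl
    · by_contra hne
      have hmem := hinv.2 x ⟨n, hx.symm⟩
        (subset_closure (branch_mem_trajectories hH hB hl (Ne.symm hne)))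
      rw [Set.mem_preimage, h.map_branch, hx] at hmem
      obtain ⟨k, hk⟩ := hmem
      refine he (hc.digit_unique hA hS (h.mem l hl) (hc.mem n) (x := c n) ?_ ?_)
      · rw [← hk]
        exact IsPeriodicOrbit.mem_latticeHull k
      · rw [← hc.step]
        exact IsPeriodicOrbit.mem_latticeHull _
  -- Each orbit point is the successor of another one, by periodicity.
  obtain ⟨k, hk⟩ : ∃ k, n + m = k + 1 := ⟨n + m - 1, by have := hc.pos; omega⟩
  rw [← hc.periodic n, hk]
  exact hsucc k

/-! ### Assembly of the sum formula -/

theorem hasSum_of_tsum_ofReal {α : Type} {f : α → ℝ} (hf : ∀ a, 0 ≤ f a) {x : ENNReal}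
    (hx : x ≠ ⊤) (h : x = ∑' a, ENNReal.ofReal (f a)) : HasSum f x.toReal := by
  have h1 := ENNReal.hasSum_toReal (h ▸ hx)
  rw [← ENNReal.tsum_toReal_eq fun _ => ENNReal.ofReal_ne_top, ← h] at h1
  simpa only [ENNReal.toReal_ofReal (hf _)] using h1

instance isProbabilityMeasure_pathMeasure {R : Matrix ι ι ℤ} {B L : Finset (ι → ℤ)}
    (hH : IsHadamardTriple R B L) (hB : B.Nonempty) (x : ι → ℝ) :
    IsProbabilityMeasure (pathMeasure hH hB x) := by
  obtain ⟨l₀, hl₀⟩ : L.Nonempty := by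
    by_contra hL
    have := sum_weight hH hB x
    rw [Finset.not_nonempty_iff_eq_empty.1 hL] at this
    simp at this
  constructor
  simpa using pathMeasure_cylinder hH hB x (fun _ => ⟨l₀, hl₀⟩) 0

/-- Different words can give the same `k(ω)`, for instance after appending a full turn of the cycle.
Landing points, unlike words, index the frequencies without repetition. -/
theorem frequencies_eq_range (h : IsReduction R B L V U U') (hR : IsExpansive R) {N₁ N₂ : ℕ}
    {ρ : Fin N₁ → Fin r → ℤ} {η : Fin N₁ → Fin N₂ → Fin t → ℤ} {γ : Fin N₁ → Fin N₂ → Fin r → ℤ}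
    {s : Fin N₂ → Fin t → ℤ} (hs : IsDigitSplitting (U * R * U') (B.image fun b => U *ᵥ b)
      (L.image fun l => U'ᵀ *ᵥ l) ρ η γ s) {m : ℕ} {l : ℕ → Fin d → ℤ} {x₀ : Fin d → ℝ}
    (hC : IsCycle R L m l x₀)
    (hS : ∀ a ∈ Finset.univ.image s, ∀ a' ∈ Finset.univ.image s, ∀ z : Fin t → ℤ,
      a - a' = (U * R * U').toBlocks₂₂ᵀ *ᵥ z → a = a') (Λ₁ : Set (Fin r → ℝ)) :
    frequencies R L U U' x₀ Λ₁ = Set.range fun q : landingSet (U * R * U').toBlocks₂₂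
      (Finset.univ.image s) (fun n => secondMap U' (walk R l x₀ (n % m))) × Λ₁ =>
        realMat Uᵀ *ᵥ Sum.elim (q.2 : Fin r → ℝ) (q.1 : Fin t → ℝ) := by
  have hc := h.isPeriodicOrbit hR hs hC
  have hA := isExpansive_transpose hs.expansive₂
  ext v
  simp only [frequencies, Set.mem_ofPred_eq, Set.mem_range, secondDigits_eq hs]
  constructor
  · rintro ⟨a, ha, n, ω, hω, rfl⟩
    refine ⟨(⟨_, (hc.exists_lands_iff hA hS _).2 ⟨n, ω, hω, rfl⟩⟩, ⟨a, ha⟩), ?_⟩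
    simp only [Nat.zero_mod]
    rfl
  · rintro ⟨⟨⟨z, hz⟩, a⟩, rfl⟩
    obtain ⟨n, ω, hω, he⟩ := (hc.exists_lands_iff hA hS z).1 hz
    refine ⟨a, a.2, n, ω, hω, ?_⟩
    simp only [he, Nat.zero_mod]
    rfl

theorem hasSum_harmonic (hR : IsExpansive R) (hB : B.Nonempty) (hH : IsHadamardTriple R B L)
    {m : ℕ} {l : ℕ → Fin d → ℤ} {x₀ : Fin d → ℝ} (hC : IsCycle R L m l x₀)
    (hinv : IsInvariantSet R B L (cycleTranslates R m l x₀ V)) (h : IsReduction R B L V U U')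
    {Λ₁ : Set (Fin r → ℝ)}
    (hΛ : IsSpectrum (firstMeasure (U * R * U') (B.image fun b => U *ᵥ b)) Λ₁) (x : Fin d → ℝ) :
    HasSum (fun v : frequencies R L U U' x₀ Λ₁ =>
      ‖fourier (invariantMeasure R B) (x + v)‖ ^ 2)
      (harmonic hH hB (cycleTranslates R m l x₀ V) x) := by
  obtain ⟨N₁, N₂, ρ, η, γ, s, hBm, hLm, hh₁, hh₂⟩ := h.reducible.digits
  have hs : IsDigitSplitting (U * R * U') (B.image fun b => U *ᵥ b)
      (L.image fun l => U'ᵀ *ᵥ l) ρ η γ s :=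
    ⟨isExpansive_conj hR h.mul_inv h.inv_mul, h.reducible.block, hB.image _, hBm, hLm, hh₁, hh₂⟩
  have : NeZero N₁ := ⟨hs.pos.1.ne'⟩
  have hA := isExpansive_transpose hs.expansive₂
  have hS : ∀ a ∈ Finset.univ.image s, ∀ a' ∈ Finset.univ.image s, ∀ z : Fin t → ℤ,
      a - a' = (U * R * U').toBlocks₂₂ᵀ *ᵥ z → a = a' := by
    intro a ha a' ha' z hz
    obtain ⟨j, -, rfl⟩ := Finset.mem_image.1 ha
    obtain ⟨j', -, rfl⟩ := Finset.mem_image.1 ha'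
    rw [(hh₂ ⟨0, hs.pos.1⟩).eq_of_sub_eq hA hz]
  have hfac := h.isFactor hR hs
  have hc := h.isPeriodicOrbit hR hs hC
  rw [h.cycleTranslates_eq hC.pos] at hinv ⊢
  have hone := weight_orbit_eq_one hfac hH hB hc hA hS
    (fun y => ⟨secondSection U y, h.secondMap_secondSection y⟩) hinv
  have hno := h.reducible.no_overlap
  rw [firstMeasure, firstDigits_eq hs] at hno hΛ
  -- For each `z`, the Fourier side is evaluated at the base point shifted by `(0, z)`. The limit `G
  -- z` is at the same time the probability of the digit sequence of `z`.
  choose G hGlim hGsum using fun z : landingSet (U * R * U').toBlocks₂₂ (Finset.univ.image s)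
      (fun n => secondMap U' (walk R l x₀ (n % m))) =>
    hs.hasSum_fourier hno hΛ (realMat U'ᵀ *ᵥ x + Sum.elim (0 : Fin r → ℝ) (z : Fin t → ℝ))
  have hbasin := pathMeasure_basin hfac hH hB hc hA hS
    (fun y v hv => fiberWeight_add_latticeHull η hone y hv) (secondSection U)
    h.secondMap_secondSection x G hGlim
  have hsplit : ∀ (a : Fin r → ℝ) (y : Fin t → ℝ),
      Sum.elim (0 : Fin r → ℝ) y + Sum.elim a (0 : Fin t → ℝ) = Sum.elim a y := by
    intro a y
    ext (i | i) <;> simp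
  refine hasSum_of_tsum_ofReal (fun _ => by positivity) (measure_ne_top _ _) ?_
  rw [hbasin, frequencies_eq_range h hR hs hC hS Λ₁]
  -- Injectivity, from invertibility of `Uᵀ`, counts each frequency once and permits the double sum
  -- over `z` and `λ₁`.
  have hinj : Function.Injective fun q : landingSet (U * R * U').toBlocks₂₂
      (Finset.univ.image s) (fun n => secondMap U' (walk R l x₀ (n % m))) × Λ₁ =>
        realMat Uᵀ *ᵥ Sum.elim (q.2 : Fin r → ℝ) (q.1 : Fin t → ℝ) := by
    rintro ⟨z, a⟩ ⟨z', a'⟩ he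
    have he' := congrArg (fun v => realMat U'ᵀ *ᵥ v) he
    simp only [Matrix.mulVec_mulVec, realMat_mul_transpose h.mul_inv, Matrix.one_mulVec] at he'
    have h1 := congrArg (fun v : Fin r ⊕ Fin t → ℝ => v ∘ Sum.inl) he'
    have h2 := congrArg (fun v : Fin r ⊕ Fin t → ℝ => v ∘ Sum.inr) he'
    simp only [Sum.elim_comp_inl, Sum.elim_comp_inr] at h1 h2
    rw [Subtype.ext h1, Subtype.ext h2]
  rw [tsum_range (fun v => ENNReal.ofReal (‖fourier (invariantMeasure R B) (x + v)‖ ^ 2)) hinj,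
    ENNReal.tsum_prod']
  refine tsum_congr fun z => ?_
  rw [← (hGsum z).tsum_eq, ENNReal.ofReal_tsum_of_nonneg (fun _ => by positivity)
    (hGsum z).summable]
  refine tsum_congr fun a => ?_
  rw [← fourier_conj hR hB h.mul_inv h.inv_mul, Matrix.mulVec_add, Matrix.mulVec_mulVec,
    realMat_mul_transpose h.mul_inv, Matrix.one_mulVec, add_assoc, hsplit]

theorem exists_eq_realVec_of_mem_frequencies {x₀ : Fin d → ℝ} {Λ₁ : Set (Fin r → ℝ)}
    (hΛ : ∀ a ∈ Λ₁, ∃ z : Fin r → ℤ, a = realVec z)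
    (hy : ∃ z : Fin t → ℤ, secondPoint U' x₀ = realVec z) {v : Fin d → ℝ}
    (hv : v ∈ frequencies R L U U' x₀ Λ₁) : ∃ z : Fin d → ℤ, v = realVec z := by
  obtain ⟨a, ha, n, ω, -, rfl⟩ := hv
  obtain ⟨za, rfl⟩ := hΛ a ha
  obtain ⟨zy, hzy⟩ := hy
  set S₂ := (U * R * U')ᵀ.toBlocks₂₂
  -- All powers of `S₂` are integer matrices, so with `y₀` integral both terms of the shift are
  -- integral.
  have hsum : ∑ i : Fin n, realVec (S₂ ^ (i : ℕ) *ᵥ ω i) =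
      realVec (∑ i : Fin n, S₂ ^ (i : ℕ) *ᵥ ω i) := by
    ext j
    simp [realVec]
  refine ⟨Uᵀ *ᵥ Sum.elim za (∑ i : Fin n, S₂ ^ (i : ℕ) *ᵥ ω i - S₂ ^ n *ᵥ zy), ?_⟩
  rw [← realMat_mulVec, shift, hzy]
  congr 1
  simp only [← realMat_pow, realMat_mulVec]
  rw [hsum, ← realVec_sub]
  ext (i | i) <;> rfl

end Reduction

end

end AffineIFS

/-! ### The proposition -/

theorem proposition4p10 (d : ℕ) (R : Matrix (Fin d) (Fin d) ℤ) (B L : Finset (Fin d → ℤ))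
    (hR : AffineIFS.IsExpansive R) (h0 : (0 : Fin d → ℤ) ∈ B)
    (hH : AffineIFS.IsHadamardTriple R B L)
    -- a minimal compact invariant set `M`, a reducing subspace `V`, and a cycle such that
    -- `M` lies in the union `ℛ` of the translates of `V` along the cycle, and `ℛ` is invariant
    (M : Set (Fin d → ℝ)) (hM : AffineIFS.IsMinimalCompactInvariant R B L M)
    (V : Submodule ℝ (Fin d → ℝ)) (hV : AffineIFS.IsReducing R B L V)
    (m : ℕ) (l : ℕ → Fin d → ℤ) (x₀ : Fin d → ℝ) (hC : AffineIFS.IsCycle R L m l x₀)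
    (hMR : M ⊆ AffineIFS.cycleTranslates R m l x₀ V)
    (hinv : AffineIFS.IsInvariantSet R B L (AffineIFS.cycleTranslates R m l x₀ V)) :
    (∃ Λ : Set (Fin d → ℝ), ∀ x : Fin d → ℝ,
      HasSum (fun v : Λ => ‖AffineIFS.fourier (AffineIFS.invariantMeasure R B) (x + v)‖ ^ 2)
        (AffineIFS.harmonic hH ⟨0, h0⟩ (AffineIFS.cycleTranslates R m l x₀ V) x)) ∧
    -- every reduction of `V` and every spectrum `Λ₁` of the corresponding measure `μ₁` give
    -- such a set, which is integral as soon as `Λ₁` and `y₀` are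
    ∀ (r t : ℕ) (U : Matrix (Fin r ⊕ Fin t) (Fin d) ℤ) (U' : Matrix (Fin d) (Fin r ⊕ Fin t) ℤ),
      AffineIFS.IsReduction R B L V U U' →
      ∀ Λ₁ : Set (Fin r → ℝ),
        AffineIFS.IsSpectrum (AffineIFS.firstMeasure (U * R * U') (B.image fun b => U.mulVec b))
          Λ₁ →
        (∀ x : Fin d → ℝ,
          HasSum (fun v : AffineIFS.frequencies R L U U' x₀ Λ₁ =>
              ‖AffineIFS.fourier (AffineIFS.invariantMeasure R B) (x + v)‖ ^ 2)
            (AffineIFS.harmonic hH ⟨0, h0⟩ (AffineIFS.cycleTranslates R m l x₀ V) x)) ∧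
        ((∀ a ∈ Λ₁, ∃ z : Fin r → ℤ, a = AffineIFS.realVec z) →
          (∃ z : Fin t → ℤ, AffineIFS.secondPoint U' x₀ = AffineIFS.realVec z) →
          ∀ v ∈ AffineIFS.frequencies R L U U' x₀ Λ₁, ∃ z : Fin d → ℤ, v = AffineIFS.realVec z) := by
  refine ⟨?_, fun r t U U' hred Λ₁ hΛ => ⟨fun x =>
    AffineIFS.hasSum_harmonic hR ⟨0, h0⟩ hH hC hinv hred hΛ x, fun h1 h2 v hv =>
    AffineIFS.exists_eq_realVec_of_mem_frequencies h1 h2 hv⟩⟩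
  obtain ⟨r, t, U, U', hred⟩ := hV
  obtain ⟨Λ₁, hΛ⟩ := hred.reducible.spectral
  exact ⟨AffineIFS.frequencies R L U U' x₀ Λ₁, fun x =>
    AffineIFS.hasSum_harmonic hR ⟨0, h0⟩ hH hC hinv hred hΛ x⟩
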